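/- Let $0<T<\infty$ and let $U=\mathbb R^3/\mathbb Z^3$ (the cube $[0,1]^3$ with periodic boundary conditions). Let $f_0\in L^1(U\times\mathbb R^3)$ and $g_0\in L^1(\mathbb R^3)$ be admissible, i.e. probability densities with $\int f_0(x,v)(1+|v|^2)\,dx\,dv<\infty$, $\int g_0(v)(1+|v|^2)\,dv<\infty$ and $\operatorname{ess\,sup}_v g_0(v)(1+|v|^4)<\infty$ (representatives of $f_0,g_0$ are fixed). Write $[a]_+=\max(a,0)$ and $$\Lambda(v)=\int_{\mathbb S^2}\int_{\mathbb R^3}g_0(\bar v)[(v-\bar v)\cdot\nu]_+\,d\bar v\,d\nu,\qquad Q^+[f](x,v)=\int_{\mathbb S^2}\int_{\mathbb R^3}f(x,v')g_0(\bar v')[(v-\bar v)\cdot\nu]_+\,d\bar v\,d\nu,$$ with $v'=v+\nu\cdot(\bar v-v)\,\nu$ and $\bar v'=\bar v-\nu\cdot(\bar v-v)\,\nu$. *Linear Boltzmann equation.* Let $Af=-v\cdot\partial_xf-\Lambda f$ (in the sense of distributions) with domain $D(A)=\{f\in L^1(U\times\mathbb R^3): v\cdot\partial_xf+\Lambda f\in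 L^1(U\times\mathbb R^3)\}$, and $Bf=Q^+[f]$ with domain $D(B)=\{f\in L^1(U\times\mathbb R^3): Q^+[f]\in L^1(U\times\mathbb R^3)\}$. A mild solution of $\partial_tf_t=-v\cdot\partial_xf_t+Q^+[f_t]-\Lambda f_t$, $f_{t=0}=f_0$, is an integrable function $f:[0,T]\to L^1(U\times\mathbb R^3)$ such that for all $t\in[0,T]$: $\int_0^tf_\theta\,d\theta\in D(A)\cap D(B)$ and $(A+B)\int_0^tf_\theta\,d\theta=f_t-f_0$. *Collision trees.* Let $\mathcal{MT}$ be the set of all $\Phi=((x_0,v_0),(t_1,\nu_1,v_1),\dots,(t_n,\nu_n,v_n))$ with $n=n(\Phi)\ge0$, $(x_0,v_0)\in U\times\mathbb R^3$, $(t_j,\nu_j,v_j)\in(0,T]\times\mathbb S^2\times\mathbb R^3$ and $t_1<\dots<t_n$, with the measure $d\Phi=dx_0\,dv_0\prod_j dt_j\,d\nu_j\,dv_j$ on each set $\{n(\Phi)=n\}$. The tagged particle of $\Phi$ starts at $(x_0,v_0)$, moves by $\dot x=v$ with constant velocity between the times $t_j$, and has $v(t_j)=v(t_j^-)-\nu_j\cdot(v(t_j^-)-v_j)\,\nu_j$.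 Put $\tau(\Phi)=0$ if $n=0$. If $n\ge1$, let $(\tau,\nu,v')=(t_n,\nu_n,v_n)$ be the final collision and let $\bar\Phi$ be $\Phi$ without it. The idealized equation is $$\partial_tP_t(\Phi)=\mathcal Q_t^+[P_t](\Phi)-P_t(\Phi)\,\Lambda(v(\tau)),\qquad P_0(\Phi)=f_0(x_0,v_0)\,\mathbf 1_{n(\Phi)=0},$$ where $\mathcal Q^+_t[P_t](\Phi)=\delta(t-\tau)\,P_t(\bar\Phi)\,g_0(v')\,[(v(\tau^-)-v')\cdot\nu]_+$ if $n(\Phi)\ge1$ and $\mathcal Q^+_t[P_t](\Phi)=0$ if $n(\Phi)=0$. It is understood for each $\Phi$ in the form integrated over $[0,t]$, for all $t\in[0,T]$, the mass of $\delta(\cdot-\tau)$ being counted when $t\ge\tau$. **Theorem.** The linear Boltzmann equation has a unique mild solution $f:[0,T]\to L^1(U\times\mathbb R^3)$, and there is a solution $P:[0,T]\to L^1(\mathcal{MT})$ of the idealized equation such that for every $t\in[0,T]$ and every measurable $\Omega\subset U\times\mathbb R^3$, with $S_t(\Omega)=\{\Phi\in\mathcal{MT}:(x(t),v(t))\in\Omega\}$,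 $$\int_\Omega f_t(x,v)\,dx\,dv=\int_{S_t(\Omega)}P_t(\Phi)\,d\Phi .$$ -/

import Mathlib

open MeasureTheory Set
open scoped ContDiff

noncomputable section

namespace RayleighGas

/-- Velocity space `ℝ³`. -/
abbrev Vel : Type := EuclideanSpace ℝ (Fin 3)

/-- `U = [0,1]³` with periodic boundary conditions, with its Lebesgue (Haar) measure of mass one. -/
abbrev Torus : Type := Fin 3 → UnitAddCircle

/-- The one-particle phase space `U × ℝ³`, with Lebesgue measure `volume`. -/
abbrev Phase : Type := Torus × Vel

/-- The unit sphere `𝕊²`. -/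
abbrev Sph : Type := Metric.sphere (0 : Vel) 1

/-- Surface measure on `𝕊²` (total mass `4π`). -/
def surf : Measure Sph := (volume : Measure Vel).toSphere

/-- The projection `ℝ³ → ℝ³ / ℤ³`. -/
def toTorus (y : Vel) : Torus := fun i => (y i : UnitAddCircle)

/-- Free flow of the tagged particle: `(x, v) ↦ (x + t v, v)`. -/
def freeFlow (t : ℝ) (z : Phase) : Phase := (z.1 + toTorus (t • z.2), z.2)

/-- The cross section `[(v - w) · ν]₊`. -/
def crossSection (v w : Vel) (ν : Sph) : ℝ := max (inner ℝ (v - w) (ν : Vel)) 0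

/-! ### Admissible data -/

/-- `f₀` and `g₀` (representatives of elements of `L¹`) are admissible probability densities. -/
structure Admissible (f₀ : Phase → ℝ) (g₀ : Vel → ℝ) : Prop where
  f_integrable : Integrable f₀
  f_nonneg : ∀ᵐ z, 0 ≤ f₀ z
  f_mass : ∫ z, f₀ z = 1
  g_integrable : Integrable g₀
  g_nonneg : ∀ᵐ v, 0 ≤ g₀ v
  g_mass : ∫ v, g₀ v = 1
  f_moment : Integrable fun z : Phase => f₀ z * (1 + ‖z.2‖ ^ 2)
  g_moment : Integrable fun v : Vel => g₀ v * (1 + ‖v‖ ^ 2)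
  g_bound : ∃ C : ℝ, ∀ᵐ v, g₀ v * (1 + ‖v‖ ^ 4) ≤ C

/-! ### The linear Boltzmann equation -/

/-- `L¹(U × ℝ³)`. -/
abbrev L1 : Type := Lp ℝ 1 (volume : Measure Phase)

/-- The collision frequency `∫_{𝕊²} ∫_{ℝ³} g₀(w) [(v - w) · ν]₊ dw dν`. -/
def lossRate (g₀ : Vel → ℝ) (v : Vel) : ℝ :=
  ∫ ν, (∫ w, g₀ w * crossSection v w ν) ∂surf

/-- The integrand `f(x, v') g₀(w') [(v - w) · ν]₊` of the gain term, where
`v' = v + ν · (w - v) ν` and `w' = w - ν · (w - v) ν`. -/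
def gainIntegrand (g₀ : Vel → ℝ) (f : Phase → ℝ) (z : Phase) (ν : Sph) (w : Vel) : ℝ :=
  f (z.1, z.2 + inner ℝ (ν : Vel) (w - z.2) • (ν : Vel))
    * g₀ (w - inner ℝ (ν : Vel) (w - z.2) • (ν : Vel)) * crossSection z.2 w ν

/-- The gain term `Q⁺[f]`. -/
def gainTerm (g₀ : Vel → ℝ) (f : Phase → ℝ) (z : Phase) : ℝ :=
  ∫ ν, (∫ w, gainIntegrand g₀ f z ν w) ∂surf

/-- Test functions `C_c^∞(U × ℝ³)`, `U` the torus; smoothness is that of the periodic lift. -/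
def IsTestFunction (φ : Phase → ℝ) : Prop :=
  ContDiff ℝ ∞ (fun p : Vel × Vel => φ (toTorus p.1, p.2)) ∧ HasCompactSupport φ

/-- `v · ∂ₓ φ (x, v)`. -/
def transport (φ : Phase → ℝ) (z : Phase) : ℝ := deriv (fun s : ℝ => φ (freeFlow s z)) 0

/-- `f ∈ D(A)` and `A f = h`, that is, `-v · ∂ₓ f - Q⁻[f] = h ∈ L¹` in the sense of distributions. -/
def IsA (g₀ : Vel → ℝ) (f h : L1) : Prop :=
  ∀ φ : Phase → ℝ, IsTestFunction φ →
    ∫ z, f z * (transport φ z - lossRate g₀ z.2 * φ z) = ∫ z, h z * φ z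

/-- `f ∈ D(B)` and `B f = h`, that is, `Q⁺[f] = h ∈ L¹`, the integral defining `Q⁺[f]` being
absolutely convergent almost everywhere. -/
def IsB (g₀ : Vel → ℝ) (f h : L1) : Prop :=
  (∀ᵐ z : Phase, Integrable (fun p : Sph × Vel => gainIntegrand g₀ f z p.1 p.2)
      (surf.prod volume)) ∧
    (h : Phase → ℝ) =ᵐ[volume] gainTerm g₀ f

/-- `f ∈ D(A) ∩ D(B)` and `(A + B) f = h`. -/
def IsAPlusB (g₀ : Vel → ℝ) (f h : L1) : Prop :=
  ∃ a b : L1, IsA g₀ f a ∧ IsB g₀ f b ∧ h = a + b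

/-- `u` is a mild solution on `[0, T]` of `∂ₜ u = L u`, `u(0) = u₀`, where the operator `L` on
`L¹` is given by its graph. The time integrals are Bochner integrals in `L¹`. -/
def IsMildSolution (L : L1 → L1 → Prop) (T : ℝ) (u₀ : L1) (u : ℝ → L1) : Prop :=
  IntervalIntegrable u volume 0 T ∧
    ∀ t ∈ Icc (0 : ℝ) T, L (∫ θ in (0 : ℝ)..t, u θ) (u t - u₀)

/-! ### Collision trees -/

/-- The marker `(t_j, ν_j, v_j)` of a collision. -/
abbrev Marker : Type := ℝ × Sph × Vel

/-- The initial data `(x₀, v₀)` of the root and a list of `n` markers, for some `n`. -/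
abbrev Tree : Type := Σ n : ℕ, Phase × (Fin n → Marker)

/-- The set `MT` of collision trees: the collision times lie in `(0, T]` and the collisions are
listed in their order in time. -/
def MT (T : ℝ) : Set Tree :=
  {Φ | (∀ j, (Φ.2.2 j).1 ∈ Ioc 0 T) ∧ StrictMono fun j => (Φ.2.2 j).1}

/-- Lebesgue measure on trees: on the trees with `n` collisions it is
`dx₀ dv₀ ∏ⱼ dtⱼ dνⱼ dvⱼ`. -/
def treeMeasure : Measure Tree :=
  Measure.sum fun n : ℕ =>
    ((volume : Measure Phase).prod
      (Measure.pi fun _ : Fin n => (volume : Measure ℝ).prod (surf.prod (volume : Measure Vel)))).map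
      (Sigma.mk n)

/-- The final collision time `τ(Φ)`, which is `0` if there is no collision. -/
def finalTime : Tree → ℝ
  | ⟨0, _⟩ => 0
  | ⟨n + 1, d⟩ => (d.2 (Fin.last n)).1

/-- The pruned tree, without its final collision (a tree without collisions is left unchanged). -/
def prune : Tree → Tree
  | ⟨0, d⟩ => ⟨0, d⟩
  | ⟨n + 1, d⟩ => ⟨n, d.1, Fin.init d.2⟩

/-- The velocity `v - ν · (v - w) ν` of the tagged particle after a collision with a background
particle of velocity `w`. -/
def scatter (v : Vel) (ν : Sph) (w : Vel) : Vel := v - inner ℝ (ν : Vel) (v - w) • (ν : Vel)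

/-- The position and velocity of the tagged particle at time `t`, for `n` collisions listed in their
order in time: free flow between collisions, and `scatter` at each collision. -/
def rootAux : (n : ℕ) → Phase → (Fin n → Marker) → ℝ → Phase
  | 0, z, _, t => freeFlow t z
  | n + 1, z, m, t =>
      let last := m (Fin.last n)
      if t < last.1 then rootAux n z (Fin.init m) t
      else
        let before := rootAux n z (Fin.init m) last.1
        freeFlow (t - last.1) (before.1, scatter before.2 last.2.1 last.2.2)

/-- `(x(t), v(t))` for the tagged particle of the tree `Φ`. -/
def root (Φ : Tree) (t : ℝ) : Phase := rootAux Φ.1 Φ.2.1 Φ.2.2 t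

/-- `S_t(Ω)`: the collision trees whose tagged particle is in `Ω` at time `t`. -/
def treesIn (T t : ℝ) (Ω : Set Phase) : Set Tree := {Φ ∈ MT T | root Φ t ∈ Ω}

/-! ### The idealized equation -/

/-- The coefficient of `δ(t - τ)` in the gain term `𝒬⁺[p](Φ)`:
`p(Φ̄) g₀(v') [(v(τ⁻) - v') · ν]₊` where `(τ, ν, v')` is the final collision, and `0` if there is
no collision. The velocity `v(τ⁻)` is that of the root of the pruned tree at time `τ`. -/
def treeGain (g₀ : Vel → ℝ) (p : Tree → ℝ) : Tree → ℝ
  | ⟨0, _⟩ => 0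
  | ⟨n + 1, d⟩ =>
      let last := d.2 (Fin.last n)
      let Ψ := prune ⟨n + 1, d⟩
      p Ψ * (g₀ last.2.2 * crossSection (root Ψ last.1).2 last.2.2 last.2.1)

/-- The loss term `𝒬⁻[p](Φ) = p(Φ) ∫∫ g₀(w) [(v(τ) - w) · ν]₊ dw dν`. -/
def treeLoss (g₀ : Vel → ℝ) (p : Tree → ℝ) (Φ : Tree) : ℝ :=
  p Φ * lossRate g₀ (root Φ (finalTime Φ)).2

/-- `P : [0, T] → L¹(MT)` solves `∂ₜ P_t(Φ) = δ(t - τ) (…) - 𝒬⁻[P_t](Φ)` with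
`P₀(Φ) = f₀(x₀, v₀) 1_{n(Φ) = 0}`. Since the right-hand side is a measure in time, the equation is
read in integrated form over `[0, t]` for every `t`, so that the jump at `t = τ` is included in
`P_τ(Φ)`. -/
structure IsIdealizedSolution (f₀ : Phase → ℝ) (g₀ : Vel → ℝ) (T : ℝ) (P : ℝ → Tree → ℝ) :
    Prop where
  integrable : ∀ t ∈ Icc (0 : ℝ) T, IntegrableOn (P t) (MT T) treeMeasure
  initial : ∀ Φ ∈ MT T, P 0 Φ = if Φ.1 = 0 then f₀ Φ.2.1 else 0
  time_integrable : ∀ Φ ∈ MT T, IntervalIntegrable (fun s => P s Φ) volume 0 T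
  equation : ∀ Φ ∈ MT T, ∀ t ∈ Icc (0 : ℝ) T,
    P t Φ = P 0 Φ + (∫ s in Icc (0 : ℝ) t, treeGain g₀ (P s) Φ ∂(Measure.dirac (finalTime Φ)))
      - ∫ s in (0 : ℝ)..t, treeLoss g₀ (P s) Φ

end RayleighGas

end

noncomputable section

namespace RayleighGas

open scoped ENNReal

/-! ### Free flow -/

/-! Existence comes from expanding in the number of collisions. Particles without collision follow
damped free flow, and those with `n + 1` collisions solve Duhamel's formula with the gain of those
with `n` collisions as source. All terms are nonnegative, so the series is handled in `[0, ⊤]` with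
Tonelli, and only its convergence needs an estimate. The collision map preserves both the measure
and the cross section, which gives the adjoint of the gain term (`lintegral_gainE`). For a weight
`m` invariant under free flow with `Q⁺* m ≤ m Λ + K`, the losses at level `n` pay for the emission
at level `n + 1`, up to `K` times the mass. The sum over levels therefore telescopes
(`sum_collisionSeries_le`). The weight `1` bounds the mass. The weight `1 + |v|` bounds a first
moment, because the part of a speed gain that `m Λ` does not absorb is at most `2 |w|²`, whatever
`v` is (`norm_scatter_mul_crossSection_le`). Since `Λ ≤ C (1 + |v|)`, the total gain and loss on
`[0, t]` are finite. Testing along trajectories then shows that the sum is a mild solution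
(`isA_solution`, `isMildSolution_solution`).

Uniqueness is dissipativity of `A + B`. At almost every velocity `A` multiplies the Fourier mode `k`
in `x` by `2πi k·v - Λ(v)` (`IsA.fourier`). This identifies the resolvent with an explicit integral
along trajectories and gives `r ‖H‖ + ‖Λ H‖ ≤ ‖r H - A H‖` (`IsA.resolvent_le`). In particular `Λ H`
is integrable on all of `D(A)`. As `‖B H‖ ≤ ‖Λ H‖`, it follows that `‖H‖ ≤ ‖H - s (A + B) H‖`. The
time integral of the difference of two mild solutions then has an absolutely continuous norm with
nonpositive derivative, so it vanishes (`integral_eq_zero_of_dissipative`). The operators send `0`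
only to `0`, so the solutions agree at every time.

The idealized equation is solved explicitly, collision by collision, by a product of rates and
survival probabilities. Integrating out the last marker shows by induction that the law of the root
over the trees with `n` collisions is the `n`-th term of the series (`lintegral_treeDensityE`).
Summing over `n` compares the two descriptions. -/

instance : IsFiniteMeasure surf := by unfold surf; infer_instance

lemma continuous_toTorus : Continuous toTorus := by
  refine continuous_pi fun i => ?_
  exact (AddCircle.continuous_mk' 1).comp (by fun_prop)

lemma toTorus_add (a b : Vel) : toTorus (a + b) = toTorus a + toTorus b := by
  ext i; simp [toTorus]

lemma toTorus_zero : toTorus 0 = 0 := by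
  ext i; simp [toTorus]

lemma continuous_freeFlow : Continuous fun p : ℝ × Phase => freeFlow p.1 p.2 := by
  unfold freeFlow
  have := continuous_toTorus
  fun_prop

lemma measurable_freeFlow : Measurable fun p : ℝ × Phase => freeFlow p.1 p.2 :=
  continuous_freeFlow.measurable

@[simp] lemma freeFlow_zero (z : Phase) : freeFlow 0 z = z := by
  simp [freeFlow, toTorus_zero]

@[simp] lemma freeFlow_snd (t : ℝ) (z : Phase) : (freeFlow t z).2 = z.2 := rfl

lemma freeFlow_freeFlow (s t : ℝ) (z : Phase) :
    freeFlow s (freeFlow t z) = freeFlow (s + t) z := by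
  simp only [freeFlow, add_smul, toTorus_add, Prod.mk.injEq, and_true]
  abel

/-- At each fixed velocity the flow is a translation of the torus, so with the factors swapped it is
a skew product over the identity. -/
lemma measurePreserving_freeFlow (t : ℝ) :
    MeasurePreserving (freeFlow t) (volume : Measure Phase) volume := by
  have h2 : MeasurePreserving (fun p : Vel × Torus => ((p.1, p.2 + toTorus (t • p.1)) : Vel × Torus))
      ((volume : Measure Vel).prod (volume : Measure Torus))
      ((volume : Measure Vel).prod (volume : Measure Torus)) := by
    refine MeasurePreserving.skew_product (g := fun v x => x + toTorus (t • v))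
      (MeasurePreserving.id _) ?_ ?_
    · have := continuous_toTorus
      exact (Continuous.measurable (by fun_prop))
    · exact Filter.Eventually.of_forall fun v => map_add_right_eq_self _ _
  exact ((Measure.measurePreserving_swap (μ := (volume : Measure Vel))
    (ν := (volume : Measure Torus))).comp h2).comp Measure.measurePreserving_swap

/-! ### The collision map -/

lemma scatter_eq (v w : Vel) (ν : Sph) :
    v + inner ℝ (ν : Vel) (w - v) • (ν : Vel) = scatter v ν w := by
  rw [scatter, ← neg_sub w v, inner_neg_right, neg_smul, sub_neg_eq_add]

/-- The velocity of the background particle after a collision. -/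
def rebound (v : Vel) (ν : Sph) (w : Vel) : Vel :=
  w - inner ℝ (ν : Vel) (w - v) • (ν : Vel)

lemma inner_sph_self (ν : Sph) : inner ℝ (ν : Vel) (ν : Vel) = 1 := by
  have : ‖(ν : Vel)‖ = 1 := by simp
  rw [real_inner_self_eq_norm_sq, this]; norm_num

lemma inner_scatter (v w : Vel) (ν : Sph) :
    inner ℝ (ν : Vel) (scatter v ν w) = inner ℝ (ν : Vel) w := by
  rw [scatter, inner_sub_right, inner_smul_right, inner_sph_self, inner_sub_right]; ring

lemma inner_rebound (v w : Vel) (ν : Sph) :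
    inner ℝ (ν : Vel) (rebound v ν w) = inner ℝ (ν : Vel) v := by
  rw [rebound, inner_sub_right, inner_smul_right, inner_sph_self, inner_sub_right]; ring

lemma scatter_scatter (v w : Vel) (ν : Sph) :
    scatter (scatter v ν w) ν (rebound v ν w) = v := by
  rw [scatter, inner_sub_right, inner_scatter, inner_rebound, scatter, inner_sub_right]
  module

lemma rebound_rebound (v w : Vel) (ν : Sph) :
    rebound (scatter v ν w) ν (rebound v ν w) = w := by
  rw [rebound, inner_sub_right, inner_scatter, inner_rebound, rebound, inner_sub_right]
  module

lemma scatter_neg (v w : Vel) (ν : Sph) : scatter v (-ν) w = scatter v ν w := by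
  simp [scatter]

lemma rebound_neg (v w : Vel) (ν : Sph) : rebound v (-ν) w = rebound v ν w := by
  simp [rebound]

/-- A collision exchanges the components of the two velocities along `ν`, so the relative normal
velocity changes sign; reversing `ν` undoes this. -/
lemma crossSection_collide (v w : Vel) (ν : Sph) :
    crossSection (scatter v ν w) (rebound v ν w) (-ν) = crossSection v w ν := by
  unfold crossSection
  congr 1
  rw [real_inner_comm, real_inner_comm (ν : Vel)]
  simp only [coe_neg_sphere, inner_neg_left, inner_sub_right, inner_scatter, inner_rebound]
  ring

lemma continuous_scatter : Continuous fun p : Vel × Sph × Vel => scatter p.1 p.2.1 p.2.2 := by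
  unfold scatter; fun_prop

lemma continuous_rebound : Continuous fun p : Vel × Sph × Vel => rebound p.1 p.2.1 p.2.2 := by
  unfold rebound; fun_prop

lemma continuous_crossSection :
    Continuous fun p : Vel × Sph × Vel => crossSection p.1 p.2.2 p.2.1 := by
  unfold crossSection; fun_prop

lemma crossSection_nonneg (v w : Vel) (ν : Sph) : 0 ≤ crossSection v w ν := le_max_right _ _

lemma crossSection_le (v w : Vel) (ν : Sph) : crossSection v w ν ≤ ‖v‖ + ‖w‖ := by
  refine max_le ?_ (by positivity)
  calc inner ℝ (v - w) (ν : Vel) ≤ ‖v - w‖ * ‖(ν : Vel)‖ := real_inner_le_norm _ _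
    _ ≤ ‖v‖ + ‖w‖ := by simpa using norm_sub_le v w

/-- For a fixed direction, the collision as a linear map of the pair of velocities. -/
def collideLin (ν : Sph) : Vel × Vel →ₗ[ℝ] Vel × Vel where
  toFun p := (scatter p.1 ν p.2, rebound p.1 ν p.2)
  map_add' p q := by
    simp only [scatter, rebound, Prod.fst_add, Prod.snd_add, inner_sub_right, inner_add_right,
      Prod.mk_add_mk, Prod.mk.injEq]
    constructor <;> module
  map_smul' c p := by
    simp only [scatter, rebound, Prod.smul_fst, Prod.smul_snd, inner_sub_right, inner_smul_right,
      RingHom.id_apply, Prod.smul_mk, Prod.mk.injEq]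
    constructor <;> module

/-- The map is a linear involution, so its determinant is `1` or `-1`. -/
lemma measurePreserving_collideLin (ν : Sph) :
    MeasurePreserving (collideLin ν) ((volume : Measure Vel).prod (volume : Measure Vel))
      ((volume : Measure Vel).prod (volume : Measure Vel)) := by
  have hinv : collideLin ν ∘ₗ collideLin ν = LinearMap.id := by
    ext p <;> simp [collideLin, scatter_scatter, rebound_rebound]
  have hdet : LinearMap.det (collideLin ν) * LinearMap.det (collideLin ν) = 1 := by
    rw [← LinearMap.det_comp, hinv, LinearMap.det_id]
  have hne : LinearMap.det (collideLin ν) ≠ 0 := fun h => by simp [h] at hdet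
  refine ⟨(LinearMap.continuous_of_finiteDimensional _).measurable, ?_⟩
  rw [Measure.map_linearMap_addHaar_eq_smul_addHaar _ hne]
  have : |(LinearMap.det (collideLin ν))⁻¹| = 1 := by
    rw [abs_inv]
    rcases mul_self_eq_one_iff.1 hdet with h | h <;> simp [h]
  simp [this]

-- Surface measure is defined through the volume of cones, so the symmetry is inherited from that of
-- Lebesgue measure.
open scoped Pointwise in
lemma measurePreserving_neg_surf : MeasurePreserving (fun ν : Sph => -ν) surf surf := by
  refine ⟨continuous_neg.measurable, ?_⟩
  ext s hs
  have hm : Measurable (fun ν : Sph => -ν) := continuous_neg.measurable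
  rw [Measure.map_apply hm hs, surf, Measure.toSphere_apply' _ hs,
    Measure.toSphere_apply' _ (hm hs)]
  congr 1
  have : (Ioo (0 : ℝ) 1 • (Subtype.val '' ((fun ν : Sph => -ν) ⁻¹' s)) : Set Vel)
      = (fun v : Vel => -v) ⁻¹' (Ioo (0 : ℝ) 1 • (Subtype.val '' s)) := by
    ext v
    simp only [Set.mem_smul, mem_image, mem_preimage, Subtype.exists, exists_and_right,
      exists_eq_right]
    constructor
    · rintro ⟨r, hr, y, ⟨hy, hs⟩, rfl⟩
      exact ⟨r, hr, -y, ⟨by simpa using hy, hs⟩, by simp⟩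
    · rintro ⟨r, hr, y, ⟨hy, hs⟩, h⟩
      refine ⟨r, hr, -y, ⟨by simpa using hy, ?_⟩, by rw [smul_neg, h, neg_neg]⟩
      convert hs using 1
      ext1; simp
  rw [this]
  exact (Measure.measurePreserving_neg (volume : Measure Vel)).measure_preimage_equiv
    (f := MeasurableEquiv.neg Vel) _

/-- The measure `dx dv dν dw` on pairs of colliding particles. -/
abbrev collisionMeasure : Measure (Phase × Sph × Vel) :=
  (volume : Measure Phase).prod (surf.prod volume)

/-- The collision map, with the direction reversed, so that it preserves the cross section. -/
def collide (p : Phase × Sph × Vel) : Phase × Sph × Vel :=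
  ((p.1.1, scatter p.1.2 p.2.1 p.2.2), -p.2.1, rebound p.1.2 p.2.1 p.2.2)

lemma continuous_collide : Continuous collide := by
  have h1 := continuous_scatter
  have h2 := continuous_rebound
  unfold collide
  exact (by fun_prop : Continuous fun p : Phase × Sph × Vel => p.1.1).prodMk
    (h1.comp (by fun_prop : Continuous fun p : Phase × Sph × Vel => (p.1.2, p.2.1, p.2.2))) |>.prodMk
    ((by fun_prop : Continuous fun p : Phase × Sph × Vel => -p.2.1).prodMk
    (h2.comp (by fun_prop : Continuous fun p : Phase × Sph × Vel => (p.1.2, p.2.1, p.2.2))))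

/-- By Tonelli the position and the direction can be frozen. What remains is the linear involution
of the velocities, followed by the reflection of the sphere. -/
lemma measurePreserving_collide : MeasurePreserving collide collisionMeasure collisionMeasure := by
  refine ⟨continuous_collide.measurable, Measure.ext_of_lintegral _ fun F hF => ?_⟩
  rw [lintegral_map hF continuous_collide.measurable]
  have key : ∀ G : Phase × Sph × Vel → ℝ≥0∞, Measurable G → ∫⁻ p, G p ∂collisionMeasure
      = ∫⁻ x : Torus, ∫⁻ ν, ∫⁻ q : Vel × Vel, G ((x, q.1), ν, q.2) ∂(volume.prod volume) ∂surf := by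
    intro G hG
    rw [lintegral_prod _ hG.aemeasurable, Measure.volume_eq_prod, lintegral_prod _
      (Measurable.lintegral_prod_right' hG).aemeasurable]
    refine lintegral_congr fun x => ?_
    have h1 : ∀ v : Vel, ∫⁻ y, G ((x, v), y) ∂(surf.prod volume)
        = ∫⁻ ν, (∫⁻ w, G ((x, v), ν, w)) ∂surf := fun v =>
      lintegral_prod (fun y => G ((x, v), y)) (by fun_prop)
    simp_rw [h1]
    rw [lintegral_lintegral_swap (Measurable.aemeasurable
      (Measurable.lintegral_prod_right'
        (f := fun q : (Vel × Sph) × Vel => G ((x, q.1.1), q.1.2, q.2)) (by fun_prop)))]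
    refine lintegral_congr fun ν => ?_
    rw [lintegral_prod _ (by fun_prop)]
  rw [key (fun p => F (collide p)) (hF.comp continuous_collide.measurable), key _ hF]
  refine lintegral_congr fun x => ?_
  have h1 : ∀ ν : Sph, ∫⁻ q : Vel × Vel, F (collide ((x, q.1), ν, q.2)) ∂(volume.prod volume)
      = ∫⁻ q : Vel × Vel, F ((x, q.1), -ν, q.2) ∂(volume.prod volume) := fun ν =>
    (measurePreserving_collideLin ν).lintegral_comp
      (f := fun q : Vel × Vel => F ((x, q.1), -ν, q.2)) (by fun_prop)
  simp_rw [h1]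
  exact measurePreserving_neg_surf.lintegral_comp
    (f := fun ν => ∫⁻ q : Vel × Vel, F ((x, q.1), ν, q.2) ∂(volume.prod volume))
    (Measurable.lintegral_prod_right'
      (f := fun r : Sph × Vel × Vel => F ((x, r.2.1), r.1, r.2.2)) (by fun_prop))

section

attribute [local irreducible] crossSection scatter toTorus

/-! ### Gain and loss for nonnegative functions -/

/-- The gain term, for functions with values in `[0, ⊤]`. -/
def gainE (g : Vel → ℝ≥0∞) (f : Phase → ℝ≥0∞) (z : Phase) : ℝ≥0∞ :=
  ∫⁻ p : Sph × Vel, f (z.1, scatter z.2 p.1 p.2) * g (rebound z.2 p.1 p.2) *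
    ENNReal.ofReal (crossSection z.2 p.2 p.1) ∂(surf.prod volume)

/-- The adjoint of the gain term. -/
def adjointGainE (g : Vel → ℝ≥0∞) (ψ : Phase → ℝ≥0∞) (z : Phase) : ℝ≥0∞ :=
  ∫⁻ p : Sph × Vel, ψ (z.1, scatter z.2 p.1 p.2) * g p.2 *
    ENNReal.ofReal (crossSection z.2 p.2 p.1) ∂(surf.prod volume)

/-- The collision frequency, with values in `[0, ⊤]`. -/
def lossE (g : Vel → ℝ≥0∞) (v : Vel) : ℝ≥0∞ :=
  ∫⁻ p : Sph × Vel, g p.2 * ENNReal.ofReal (crossSection v p.2 p.1) ∂(surf.prod volume)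

@[fun_prop]
lemma measurable_scatter_comp {α : Type*} [MeasurableSpace α] {a : α → Vel} {b : α → Sph} {c : α → Vel}
    (ha : Measurable a) (hb : Measurable b) (hc : Measurable c) :
    Measurable fun x => scatter (a x) (b x) (c x) :=
  continuous_scatter.measurable.comp (ha.prodMk (hb.prodMk hc))

@[fun_prop]
lemma measurable_rebound_comp {α : Type*} [MeasurableSpace α] {a : α → Vel} {b : α → Sph} {c : α → Vel}
    (ha : Measurable a) (hb : Measurable b) (hc : Measurable c) :
    Measurable fun x => rebound (a x) (b x) (c x) :=
  continuous_rebound.measurable.comp (ha.prodMk (hb.prodMk hc))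

@[fun_prop]
lemma measurable_crossSection_comp {α : Type*} [MeasurableSpace α] {a b : α → Vel} {c : α → Sph}
    (ha : Measurable a) (hb : Measurable b) (hc : Measurable c) :
    Measurable fun x => crossSection (a x) (b x) (c x) :=
  continuous_crossSection.measurable.comp (ha.prodMk (hc.prodMk hb))

@[fun_prop]
lemma measurable_freeFlow_comp {α : Type*} [MeasurableSpace α] {a : α → ℝ} {b : α → Phase}
    (ha : Measurable a) (hb : Measurable b) : Measurable fun x => freeFlow (a x) (b x) :=
  measurable_freeFlow.comp (ha.prodMk hb)

lemma measurable_gainE {α : Type*} [MeasurableSpace α] {g : Vel → ℝ≥0∞} (hg : Measurable g)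
    {f : α → Phase → ℝ≥0∞} (hf : Measurable (Function.uncurry f)) :
    Measurable (Function.uncurry fun a => gainE g (f a)) := by
  unfold gainE
  refine Measurable.lintegral_prod_right' (f := fun q : (α × Phase) × Sph × Vel =>
    f q.1.1 (q.1.2.1, scatter q.1.2.2 q.2.1 q.2.2) *
      g (rebound q.1.2.2 q.2.1 q.2.2) *
      ENNReal.ofReal (crossSection q.1.2.2 q.2.2 q.2.1)) ?_
  have : Measurable fun q : (α × Phase) × Sph × Vel =>
      f q.1.1 (q.1.2.1, scatter q.1.2.2 q.2.1 q.2.2) :=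
    hf.comp (g := Function.uncurry f)
      (f := fun q : (α × Phase) × Sph × Vel => (q.1.1, (q.1.2.1, scatter q.1.2.2 q.2.1 q.2.2)))
      (by fun_prop)
  fun_prop

lemma measurable_adjointGainE {g : Vel → ℝ≥0∞} (hg : Measurable g)
    {f : Phase → ℝ≥0∞} (hf : Measurable f) : Measurable (adjointGainE g f) := by
  unfold adjointGainE
  exact Measurable.lintegral_prod_right' (f := fun q : Phase × Sph × Vel =>
    f (q.1.1, scatter q.1.2 q.2.1 q.2.2) * g q.2.2 *
      ENNReal.ofReal (crossSection q.1.2 q.2.2 q.2.1)) (by fun_prop)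

lemma measurable_lossE {g : Vel → ℝ≥0∞} (hg : Measurable g) : Measurable (lossE g) := by
  unfold lossE
  exact Measurable.lintegral_prod_right' (f := fun q : Vel × Sph × Vel =>
    g q.2.2 * ENNReal.ofReal (crossSection q.1 q.2.2 q.2.1)) (by fun_prop)

/-- Substituting `collide` exchanges the velocities before and after the collision and leaves the
cross section unchanged. With `ψ = 1` this says that total gain equals total loss. -/
lemma lintegral_gainE {g : Vel → ℝ≥0∞} (hg : Measurable g) {f ψ : Phase → ℝ≥0∞}
    (hf : Measurable f) (hψ : Measurable ψ) :
    ∫⁻ z, ψ z * gainE g f z = ∫⁻ z, f z * adjointGainE g ψ z := by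
  have h1 : ∫⁻ z, ψ z * gainE g f z = ∫⁻ q : Phase × Sph × Vel,
      ψ q.1 * (f (q.1.1, scatter q.1.2 q.2.1 q.2.2) *
      g (rebound q.1.2 q.2.1 q.2.2) *
      ENNReal.ofReal (crossSection q.1.2 q.2.2 q.2.1)) ∂collisionMeasure := by
    rw [lintegral_prod _ (by fun_prop)]
    refine lintegral_congr fun z => ?_
    rw [gainE, ← lintegral_const_mul _ (by fun_prop)]
  have h2 : ∫⁻ z, f z * adjointGainE g ψ z = ∫⁻ q : Phase × Sph × Vel,
      f q.1 * (ψ (q.1.1, scatter q.1.2 q.2.1 q.2.2) * g q.2.2 *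
      ENNReal.ofReal (crossSection q.1.2 q.2.2 q.2.1)) ∂collisionMeasure := by
    rw [lintegral_prod _ (by fun_prop)]
    refine lintegral_congr fun z => ?_
    rw [adjointGainE, ← lintegral_const_mul _ (by fun_prop)]
  rw [h1, h2, ← measurePreserving_collide.lintegral_comp (by fun_prop)]
  refine lintegral_congr fun q => ?_
  simp only [collide, scatter_neg, rebound_neg, crossSection_collide, scatter_scatter,
    rebound_rebound]
  ring

lemma adjointGainE_one (g : Vel → ℝ≥0∞) (z : Phase) : adjointGainE g 1 z = lossE g z.2 := by
  simp [adjointGainE, lossE]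

/-- Let `a`, `b` be the components of `v`, `w` along `ν`, so that `|v'|² = |v|² - a² + b²`. The
speed can only grow if `|a| < |b|`; then it grows by at most `|b|` and the cross section is at most
`2|b|`. The error is thus quadratic in `w` and free of `v`. -/
lemma norm_scatter_mul_crossSection_le (v w : Vel) (ν : Sph) :
    (1 + ‖scatter v ν w‖) * crossSection v w ν
      ≤ (1 + ‖v‖) * crossSection v w ν + 2 * ‖w‖ ^ 2 := by
  set a := inner ℝ (ν : Vel) v with ha
  set b := inner ℝ (ν : Vel) w with hb
  have hbw : |b| ≤ ‖w‖ := by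
    simpa using abs_real_inner_le_norm (ν : Vel) w
  have hcs : crossSection v w ν = max (a - b) 0 := by
    rw [crossSection, real_inner_comm, inner_sub_right]
  have hsq : ‖scatter v ν w‖ ^ 2 = ‖v‖ ^ 2 - a ^ 2 + b ^ 2 := by
    rw [scatter, norm_sub_sq_real, inner_smul_right, norm_smul, real_inner_comm (ν : Vel) v, ← ha,
      inner_sub_right, ← ha, ← hb]
    simp only [norm_eq_of_mem_sphere, mul_one, Real.norm_eq_abs, sq_abs]
    ring
  have h0 := crossSection_nonneg v w ν
  have hw2 : b ^ 2 ≤ ‖w‖ ^ 2 := by rw [← sq_abs b]; gcongr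
  rcases le_or_gt (b ^ 2) (a ^ 2) with h | h
  · have : ‖scatter v ν w‖ ≤ ‖v‖ := by
      refine le_of_sq_le_sq ?_ (norm_nonneg _)
      rw [hsq]; linarith
    nlinarith [sq_nonneg ‖w‖]
  · have h1 : ‖scatter v ν w‖ ≤ ‖v‖ + |b| := by
      refine le_of_sq_le_sq ?_ (by positivity)
      rw [hsq]
      nlinarith [sq_abs b, abs_nonneg b, norm_nonneg v, sq_nonneg a]
    have h2 : crossSection v w ν ≤ 2 * |b| := by
      rw [hcs]
      refine max_le ?_ (by positivity)
      have := sq_lt_sq.1 h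
      have := abs_le.1 this.le
      have := neg_abs_le b
      linarith
    nlinarith [sq_abs b, abs_nonneg b, mul_le_mul_of_nonneg_right h1 h0,
      mul_le_mul_of_nonneg_left h2 (abs_nonneg b)]

/-- The weight `1 + |v|`. -/
def velWeight (z : Phase) : ℝ≥0∞ := ENNReal.ofReal (1 + ‖z.2‖)

@[fun_prop]
lemma measurable_velWeight : Measurable velWeight := by unfold velWeight; fun_prop

/-- A bound for the rate of creation of `velWeight` by collisions. -/
def weightRate (g : Vel → ℝ≥0∞) : ℝ≥0∞ :=
  ∫⁻ p : Sph × Vel, g p.2 * ENNReal.ofReal (2 * ‖p.2‖ ^ 2) ∂(surf.prod volume)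

lemma adjointGainE_velWeight_le {g : Vel → ℝ≥0∞} (hg : Measurable g) (z : Phase) :
    adjointGainE g velWeight z ≤ velWeight z * lossE g z.2 + weightRate g := by
  rw [lossE, weightRate, ← lintegral_const_mul _ (by fun_prop), ← lintegral_add_left (by fun_prop)]
  refine lintegral_mono fun p => ?_
  dsimp only
  rw [mul_assoc, mul_left_comm, mul_left_comm (velWeight z), ← mul_add]
  gcongr
  rw [velWeight, velWeight, ← ENNReal.ofReal_mul (by positivity),
    ← ENNReal.ofReal_mul (by positivity), ← ENNReal.ofReal_add
      (mul_nonneg (by positivity) (crossSection_nonneg _ _ _)) (by positivity)]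
  exact ENNReal.ofReal_le_ofReal (norm_scatter_mul_crossSection_le _ _ _)

lemma lossE_le {g : Vel → ℝ≥0∞} (hg : Measurable g) (v : Vel) :
    lossE g v ≤ ENNReal.ofReal (1 + ‖v‖) *
      ∫⁻ p : Sph × Vel, g p.2 * ENNReal.ofReal (1 + ‖p.2‖) ∂(surf.prod volume) := by
  rw [lossE, ← lintegral_const_mul _ (by fun_prop)]
  refine lintegral_mono fun p => ?_
  dsimp only
  rw [mul_left_comm, ← ENNReal.ofReal_mul (by positivity)]
  gcongr
  have := crossSection_le v p.2 p.1
  nlinarith [norm_nonneg v, norm_nonneg p.2]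

/-- The background density as a measurable function `g` with values in `[0, ⊤)`, with the finite
moments that the linear Boltzmann equation needs. -/
structure IsBackground (g₀ : Vel → ℝ) (g : Vel → ℝ≥0∞) : Prop where
  measurable : Measurable g
  ne_top : ∀ v, g v ≠ ⊤
  ae_eq : ∀ᵐ v, g₀ v = (g v).toReal
  loss : ∀ v, ENNReal.ofReal (lossRate g₀ v) = lossE g v
  loss_nonneg : ∀ v, 0 ≤ lossRate g₀ v
  loss_le : ∃ C : ℝ, ∀ v, lossRate g₀ v ≤ C * (1 + ‖v‖)
  weightRate_ne_top : weightRate g ≠ ⊤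

/-- Changing `g₀` on a null set does not affect `lossRate` at any velocity, since `g₀` enters it
only under an integral. The second moment of `g₀` and the finiteness of `surf` give the remaining
bounds. -/
lemma exists_isBackground {g₀ : Vel → ℝ} (hg : Integrable g₀) (hg0 : ∀ᵐ v, 0 ≤ g₀ v)
    (hm : Integrable fun v : Vel => g₀ v * (1 + ‖v‖ ^ 2)) : ∃ g, IsBackground g₀ g := by
  obtain ⟨g', hg', hgg'⟩ := hg.aemeasurable
  set g : Vel → ℝ≥0∞ := fun v => ENNReal.ofReal (g' v) with hgdef
  have gm : Measurable g := by fun_prop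
  have hae : ∀ᵐ v, g₀ v = (g v).toReal := by
    filter_upwards [hgg', hg0] with v h1 h2
    rw [hgdef, ENNReal.toReal_ofReal (h1 ▸ h2), h1]
  have hgE : ∀ᵐ v, g v = ENNReal.ofReal (g₀ v) := by
    filter_upwards [hgg'] with v h1
    rw [hgdef, h1]
  have hmom : ∫⁻ v, g v * ENNReal.ofReal (1 + ‖v‖ ^ 2) < ⊤ := by
    have := hm.lintegral_lt_top
    refine lt_of_le_of_lt (le_of_eq (lintegral_congr_ae ?_)) this
    filter_upwards [hgE, hg0] with v h1 h2
    rw [h1, ENNReal.ofReal_mul h2]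
  have hprod : ∀ a : Vel → ℝ≥0∞, Measurable a → ∫⁻ p : Sph × Vel, g p.2 * a p.2 ∂(surf.prod volume)
      = (∫⁻ v, g v * a v) * surf univ := fun a ha => by
    rw [lintegral_prod _ (by fun_prop)]
    simp only [lintegral_const]
  have hW : ∀ a : Vel → ℝ, Measurable a → ∀ c : ℝ, 0 ≤ c → (∀ v, a v ≤ c * (1 + ‖v‖ ^ 2)) →
      ∫⁻ p : Sph × Vel, g p.2 * ENNReal.ofReal (a p.2) ∂(surf.prod volume) < ⊤ := by
    intro a ha c hc hac
    rw [hprod (fun v => ENNReal.ofReal (a v)) (by fun_prop)]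
    refine ENNReal.mul_lt_top ?_ (measure_lt_top _ _)
    calc ∫⁻ v, g v * ENNReal.ofReal (a v)
        ≤ ∫⁻ v, ENNReal.ofReal c * (g v * ENNReal.ofReal (1 + ‖v‖ ^ 2)) := by
          refine lintegral_mono fun v => ?_
          dsimp only
          rw [mul_left_comm, ← ENNReal.ofReal_mul hc]
          gcongr
          exact hac v
      _ < ⊤ := by
          rw [lintegral_const_mul _ (by fun_prop)]
          exact ENNReal.mul_lt_top ENNReal.ofReal_lt_top hmom
  -- The constant `2` comes from `1 + x ≤ 2 (1 + x²)`, which follows from `(x - 1)² ≥ 0`.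
  have hM := hW (fun v => 1 + ‖v‖) (by fun_prop) 2 (by norm_num)
    (fun v => by nlinarith [sq_nonneg (‖v‖ - 1)])
  set M := ∫⁻ p : Sph × Vel, g p.2 * ENNReal.ofReal (1 + ‖p.2‖) ∂(surf.prod volume) with hMdef
  have hlt : ∀ v, lossE g v < ⊤ := fun v =>
    (lossE_le gm v).trans_lt (ENNReal.mul_lt_top ENNReal.ofReal_lt_top hM)
  have hloss : ∀ v, lossRate g₀ v = (lossE g v).toReal := by
    intro v
    have hi : ∀ ν : Sph, ∫ w, g₀ w * crossSection v w ν
        = (∫⁻ w, g w * ENNReal.ofReal (crossSection v w ν)).toReal := by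
      intro ν
      rw [integral_eq_lintegral_of_nonneg_ae]
      · congr 1
        refine lintegral_congr_ae ?_
        filter_upwards [hgE, hg0] with w h1 h2
        rw [h1, ENNReal.ofReal_mul h2]
      · filter_upwards [hg0] with w h2
        exact mul_nonneg h2 (crossSection_nonneg _ _ _)
      · exact hg.aestronglyMeasurable.mul
          (measurable_crossSection_comp measurable_const measurable_id measurable_const).aestronglyMeasurable
    have hprod' : lossE g v
        = ∫⁻ ν, (∫⁻ w, g w * ENNReal.ofReal (crossSection v w ν)) ∂surf := by
      rw [lossE, lintegral_prod _ (by fun_prop)]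
    have hmeas : Measurable fun ν : Sph => ∫⁻ w, g w * ENNReal.ofReal (crossSection v w ν) :=
      Measurable.lintegral_prod_right' (f := fun q : Sph × Vel =>
        g q.2 * ENNReal.ofReal (crossSection v q.2 q.1)) (by fun_prop)
    rw [lossRate]
    simp_rw [hi]
    rw [hprod', integral_toReal hmeas.aemeasurable]
    exact ae_lt_top hmeas (hprod' ▸ (hlt v).ne)
  refine ⟨g, gm, fun v => ENNReal.ofReal_ne_top, hae, fun v => ?_, fun v => ?_,
    ⟨M.toReal, fun v => ?_⟩, ?_⟩
  · rw [hloss, ENNReal.ofReal_toReal (hlt v).ne]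
  · rw [hloss]; positivity
  · rw [hloss, mul_comm]
    have := ENNReal.toReal_mono (ENNReal.mul_lt_top ENNReal.ofReal_lt_top hM).ne (lossE_le gm v)
    rwa [ENNReal.toReal_mul, ENNReal.toReal_ofReal (by positivity)] at this
  · exact (hW (fun v => 2 * ‖v‖ ^ 2) (by fun_prop) 2 (by norm_num)
      (fun v => by nlinarith [sq_nonneg ‖v‖])).ne

lemma IsBackground.measurable_loss {g₀ : Vel → ℝ} {g : Vel → ℝ≥0∞} (h : IsBackground g₀ g) :
    Measurable (lossRate g₀) := by
  have : lossRate g₀ = fun v => (lossE g v).toReal := by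
    ext v
    rw [← h.loss, ENNReal.toReal_ofReal (h.loss_nonneg v)]
  rw [this]
  exact (measurable_lossE h.measurable).ennreal_toReal

/-! ### Transport with damping -/

/-- The probability `exp (- t L(v))` of no collision during a time `t`. -/
def damp (L : Vel → ℝ) (t : ℝ) (v : Vel) : ℝ≥0∞ := ENNReal.ofReal (Real.exp (-(t * L v)))

/-- Damped free transport of the density `f`. -/
def freeE (L : Vel → ℝ) (f : Phase → ℝ≥0∞) (t : ℝ) (z : Phase) : ℝ≥0∞ :=
  damp L t z.2 * f (freeFlow (-t) z)

/-- Damped free transport of a source `q`. -/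
def duhamelE (L : Vel → ℝ) (q : ℝ → Phase → ℝ≥0∞) (t : ℝ) (z : Phase) : ℝ≥0∞ :=
  ∫⁻ s in Ioc 0 t, freeE L (q s) (t - s) z

/-- Data `f` at time zero, as a measure on space-time. -/
def initMeasure (f : Phase → ℝ≥0∞) : Measure (ℝ × Phase) :=
  (Measure.dirac 0).prod (volume.withDensity f)

/-- A source `q` in positive time, as a measure on space-time. -/
def sourceMeasure (q : ℝ → Phase → ℝ≥0∞) : Measure (ℝ × Phase) :=
  ((volume.restrict (Ioi 0)).prod volume).withDensity (Function.uncurry q)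

/-- `u t` is at each time `t ≥ 0` the density of the particles emitted by `ρ` up to time `t`, which
move freely and survive for a time `s` with probability `exp (- s L(v))`. -/
def Evolves (L : Vel → ℝ) (ρ : Measure (ℝ × Phase)) (u : ℝ → Phase → ℝ≥0∞) : Prop :=
  ∀ t, 0 ≤ t → ∀ ψ : Phase → ℝ≥0∞, Measurable ψ → ∫⁻ z, ψ z * u t z =
    ∫⁻ p in {p | p.1 ≤ t}, damp L (t - p.1) p.2.2 * ψ (freeFlow (t - p.1) p.2) ∂ρ

lemma measurable_damp {α : Type*} [MeasurableSpace α] {L : Vel → ℝ} (hL : Measurable L)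
    {a : α → ℝ} {b : α → Vel} (ha : Measurable a) (hb : Measurable b) :
    Measurable fun x => damp L (a x) (b x) := by
  unfold damp; fun_prop

lemma measurable_freeE {α : Type*} [MeasurableSpace α] {L : Vel → ℝ} (hL : Measurable L)
    {q : α → Phase → ℝ≥0∞} (hq : Measurable (Function.uncurry q)) {a : α → ℝ} {b : α → Phase}
    (ha : Measurable a) (hb : Measurable b) :
    Measurable fun x => freeE L (q x) (a x) (b x) := by
  unfold freeE
  refine (measurable_damp hL ha hb.snd).mul ?_
  exact hq.comp (g := Function.uncurry q) (f := fun x => (x, freeFlow (-(a x)) (b x)))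
    (measurable_id.prodMk (measurable_freeFlow_comp ha.neg hb))

lemma measurableSet_fst_le (t : ℝ) : MeasurableSet {p : ℝ × Phase | p.1 ≤ t} :=
  measurableSet_le measurable_fst measurable_const

lemma lintegral_initMeasure {f : Phase → ℝ≥0∞} (hf : Measurable f) {F : ℝ × Phase → ℝ≥0∞}
    (hF : Measurable F) {t : ℝ} (ht : 0 ≤ t) :
    ∫⁻ p in {p | p.1 ≤ t}, F p ∂(initMeasure f) = ∫⁻ z, f z * F (0, z) := by
  rw [← lintegral_indicator (measurableSet_fst_le t), initMeasure, Measure.dirac_prod,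
    lintegral_map (hF.indicator (measurableSet_fst_le t)) (by fun_prop),
    lintegral_withDensity_eq_lintegral_mul _ hf
      (g := fun z => {p : ℝ × Phase | p.1 ≤ t}.indicator F (0, z))
      ((hF.indicator (measurableSet_fst_le t)).comp (by fun_prop))]
  simp [indicator, ht]

lemma lintegral_sourceMeasure {q : ℝ → Phase → ℝ≥0∞} (hq : Measurable (Function.uncurry q))
    {F : ℝ × Phase → ℝ≥0∞} (hF : Measurable F) (t : ℝ) :
    ∫⁻ p in {p | p.1 ≤ t}, F p ∂(sourceMeasure q)
      = ∫⁻ s in Ioc 0 t, ∫⁻ z, q s z * F (s, z) := by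
  rw [← lintegral_indicator (measurableSet_fst_le t), sourceMeasure,
    lintegral_withDensity_eq_lintegral_mul _ hq (hF.indicator (measurableSet_fst_le t)),
    lintegral_prod _ (hq.mul (hF.indicator (measurableSet_fst_le t))).aemeasurable,
    ← lintegral_indicator measurableSet_Ioi, ← lintegral_indicator measurableSet_Ioc]
  refine lintegral_congr fun s => ?_
  by_cases h0 : 0 < s <;> by_cases h1 : s ≤ t <;> simp [indicator, h0, h1, Function.uncurry]

lemma evolves_freeE {L : Vel → ℝ} (hL : Measurable L) {f : Phase → ℝ≥0∞} (hf : Measurable f) :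
    Evolves L (initMeasure f) (freeE L f) := by
  intro t ht ψ hψ
  have := measurable_damp hL (a := fun p : ℝ × Phase => t - p.1) (b := fun p => p.2.2)
    (by fun_prop) (by fun_prop)
  rw [lintegral_initMeasure hf (by fun_prop) ht,
    ← (measurePreserving_freeFlow t).lintegral_comp (f := fun z => ψ z * freeE L f t z) (hψ.mul
      (measurable_freeE (q := fun _ : Phase => f) hL (by fun_prop) measurable_const measurable_id))]
  refine lintegral_congr fun z => ?_
  simp only [freeE, freeFlow_freeFlow, freeFlow_snd, neg_add_cancel, freeFlow_zero, sub_zero]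
  ring

lemma evolves_duhamelE {L : Vel → ℝ} (hL : Measurable L) {q : ℝ → Phase → ℝ≥0∞}
    (hq : Measurable (Function.uncurry q)) : Evolves L (sourceMeasure q) (duhamelE L q) := by
  intro t ht ψ hψ
  have hd := measurable_damp hL (a := fun p : ℝ × Phase => t - p.1) (b := fun p => p.2.2)
    (by fun_prop) (by fun_prop)
  have hm : Measurable fun p : Phase × ℝ => freeE L (q p.2) (t - p.2) p.1 :=
    measurable_freeE hL (q := fun p : Phase × ℝ => q p.2)
      (hq.comp (g := Function.uncurry q)
        (f := fun x : (Phase × ℝ) × Phase => (x.1.2, x.2)) (by fun_prop)) (by fun_prop) (by fun_prop)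
  rw [lintegral_sourceMeasure hq (by fun_prop)]
  calc ∫⁻ z, ψ z * duhamelE L q t z
      = ∫⁻ z, ∫⁻ s in Ioc 0 t, ψ z * freeE L (q s) (t - s) z := by
        refine lintegral_congr fun z => ?_
        rw [duhamelE, lintegral_const_mul]
        exact hm.comp (f := fun s : ℝ => (z, s)) (by fun_prop)
    _ = ∫⁻ s in Ioc 0 t, ∫⁻ z, ψ z * freeE L (q s) (t - s) z := by
        rw [lintegral_lintegral_swap]
        exact ((hψ.comp measurable_fst).mul hm).aemeasurable
    _ = _ := by
        refine setLIntegral_congr_fun measurableSet_Ioc fun s hs => ?_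
        have hqs : Measurable (q s) := hq.comp (f := fun z : Phase => (s, z)) (by fun_prop)
        have := evolves_freeE hL hqs (t - s) (by linarith [hs.2]) ψ hψ
        have hd' := measurable_damp hL (a := fun p : ℝ × Phase => t - s - p.1) (b := fun p => p.2.2)
          (by fun_prop) (by fun_prop)
        rw [lintegral_initMeasure hqs (by fun_prop) (by linarith [hs.2])] at this
        simpa using this

lemma Evolves.add {L : Vel → ℝ} {ρ₁ ρ₂ : Measure (ℝ × Phase)} {u₁ u₂ : ℝ → Phase → ℝ≥0∞}
    (h₁ : Evolves L ρ₁ u₁) (h₂ : Evolves L ρ₂ u₂) (hu : ∀ t, Measurable (u₁ t)) :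
    Evolves L (ρ₁ + ρ₂) (fun t z => u₁ t z + u₂ t z) := by
  intro t ht ψ hψ
  simp_rw [mul_add]
  have := hu t
  rw [lintegral_add_left (by fun_prop), h₁ t ht ψ hψ, h₂ t ht ψ hψ, Measure.restrict_add,
    lintegral_add_measure]

instance (f : Phase → ℝ≥0∞) : SFinite (initMeasure f) := by unfold initMeasure; infer_instance

instance (q : ℝ → Phase → ℝ≥0∞) : SFinite (sourceMeasure q) := by
  unfold sourceMeasure; infer_instance

lemma initMeasure_fst_neg (f : Phase → ℝ≥0∞) : ∀ᵐ p ∂initMeasure f, 0 ≤ p.1 := by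
  have : MeasurableSet {p : ℝ × Phase | 0 ≤ p.1} := measurableSet_le measurable_const measurable_fst
  rw [initMeasure, Measure.dirac_prod, ae_map_iff (by fun_prop) this]
  simp

lemma sourceMeasure_fst_neg (q : ℝ → Phase → ℝ≥0∞) : ∀ᵐ p ∂sourceMeasure q, 0 ≤ p.1 := by
  refine (withDensity_absolutelyContinuous _ _).ae_le ?_
  have h : ∀ᵐ s : ℝ ∂(volume.restrict (Ioi 0)), 0 ≤ s :=
    (ae_restrict_mem measurableSet_Ioi).mono fun s hs => le_of_lt hs
  exact Measure.quasiMeasurePreserving_fst.ae h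

lemma lintegral_damp {c r t : ℝ} (hc : 0 ≤ c) (hr : 0 ≤ r) (hrt : r ≤ t) :
    ∫⁻ s in Ioc 0 t, (if r ≤ s then
      ENNReal.ofReal c * ENNReal.ofReal (Real.exp (-((s - r) * c))) else 0)
      = ENNReal.ofReal (1 - Real.exp (-((t - r) * c))) := by
  have h1 : ∫⁻ s in Ioc 0 t, (if r ≤ s then
      ENNReal.ofReal c * ENNReal.ofReal (Real.exp (-((s - r) * c))) else 0)
      = ∫⁻ s in Ioc r t, ENNReal.ofReal (c * Real.exp (-((s - r) * c))) := by
    rw [← lintegral_indicator measurableSet_Ioc, ← lintegral_indicator measurableSet_Ioc]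
    refine lintegral_congr_ae ?_
    -- The two integrands can differ only at the null point `s = r`.
    filter_upwards [Measure.ae_ne volume r] with s hs
    simp only [← ENNReal.ofReal_mul hc]
    rcases lt_trichotomy r s with h | h | h
    · simp [indicator, h, h.le, hr.trans_lt h]
    · exact absurd h.symm hs
    · simp [indicator, h.not_ge, h.not_gt]
  have hcont : Continuous fun s : ℝ => c * Real.exp (-((s - r) * c)) := by fun_prop
  rw [h1, ← ofReal_integral_eq_lintegral_ofReal, ← intervalIntegral.integral_of_le hrt]
  · congr 1
    have hd : ∀ s ∈ uIcc r t, HasDerivAt (fun s : ℝ => -Real.exp (-((s - r) * c)))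
        (c * Real.exp (-((s - r) * c))) s := by
      intro s _
      have : HasDerivAt (fun s : ℝ => -((s - r) * c)) (-(1 * c)) s :=
        (((hasDerivAt_id s).sub_const r).mul_const c).neg
      exact this.exp.neg.congr_deriv (by ring)
    rw [intervalIntegral.integral_eq_sub_of_hasDerivAt hd (hcont.intervalIntegrable _ _)]
    simp only [sub_self, zero_mul, neg_zero, Real.exp_zero]
    ring
  · exact (hcont.intervalIntegrable r t).1
  · exact Filter.Eventually.of_forall fun s => mul_nonneg hc (Real.exp_nonneg _)

/-- Particles emitted up to time `t` have either survived or been lost. -/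
lemma Evolves.balance {L : Vel → ℝ} (hL : Measurable L) (hL0 : ∀ v, 0 ≤ L v)
    {ρ : Measure (ℝ × Phase)} [SFinite ρ] (hρ : ∀ᵐ p ∂ρ, 0 ≤ p.1) {u : ℝ → Phase → ℝ≥0∞}
    (h : Evolves L ρ u) {m : Phase → ℝ≥0∞} (hm : Measurable m)
    (hinv : ∀ s z, m (freeFlow s z) = m z) {t : ℝ} (ht : 0 ≤ t) :
    (∫⁻ z, m z * u t z) + ∫⁻ s in Ioc 0 t, ∫⁻ z, (m z * ENNReal.ofReal (L z.2)) * u s z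
      = ∫⁻ p in {p | p.1 ≤ t}, m p.2 ∂ρ := by
  have h1 : ∫⁻ s in Ioc 0 t, ∫⁻ z, (m z * ENNReal.ofReal (L z.2)) * u s z
      = ∫⁻ s in Ioc 0 t, ∫⁻ p, m p.2 * (if p.1 ≤ s then
        ENNReal.ofReal (L p.2.2) * damp L (s - p.1) p.2.2 else 0) ∂ρ := by
    refine setLIntegral_congr_fun measurableSet_Ioc fun s hs => ?_
    rw [h s hs.1.le (fun z => m z * ENNReal.ofReal (L z.2)) (by fun_prop),
      ← lintegral_indicator (measurableSet_fst_le s)]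
    refine lintegral_congr fun p => ?_
    by_cases hp : p.1 ≤ s
    · simp [indicator, hp, hinv]; ring
    · simp [indicator, hp]
  have hd := measurable_damp hL (a := fun q : ℝ × ℝ × Phase => q.1 - q.2.1) (b := fun q => q.2.2.2)
    (by fun_prop) (by fun_prop)
  have hmeas : Measurable fun q : ℝ × ℝ × Phase => (if q.2.1 ≤ q.1 then
      ENNReal.ofReal (L q.2.2.2) * damp L (q.1 - q.2.1) q.2.2.2 else 0) :=
    Measurable.ite (measurableSet_le (by fun_prop) (by fun_prop)) (by fun_prop) measurable_const
  -- After Tonelli the identity holds particle by particle: a particle emitted at time `r ≤ t`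
  -- survives to `t` with probability `exp (-(t - r) L)` and is lost before with the complementary
  -- one, computed in `lintegral_damp`.
  rw [h1, lintegral_lintegral_swap (by fun_prop), h t ht m hm,
    ← lintegral_indicator (measurableSet_fst_le t), ← lintegral_indicator (measurableSet_fst_le t),
    ← lintegral_add_left]
  · refine lintegral_congr_ae ?_
    filter_upwards [hρ] with p hp
    have hmeas' : Measurable fun s : ℝ => (if p.1 ≤ s then
      ENNReal.ofReal (L p.2.2) * damp L (s - p.1) p.2.2 else 0) :=
      hmeas.comp (f := fun s : ℝ => (s, p)) (by fun_prop)
    rw [lintegral_const_mul _ hmeas']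
    by_cases hpt : p.1 ≤ t
    · have := lintegral_damp (hL0 p.2.2) hp hpt
      simp only [indicator, mem_ofPred_eq, hpt, if_true, hinv, damp] at this ⊢
      rw [this, mul_comm, ← mul_add, ← ENNReal.ofReal_add (Real.exp_nonneg _)]
      · simp
      · rw [sub_nonneg, Real.exp_le_one_iff, neg_nonpos]
        exact mul_nonneg (by linarith) (hL0 _)
    · have : ∫⁻ s in Ioc 0 t, (if p.1 ≤ s then
          ENNReal.ofReal (L p.2.2) * damp L (s - p.1) p.2.2 else 0) = 0 := by
        rw [setLIntegral_congr_fun measurableSet_Ioc (g := fun _ => 0)]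
        · simp
        · intro s hs
          have : ¬ p.1 ≤ s := fun h => hpt (h.trans hs.2)
          simp [this]
      simp [indicator, hpt, this]
  · have := measurable_damp hL (a := fun p : ℝ × Phase => t - p.1) (b := fun p => p.2.2)
      (by fun_prop) (by fun_prop)
    exact Measurable.indicator (by fun_prop) (measurableSet_fst_le t)

/-! ### The series of solutions with `n` collisions -/

/-- The density of the tagged particles with exactly `n` collisions before time `t`. -/
def collisionSeries (L : Vel → ℝ) (g : Vel → ℝ≥0∞) (f : Phase → ℝ≥0∞) :
    ℕ → ℝ → Phase → ℝ≥0∞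
  | 0 => freeE L f
  | n + 1 => duhamelE L fun s => gainE g (collisionSeries L g f n s)

lemma measurable_duhamelE {L : Vel → ℝ} (hL : Measurable L) {q : ℝ → Phase → ℝ≥0∞}
    (hq : Measurable (Function.uncurry q)) : Measurable (Function.uncurry (duhamelE L q)) := by
  have h1 : Measurable fun p : (ℝ × Phase) × ℝ => freeE L (q p.2) (p.1.1 - p.2) p.1.2 :=
    measurable_freeE hL (q := fun p : (ℝ × Phase) × ℝ => q p.2)
      (hq.comp (g := Function.uncurry q)
        (f := fun x : ((ℝ × Phase) × ℝ) × Phase => (x.1.2, x.2)) (by fun_prop))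
      (by fun_prop) (by fun_prop)
  have hS : MeasurableSet {p : (ℝ × Phase) × ℝ | 0 < p.2 ∧ p.2 ≤ p.1.1} :=
    (measurableSet_lt measurable_const measurable_snd).inter
      (measurableSet_le measurable_snd measurable_fst.fst)
  convert (h1.indicator hS).lintegral_prod_right' (ν := volume) using 1
  ext ⟨t, z⟩
  simp only [Function.uncurry, duhamelE]
  rw [← lintegral_indicator measurableSet_Ioc]
  rfl

lemma measurable_collisionSeries {L : Vel → ℝ} (hL : Measurable L) {g : Vel → ℝ≥0∞}
    (hg : Measurable g) {f : Phase → ℝ≥0∞} (hf : Measurable f) (n : ℕ) :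
    Measurable (Function.uncurry (collisionSeries L g f n)) := by
  induction n with
  | zero =>
    exact measurable_freeE hL (q := fun _ : ℝ × Phase => f) (a := fun p => p.1) (b := fun p => p.2)
      (by fun_prop) (by fun_prop) (by fun_prop)
  | succ n ih => exact measurable_duhamelE hL (measurable_gainE hg ih)

section Series

variable {g₀ : Vel → ℝ} {g : Vel → ℝ≥0∞} {f : Phase → ℝ≥0∞}

lemma measurable_collisionSeries_apply (hb : IsBackground g₀ g) (hf : Measurable f) (n : ℕ) (t : ℝ) :
    Measurable (collisionSeries (lossRate g₀) g f n t) :=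
  (measurable_collisionSeries hb.measurable_loss hb.measurable hf n).comp
    (f := fun z : Phase => (t, z)) (by fun_prop)

lemma collisionSeries_balance_zero (hb : IsBackground g₀ g) (hf : Measurable f)
    {m : Phase → ℝ≥0∞} (hm : Measurable m) (hinv : ∀ s z, m (freeFlow s z) = m z) {t : ℝ}
    (ht : 0 ≤ t) :
    (∫⁻ z, m z * collisionSeries (lossRate g₀) g f 0 t z) + ∫⁻ s in Ioc 0 t, ∫⁻ z,
      (m z * lossE g z.2) * collisionSeries (lossRate g₀) g f 0 s z = ∫⁻ z, m z * f z := by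
  have := (evolves_freeE hb.measurable_loss hf).balance hb.measurable_loss hb.loss_nonneg
    (initMeasure_fst_neg f) hm hinv ht
  simp only [hb.loss] at this
  rw [collisionSeries, this, lintegral_initMeasure hf (by fun_prop) ht]
  simp_rw [mul_comm]

lemma collisionSeries_balance_succ (hb : IsBackground g₀ g) (hf : Measurable f)
    {m : Phase → ℝ≥0∞} (hm : Measurable m) (hinv : ∀ s z, m (freeFlow s z) = m z) {t : ℝ}
    (ht : 0 ≤ t) (n : ℕ) :
    (∫⁻ z, m z * collisionSeries (lossRate g₀) g f (n + 1) t z) + ∫⁻ s in Ioc 0 t, ∫⁻ z,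
      (m z * lossE g z.2) * collisionSeries (lossRate g₀) g f (n + 1) s z
      = ∫⁻ s in Ioc 0 t, ∫⁻ z, adjointGainE g m z * collisionSeries (lossRate g₀) g f n s z := by
  have hq := measurable_gainE hb.measurable
    (measurable_collisionSeries hb.measurable_loss hb.measurable hf n)
  have := (evolves_duhamelE hb.measurable_loss hq).balance hb.measurable_loss hb.loss_nonneg
    (sourceMeasure_fst_neg _) hm hinv ht
  simp only [hb.loss] at this
  rw [collisionSeries, this, lintegral_sourceMeasure hq (by fun_prop)]
  refine lintegral_congr fun s => ?_
  simp_rw [mul_comm _ (m _), mul_comm (adjointGainE _ _ _)]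
  exact lintegral_gainE hb.measurable (measurable_collisionSeries_apply hb hf n s) hm

/-- The weighted loss at the last level is kept on the left because it feeds the next level: by the
balance law, level `N + 1` and its loss amount to `adjointGainE g m` tested against level `N`, which
is at most that loss plus `K` times the mass. -/
lemma sum_collisionSeries_le (hb : IsBackground g₀ g) (hf : Measurable f)
    {m : Phase → ℝ≥0∞} (hm : Measurable m) (hinv : ∀ s z, m (freeFlow s z) = m z) {K : ℝ≥0∞}
    (hK : ∀ z, adjointGainE g m z ≤ m z * lossE g z.2 + K) {t : ℝ} (ht : 0 ≤ t) (N : ℕ) :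
    (∑ n ∈ Finset.range (N + 1), ∫⁻ z, m z * collisionSeries (lossRate g₀) g f n t z)
      + (∫⁻ s in Ioc 0 t, ∫⁻ z, (m z * lossE g z.2) * collisionSeries (lossRate g₀) g f N s z)
      ≤ (∫⁻ z, m z * f z) + K * ∑ n ∈ Finset.range N,
        ∫⁻ s in Ioc 0 t, ∫⁻ z, collisionSeries (lossRate g₀) g f n s z := by
  induction N with
  | zero => simpa using (collisionSeries_balance_zero hb hf hm hinv ht).le
  | succ N ih =>
    rw [Finset.sum_range_succ _ (N + 1), add_assoc, collisionSeries_balance_succ hb hf hm hinv ht,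
      Finset.sum_range_succ (fun n => ∫⁻ s in Ioc 0 t, ∫⁻ z,
        collisionSeries (lossRate g₀) g f n s z) N, mul_add, ← add_assoc]
    refine le_trans ?_ (add_le_add_left ih _)
    rw [add_assoc]
    refine add_le_add_right ?_ _
    have hmeas := measurable_collisionSeries hb.measurable_loss hb.measurable hf N
    have hF : Measurable fun p : ℝ × Phase =>
      (m p.2 * lossE g p.2.2) * collisionSeries (lossRate g₀) g f N p.1 p.2 := by
      have := measurable_lossE hb.measurable
      exact Measurable.mul (by fun_prop) hmeas
    have hI : Measurable fun s : ℝ => ∫⁻ z, collisionSeries (lossRate g₀) g f N s z :=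
      hmeas.lintegral_prod_right'
    rw [← lintegral_const_mul _ hI, ← lintegral_add_left hF.lintegral_prod_right']
    refine lintegral_mono fun s => ?_
    dsimp only
    rw [← lintegral_const_mul _ (measurable_collisionSeries_apply hb hf N s),
      ← lintegral_add_right _ ((measurable_collisionSeries_apply hb hf N s).const_mul K)]
    refine lintegral_mono fun z => ?_
    dsimp only
    rw [← add_mul]
    gcongr
    exact hK z

/-- The solution of the linear Boltzmann equation, as a sum over the number of collisions. -/
def solutionE (g₀ : Vel → ℝ) (g : Vel → ℝ≥0∞) (f : Phase → ℝ≥0∞) (t : ℝ) (z : Phase) : ℝ≥0∞ :=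
  ∑' n, collisionSeries (lossRate g₀) g f n t z

lemma measurable_solutionE (hb : IsBackground g₀ g) (hf : Measurable f) :
    Measurable (Function.uncurry (solutionE g₀ g f)) :=
  Measurable.tsum fun n =>
    measurable_collisionSeries hb.measurable_loss hb.measurable hf n

lemma measurable_solutionE_apply (hb : IsBackground g₀ g) (hf : Measurable f) (t : ℝ) :
    Measurable (solutionE g₀ g f t) :=
  (measurable_solutionE hb hf).comp (f := fun z : Phase => (t, z)) (by fun_prop)

lemma lintegral_mul_solutionE (hb : IsBackground g₀ g) (hf : Measurable f) {m : Phase → ℝ≥0∞}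
    (hm : Measurable m) (t : ℝ) : ∫⁻ z, m z * solutionE g₀ g f t z
      = ∑' n, ∫⁻ z, m z * collisionSeries (lossRate g₀) g f n t z := by
  rw [← lintegral_tsum (f := fun n z => m z * collisionSeries (lossRate g₀) g f n t z) fun n =>
    (hm.mul (measurable_collisionSeries_apply hb hf n t)).aemeasurable]
  simp_rw [solutionE, ENNReal.tsum_mul_left]

lemma lintegral_solutionE_weight_le (hb : IsBackground g₀ g) (hf : Measurable f)
    {m : Phase → ℝ≥0∞} (hm : Measurable m) (hinv : ∀ s z, m (freeFlow s z) = m z) {K : ℝ≥0∞}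
    (hK : ∀ z, adjointGainE g m z ≤ m z * lossE g z.2 + K) {t : ℝ} (ht : 0 ≤ t) :
    ∫⁻ z, m z * solutionE g₀ g f t z
      ≤ (∫⁻ z, m z * f z) + K * ∫⁻ s in Ioc 0 t, ∫⁻ z, solutionE g₀ g f s z := by
  rw [lintegral_mul_solutionE hb hf hm]
  refine ENNReal.tsum_le_of_sum_range_le fun N => ?_
  refine (Finset.sum_le_sum_of_subset (Finset.range_subset_range.2 N.le_succ)).trans
    (le_self_add.trans ((sum_collisionSeries_le hb hf hm hinv hK ht N).trans ?_))
  gcongr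
  rw [← lintegral_finsetSum (f := fun n s => ∫⁻ z, collisionSeries (lossRate g₀) g f n s z) _
    fun n _ => (measurable_collisionSeries hb.measurable_loss
      hb.measurable hf n).lintegral_prod_right']
  refine lintegral_mono fun s => ?_
  dsimp only
  rw [← lintegral_finsetSum _ fun n _ => measurable_collisionSeries_apply hb hf n s]
  exact lintegral_mono fun z => ENNReal.sum_le_tsum _

lemma lintegral_solutionE_le (hb : IsBackground g₀ g) (hf : Measurable f) {t : ℝ} (ht : 0 ≤ t) :
    ∫⁻ z, solutionE g₀ g f t z ≤ ∫⁻ z, f z := by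
  simpa using lintegral_solutionE_weight_le hb hf (m := 1) measurable_const (fun _ _ => rfl) (K := 0)
    (fun z => by simp [adjointGainE_one]) ht

/-- The creation rate of the weight multiplies only the mass, which is already bounded. The moment
therefore grows at most linearly in time, without a Gronwall argument. -/
lemma lintegral_velWeight_solutionE_le (hb : IsBackground g₀ g) (hf : Measurable f) {t : ℝ}
    (ht : 0 ≤ t) : ∫⁻ z, velWeight z * solutionE g₀ g f t z
      ≤ (∫⁻ z, velWeight z * f z) + weightRate g * (ENNReal.ofReal t * ∫⁻ z, f z) := by
  refine (lintegral_solutionE_weight_le hb hf measurable_velWeight (fun _ _ => rfl)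
    (adjointGainE_velWeight_le hb.measurable) ht).trans ?_
  gcongr
  calc ∫⁻ s in Ioc 0 t, ∫⁻ z, solutionE g₀ g f s z ≤ ∫⁻ _ in Ioc 0 t, ∫⁻ z, f z :=
        setLIntegral_mono measurable_const fun s hs => lintegral_solutionE_le hb hf hs.1.le
    _ = _ := by simp [mul_comm]

/-- Split off the term without collisions; monotone convergence moves the remaining sum inside the
gain and the time integral. -/
lemma solutionE_eq (hb : IsBackground g₀ g) (hf : Measurable f) (t : ℝ) (z : Phase) :
    solutionE g₀ g f t z = freeE (lossRate g₀) f t z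
      + duhamelE (lossRate g₀) (fun s => gainE g (solutionE g₀ g f s)) t z := by
  have h1 : ∀ s z, gainE g (solutionE g₀ g f s) z
      = ∑' n, gainE g (collisionSeries (lossRate g₀) g f n s) z := by
    intro s z
    have := hb.measurable
    simp only [gainE, solutionE]
    rw [← lintegral_tsum]
    · simp_rw [ENNReal.tsum_mul_right]
    · intro n
      have := measurable_collisionSeries_apply hb hf n s
      fun_prop
  have h0 := tsum_eq_zero_add' (f := fun n => collisionSeries (lossRate g₀) g f n t z)
    ENNReal.summable
  rw [solutionE, h0]
  congr 1
  simp only [duhamelE, freeE, h1, collisionSeries]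
  rw [← lintegral_tsum]
  · simp_rw [ENNReal.tsum_mul_left]
  · intro n
    have h2 := measurable_gainE hb.measurable
      (measurable_collisionSeries hb.measurable_loss hb.measurable hf n)
    have h3 : Measurable fun s : ℝ => gainE g (collisionSeries (lossRate g₀) g f n s)
        (freeFlow (-(t - s)) z) := h2.comp (f := fun s : ℝ => (s, freeFlow (-(t - s)) z))
      (by fun_prop)
    exact ((measurable_damp hb.measurable_loss (by fun_prop) measurable_const).mul h3).aemeasurable

lemma evolves_solutionE (hb : IsBackground g₀ g) (hf : Measurable f) :
    Evolves (lossRate g₀) (initMeasure f + sourceMeasure fun s => gainE g (solutionE g₀ g f s))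
      (solutionE g₀ g f) := by
  have := (evolves_freeE hb.measurable_loss hf).add
    (evolves_duhamelE hb.measurable_loss (measurable_gainE hb.measurable (measurable_solutionE hb hf)))
    (measurable_collisionSeries_apply hb hf 0)
  convert this using 1
  ext t z
  exact solutionE_eq hb hf t z

end Series

/-! ### Functions of time with values in a Banach space -/

section Banach

open Filter Topology

variable {E : Type*} [NormedAddCommGroup E] [NormedSpace ℝ E]

lemma absolutelyContinuousOnInterval_of_dist_le {X Y : Type*} [PseudoMetricSpace X]
    [PseudoMetricSpace Y] {f : ℝ → X} {g : ℝ → Y} {a b : ℝ}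
    (hg : AbsolutelyContinuousOnInterval g a b)
    (h : ∀ x ∈ uIcc a b, ∀ y ∈ uIcc a b, dist (f x) (f y) ≤ dist (g x) (g y)) :
    AbsolutelyContinuousOnInterval f a b := by
  rw [absolutelyContinuousOnInterval_iff] at hg ⊢
  intro ε hε
  obtain ⟨δ, hδ, H⟩ := hg ε hε
  refine ⟨δ, hδ, fun I hI hlt => lt_of_le_of_lt ?_ (H I hI hlt)⟩
  exact Finset.sum_le_sum fun i hi => h _ (hI.1 i hi).1 _ (hI.1 i hi).2

/-- Looking backwards in time, `H (x - s) = H x - s • h + o(s)`, so dissipativity gives `‖H (x - s)‖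
≥ ‖H x‖ - o(s)`. -/
lemma deriv_norm_nonpos_of_dissipative {H : ℝ → E} {h : E} {x : ℝ} (hH : HasDerivAt H h x)
    (hN : DifferentiableAt ℝ (fun t => ‖H t‖) x)
    (hdis : ∀ s : ℝ, 0 < s → ‖H x‖ ≤ ‖H x - s • h‖) : deriv (fun t => ‖H t‖) x ≤ 0 := by
  have h1 : Tendsto (fun s : ℝ => s⁻¹ • (H (x + -s) - H x)) (𝓝[>] 0) (𝓝 (-h)) := by
    have := hH.tendsto_slope_zero_left
    have hneg : Tendsto (fun s : ℝ => -s) (𝓝[>] 0) (𝓝[<] 0) := by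
      simpa using tendsto_neg_nhdsGT (a := (0 : ℝ))
    have := (this.comp hneg).neg
    refine this.congr fun s => ?_
    simp [inv_neg]
  have h2 : Tendsto (fun s : ℝ => s⁻¹ • (‖H (x + -s)‖ - ‖H x‖)) (𝓝[>] 0)
      (𝓝 (-deriv (fun t => ‖H t‖) x)) := by
    have := hN.hasDerivAt.tendsto_slope_zero_left
    have hneg : Tendsto (fun s : ℝ => -s) (𝓝[>] 0) (𝓝[<] 0) := by
      simpa using tendsto_neg_nhdsGT (a := (0 : ℝ))
    have := (this.comp hneg).neg
    refine this.congr fun s => ?_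
    simp [inv_neg]
  have h3 : Tendsto (fun s : ℝ => s⁻¹ • (‖H (x + -s)‖ - ‖H x‖)
      + ‖s⁻¹ • (H (x + -s) - H x) + h‖) (𝓝[>] 0) (𝓝 (-deriv (fun t => ‖H t‖) x + 0)) := by
    refine h2.add ?_
    have := (h1.add_const h).norm
    simpa using this
  have h4 : 0 ≤ -deriv (fun t => ‖H t‖) x + 0 := by
    refine ge_of_tendsto h3 ?_
    filter_upwards [self_mem_nhdsWithin] with s (hs : 0 < s)
    have e1 : s⁻¹ • (H (x + -s) - H x) + h = s⁻¹ • (H (x + -s) - (H x - s • h)) := by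
      rw [sub_sub_eq_add_sub, add_sub_right_comm, smul_add, smul_smul, inv_mul_cancel₀ hs.ne',
        one_smul]
    rw [e1, norm_smul, Real.norm_of_nonneg (inv_nonneg.2 hs.le), smul_eq_mul, ← mul_add]
    refine mul_nonneg (inv_nonneg.2 hs.le) ?_
    have := hdis s hs
    have := norm_sub_norm_le (H x - s • h) (H (x + -s))
    rw [norm_sub_rev (H x - s • h)] at this
    linarith
  linarith

/-- Uniqueness of mild solutions for a dissipative operator, given by its graph `D`. -/
lemma integral_eq_zero_of_dissipative [CompleteSpace E] {D : E → E → Prop}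
    (hD : ∀ x y, D x y → ∀ s : ℝ, 0 < s → ‖x‖ ≤ ‖x - s • y‖) {T : ℝ} {h : ℝ → E}
    (hint : IntervalIntegrable h volume 0 T)
    (heq : ∀ t ∈ Icc (0 : ℝ) T, D (∫ θ in (0 : ℝ)..t, h θ) (h t)) {t : ℝ} (ht : t ∈ Icc (0 : ℝ) T) :
    ∫ θ in (0 : ℝ)..t, h θ = 0 := by
  set H : ℝ → E := fun t => ∫ θ in (0 : ℝ)..t, h θ with hHdef
  have hsub : ∀ {a b}, a ∈ uIcc 0 t → b ∈ uIcc 0 t → IntervalIntegrable h volume a b := by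
    intro a b ha hb
    refine hint.mono_set (uIcc_subset_uIcc ?_ ?_) <;>
    · rw [uIcc_of_le ht.1] at ha hb
      rw [uIcc_of_le (ht.1.trans ht.2)]
      exact ⟨by linarith [ha.1, hb.1], by linarith [ha.2, hb.2, ht.2]⟩
  have h0 : (0 : ℝ) ∈ uIcc 0 t := left_mem_uIcc
  -- The increments of `‖H‖` are dominated by those of the integral of `‖h‖`. The fundamental
  -- theorem of calculus is then applied to the real function `‖H‖` alone.
  have hac : AbsolutelyContinuousOnInterval (fun t => ‖H t‖) 0 t := by
    refine absolutelyContinuousOnInterval_of_dist_le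
      ((hsub h0 right_mem_uIcc).norm.absolutelyContinuousOnInterval_intervalIntegral h0) ?_
    intro x hx y hy
    rw [Real.dist_eq, Real.dist_eq, intervalIntegral.integral_interval_sub_left
      (hsub h0 hx).norm (hsub h0 hy).norm]
    refine (abs_norm_sub_norm_le _ _).trans ?_
    rw [hHdef, intervalIntegral.integral_interval_sub_left (hsub h0 hx) (hsub h0 hy)]
    exact intervalIntegral.norm_integral_le_abs_integral_norm
  have hle : ∀ᵐ x ∂(volume.restrict (Ioc 0 t)), deriv (fun t => ‖H t‖) x ≤ 0 := by
    rw [ae_restrict_iff' measurableSet_Ioc]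
    filter_upwards [hac.ae_differentiableAt, (hsub h0 right_mem_uIcc).ae_hasDerivAt_integral]
      with x hx1 hx2 hx
    have hx' : x ∈ uIcc 0 t := by
      rw [uIcc_of_le ht.1]; exact ⟨hx.1.le, hx.2⟩
    exact deriv_norm_nonpos_of_dissipative (hx2 hx' 0 h0) (hx1 hx')
      (hD _ _ (heq x ⟨hx.1.le, hx.2.trans ht.2⟩))
  have hint := hac.integral_deriv_eq_sub
  rw [intervalIntegral.integral_of_le ht.1] at hint
  have : H 0 = 0 := by simp [hHdef]
  have h5 := integral_nonpos_of_ae (μ := volume.restrict (Ioc 0 t)) hle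
  rw [hint, this, norm_zero, sub_zero] at h5
  exact norm_le_zero_iff.1 h5

/-- By the Lindelöf property every open set is a countable union of balls, and the preimages of
balls are measurable by hypothesis. -/
lemma measurable_of_measurable_dist {α X : Type*} [MeasurableSpace α] [PseudoMetricSpace X]
    [SecondCountableTopology X] [MeasurableSpace X] [BorelSpace X] {f : α → X}
    (hf : ∀ x, Measurable fun a => dist (f a) x) : Measurable f := by
  refine measurable_of_isOpen fun U hU => ?_
  choose! r hr hrU using Metric.isOpen_iff.1 hU
  obtain ⟨S, hSU, hS, hSeq⟩ := TopologicalSpace.isOpen_biUnion_countable U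
    (fun x => Metric.ball x (r x)) fun _ _ => Metric.isOpen_ball
  have : U = ⋃ x ∈ S, Metric.ball x (r x) := by
    rw [hSeq]
    refine Subset.antisymm (fun x hx => mem_biUnion hx (Metric.mem_ball_self (hr x hx)))
      (iUnion₂_subset fun x hx => hrU x hx)
  rw [this, preimage_iUnion₂]
  exact MeasurableSet.biUnion hS fun x _ => measurableSet_lt (hf x) measurable_const

end Banach

/-! ### Functions of time with values in `L¹` -/

/-- In the separable space `L¹` it is enough to see that distances to fixed elements are measurable
in time; they are integrals of jointly measurable functions over phase space. -/
lemma stronglyMeasurable_toL1 {u : ℝ → Phase → ℝ} (hu : Measurable (Function.uncurry u))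
    (hi : ∀ t, Integrable (u t)) : StronglyMeasurable fun t => (hi t).toL1 (u t) := by
  borelize L1
  have : Fact ((1 : ℝ≥0∞) ≠ ⊤) := ⟨ENNReal.one_ne_top⟩
  have : MeasureTheory.IsSeparable (volume : Measure Phase) :=
    MeasureTheory.isSeparable_of_sigmaFinite _
  have : SecondCountableTopology L1 := Lp.SecondCountableTopology
  have : Measurable fun t => (hi t).toL1 (u t) := by
    refine measurable_of_measurable_dist fun k => ?_
    have h1 : ∀ t, dist ((hi t).toL1 (u t)) k = ∫ z, ‖u t z - k z‖ := by
      intro t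
      rw [L1.dist_eq_integral_dist]
      refine integral_congr_ae ?_
      filter_upwards [(hi t).coeFn_toL1] with z hz
      rw [hz, dist_eq_norm]
    simp_rw [h1]
    refine StronglyMeasurable.measurable (StronglyMeasurable.integral_prod_right
      (f := fun t z => ‖u t z - k z‖) ?_)
    exact (hu.stronglyMeasurable.sub
      ((Lp.stronglyMeasurable k).comp_measurable measurable_snd)).norm
  exact this.stronglyMeasurable

lemma norm_toL1 {v : Phase → ℝ} (hv : Integrable v) : ‖hv.toL1 v‖ = ∫ z, ‖v z‖ := by
  rw [L1.norm_eq_integral_norm]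
  exact integral_congr_ae (hv.coeFn_toL1.fun_comp norm)

lemma integrable_toL1 {u : ℝ → Phase → ℝ} (hu : Measurable (Function.uncurry u))
    (hi : ∀ t, Integrable (u t)) {I : Set ℝ}
    (hI : Integrable (Function.uncurry u) ((volume.restrict I).prod volume)) :
    IntegrableOn (fun t => (hi t).toL1 (u t)) I := by
  refine ⟨(stronglyMeasurable_toL1 hu hi).aestronglyMeasurable, ?_⟩
  have := hI.integral_norm_prod_left
  rw [← hasFiniteIntegral_norm_iff]
  refine this.2.congr' (Filter.Eventually.of_forall fun t => ?_)
  rw [norm_toL1]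
  simp [Function.uncurry]

/-- Integration over a set is a continuous functional on `L¹`, so it commutes with the Bochner
integral; Fubini then identifies the integrals of both sides over every set of finite measure. -/
lemma coeFn_integral_toL1 {u : ℝ → Phase → ℝ} (hu : Measurable (Function.uncurry u))
    (hi : ∀ t, Integrable (u t)) {I : Set ℝ}
    (hI : Integrable (Function.uncurry u) ((volume.restrict I).prod volume)) :
    (∫ t in I, (hi t).toL1 (u t) : L1) =ᵐ[volume] fun z => ∫ t in I, u t z := by
  refine Integrable.ae_eq_of_forall_setIntegral_eq _ _ (L1.integrable_coeFn _)
    hI.integral_prod_right fun s hs _ => ?_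
  have h1 : ∀ k : L1, ∫ z in s, k z
      = (L1.integralCLM ∘L LpToLpRestrictCLM Phase ℝ ℝ volume 1 s) k := by
    intro k
    rw [ContinuousLinearMap.comp_apply, ← L1.integral_def, ← integral_congr_ae
      (LpToLpRestrictCLM_coeFn ℝ s k), L1.integral_eq_integral]
  rw [h1, ← ContinuousLinearMap.integral_comp_comm _ (integrable_toL1 hu hi hI)]
  simp_rw [← h1]
  have h2 : ∀ t, ∫ z in s, (hi t).toL1 (u t) z = ∫ z in s, u t z := fun t =>
    integral_congr_ae (ae_restrict_of_ae (hi t).coeFn_toL1)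
  simp_rw [h2]
  refine integral_integral_swap ?_
  refine hI.mono_measure ?_
  exact Measure.prod_mono le_rfl Measure.restrict_le_self

/-! ### The gain term on `L¹` -/

section Gain

variable {g₀ : Vel → ℝ} {g : Vel → ℝ≥0∞}

/-- The gain evaluates the densities at velocities after a collision. Since `collide` preserves the
measure, null sets pull back to null sets and the choice of representatives is immaterial. -/
lemma gainIntegrand_ae_eq (hb : IsBackground g₀ g) {F F' : Phase → ℝ} (hF : F' =ᵐ[volume] F) :
    ∀ᵐ z : Phase, ∀ᵐ p : Sph × Vel ∂(surf.prod volume), gainIntegrand g₀ F' z p.1 p.2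
      = F (z.1, scatter z.2 p.1 p.2) * (g (rebound z.2 p.1 p.2)).toReal *
        crossSection z.2 p.2 p.1 := by
  have h1 : ∀ᵐ q ∂collisionMeasure, F' q.1 = F q.1 :=
    Measure.quasiMeasurePreserving_fst.ae hF
  have h2 : ∀ᵐ q ∂collisionMeasure, g₀ q.2.2 = (g q.2.2).toReal :=
    (Measure.quasiMeasurePreserving_snd.comp Measure.quasiMeasurePreserving_snd).ae hb.ae_eq
  have h3 := measurePreserving_collide.quasiMeasurePreserving.ae (h1.and h2)
  filter_upwards [Measure.ae_ae_of_ae_prod h3] with z hz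
  filter_upwards [hz] with p hp
  have e1 : F' (z.1, z.2 + inner ℝ (p.1 : Vel) (p.2 - z.2) • (p.1 : Vel))
      = F (z.1, scatter z.2 p.1 p.2) := by
    rw [scatter_eq]; exact hp.1
  have e2 : g₀ (p.2 - inner ℝ (p.1 : Vel) (p.2 - z.2) • (p.1 : Vel))
      = (g (rebound z.2 p.1 p.2)).toReal := hp.2
  rw [gainIntegrand, e1, e2]

/-- Taking absolute values inside reduces everything to `gainE` of `|F|`, whose total mass is the
total loss of `|F|`. Hence integrability of `Λ F` puts `F` in `D(B)`, with `‖B F‖ ≤ ‖Λ F‖`. -/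
lemma gainTerm_properties (hb : IsBackground g₀ g) {F F' : Phase → ℝ} (hm : Measurable F)
    (hF : F' =ᵐ[volume] F) (hfin : ∫⁻ z, ‖F z‖ₑ * lossE g z.2 ≠ ⊤) :
    (∀ᵐ z : Phase, Integrable (fun p : Sph × Vel => gainIntegrand g₀ F' z p.1 p.2)
      (surf.prod volume)) ∧
    (∀ᵐ z : Phase, gainTerm g₀ F' z = ∫ p : Sph × Vel, F (z.1, scatter z.2 p.1 p.2) *
      (g (rebound z.2 p.1 p.2)).toReal * crossSection z.2 p.2 p.1 ∂(surf.prod volume)) ∧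
    Integrable (gainTerm g₀ F') ∧ ∫⁻ z, ‖gainTerm g₀ F' z‖ₑ ≤ ∫⁻ z, ‖F z‖ₑ * lossE g z.2 := by
  set G : Phase → Sph × Vel → ℝ := fun z p => F (z.1, scatter z.2 p.1 p.2) *
      (g (rebound z.2 p.1 p.2)).toReal * crossSection z.2 p.2 p.1 with hG
  have hgm := hb.measurable
  have hGm : Measurable (Function.uncurry G) := by
    simp only [hG, Function.uncurry_def]
    have : Measurable fun v => (g v).toReal := hgm.ennreal_toReal
    fun_prop
  have hn : ∀ z, ∫⁻ p, ‖G z p‖ₑ ∂(surf.prod volume) = gainE g (fun z => ‖F z‖ₑ) z := by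
    intro z
    refine lintegral_congr fun p => ?_
    simp only [hG, enorm_mul]
    rw [Real.enorm_of_nonneg ENNReal.toReal_nonneg, ENNReal.ofReal_toReal (hb.ne_top _),
      Real.enorm_of_nonneg (crossSection_nonneg _ _ _)]
  have hint : ∫⁻ z, gainE g (fun z => ‖F z‖ₑ) z = ∫⁻ z, ‖F z‖ₑ * lossE g z.2 := by
    have := lintegral_gainE hgm (f := fun z => ‖F z‖ₑ) (ψ := 1) (by fun_prop) measurable_const
    simpa [adjointGainE_one] using this
  have hgmeas : Measurable (gainE g fun z => ‖F z‖ₑ) :=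
    (measurable_gainE (α := Unit) hgm (f := fun _ z => ‖F z‖ₑ) (by fun_prop)).comp
      (f := fun z : Phase => ((), z)) (by fun_prop)
  have hlt : ∀ᵐ z, gainE g (fun z => ‖F z‖ₑ) z < ⊤ := ae_lt_top hgmeas (by rwa [hint])
  have hGi : ∀ᵐ z, Integrable (G z) (surf.prod volume) := by
    filter_upwards [hlt] with z hz
    refine ⟨(hGm.comp (f := fun p : Sph × Vel => (z, p)) (by fun_prop)).aestronglyMeasurable, ?_⟩
    rw [HasFiniteIntegral, hn]
    exact hz
  have hae := gainIntegrand_ae_eq hb hF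
  have h1 : ∀ᵐ z : Phase, Integrable (fun p : Sph × Vel => gainIntegrand g₀ F' z p.1 p.2)
      (surf.prod volume) := by
    filter_upwards [hGi, hae] with z hz hz'
    exact hz.congr (hz'.mono fun p hp => hp.symm)
  have h2 : ∀ᵐ z : Phase, gainTerm g₀ F' z = ∫ p, G z p ∂(surf.prod volume) := by
    filter_upwards [h1, hae] with z hz hz'
    rw [gainTerm, ← integral_congr_ae hz', integral_prod _ hz]
  have hle : ∫⁻ z, ‖gainTerm g₀ F' z‖ₑ ≤ ∫⁻ z, ‖F z‖ₑ * lossE g z.2 := by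
    rw [← hint]
    refine lintegral_mono_ae ?_
    filter_upwards [h2] with z hz
    rw [hz, ← hn]
    exact enorm_integral_le_lintegral_enorm _
  refine ⟨h1, h2, ⟨?_, ?_⟩, hle⟩
  · exact (StronglyMeasurable.integral_prod_right hGm.stronglyMeasurable).aestronglyMeasurable.congr
      (h2.mono fun z hz => hz.symm)
  · exact hle.trans_lt hfin.lt_top

lemma exists_isB (hb : IsBackground g₀ g) {F : L1} {k : Phase → ℝ≥0∞} (hk : Measurable k)
    (hkF : F =ᵐ[volume] fun z => (k z).toReal)
    (hfin : ∫⁻ z, k z * lossE g z.2 ≠ ⊤) :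
    ∃ b : L1, IsB g₀ F b ∧ b =ᵐ[volume] fun z => (gainE g k z).toReal := by
  have hk' : ∫⁻ z, ‖(k z).toReal‖ₑ * lossE g z.2 ≠ ⊤ := by
    refine ne_top_of_le_ne_top hfin (lintegral_mono fun z => ?_)
    gcongr
    rw [Real.enorm_of_nonneg ENNReal.toReal_nonneg]
    exact ENNReal.ofReal_toReal_le
  obtain ⟨h1, h2, h3, -⟩ := gainTerm_properties hb hk.ennreal_toReal hkF hk'
  refine ⟨h3.toL1 _, ⟨h1, h3.coeFn_toL1⟩, h3.coeFn_toL1.trans ?_⟩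
  have hgm := hb.measurable
  have hint : ∫⁻ z, gainE g k z = ∫⁻ z, k z * lossE g z.2 := by
    have := lintegral_gainE hgm (f := k) (ψ := 1) hk measurable_const
    simpa [adjointGainE_one] using this
  have hgmeas : Measurable (gainE g k) :=
    (measurable_gainE (α := Unit) hgm (f := fun _ => k) (by fun_prop)).comp
      (f := fun z : Phase => ((), z)) (by fun_prop)
  filter_upwards [h2, ae_lt_top hgmeas (by rwa [hint])] with z hz hlt
  have hm : Measurable fun p : Sph × Vel => k (z.1, scatter z.2 p.1 p.2) *
      g (rebound z.2 p.1 p.2) * ENNReal.ofReal (crossSection z.2 p.2 p.1) := by fun_prop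
  rw [hz, gainE, ← integral_toReal hm.aemeasurable (ae_lt_top hm hlt.ne)]
  refine integral_congr_ae (Filter.Eventually.of_forall fun p => ?_)
  simp only [ENNReal.toReal_mul, ENNReal.toReal_ofReal (crossSection_nonneg _ _ _)]

lemma isB_norm_le (hb : IsBackground g₀ g) {F b : L1} (h : IsB g₀ F b)
    (hfin : ∫⁻ z, ‖F z‖ₑ * lossE g z.2 ≠ ⊤) :
    ‖b‖ₑ ≤ ∫⁻ z, ‖F z‖ₑ * lossE g z.2 := by
  have hm : Measurable F := (Lp.stronglyMeasurable F).measurable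
  refine le_trans (le_of_eq ?_) (gainTerm_properties hb hm Filter.EventuallyEq.rfl hfin).2.2.2
  rw [Lp.enorm_def, eLpNorm_one_eq_lintegral_enorm]
  exact lintegral_congr_ae (h.2.fun_comp _)

end Gain

end

section

attribute [local irreducible] crossSection scatter

/-! ### Test functions -/

/-- Used to descend continuity of a test function, and of its transport derivative, from the
periodic lift. -/
lemma isOpenQuotientMap_toTorus : IsOpenQuotientMap toTorus := by
  have h1 : IsOpenQuotientMap (Pi.map fun (_ : Fin 3) (y : ℝ) => (y : UnitAddCircle)) :=
    IsOpenQuotientMap.piMap fun _ => QuotientAddGroup.isOpenQuotientMap_mk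
  exact h1.comp (PiLp.homeomorph 2 (fun _ : Fin 3 => ℝ)).isOpenQuotientMap

lemma isOpenQuotientMap_phase :
    IsOpenQuotientMap (fun p : Vel × Vel => ((toTorus p.1, p.2) : Phase)) :=
  isOpenQuotientMap_toTorus.prodMap IsOpenQuotientMap.id

lemma freeFlow_toTorus (s : ℝ) (y v : Vel) :
    freeFlow s (toTorus y, v) = (toTorus (y + s • v), v) := by
  simp [freeFlow, toTorus_add]

section TestFunction

variable {φ : Phase → ℝ}

lemma IsTestFunction.continuous (hφ : IsTestFunction φ) : Continuous φ :=
  isOpenQuotientMap_phase.isQuotientMap.continuous_iff.2 hφ.1.continuous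

lemma IsTestFunction.hasDerivAt_lift (hφ : IsTestFunction φ) (y v : Vel) (s : ℝ) :
    HasDerivAt (fun s => φ (freeFlow s (toTorus y, v)))
      (fderiv ℝ (fun p : Vel × Vel => φ (toTorus p.1, p.2)) (y + s • v, v) (v, 0)) s := by
  have h1 : HasDerivAt (fun s : ℝ => ((y + s • v, v) : Vel × Vel)) (v, 0) s := by
    have : HasDerivAt (fun s : ℝ => y + s • v) v s := by
      simpa using ((hasDerivAt_id s).smul_const v).const_add y
    exact this.prodMk (hasDerivAt_const s v)
  have h2 := (hφ.1.differentiable (by simp) (y + s • v, v)).hasFDerivAt.comp_hasDerivAt s h1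
  refine h2.congr_of_eventuallyEq (Filter.Eventually.of_forall fun r => ?_)
  simp [freeFlow_toTorus]

lemma IsTestFunction.transport_toTorus (hφ : IsTestFunction φ) (y v : Vel) : transport φ (toTorus y, v)
    = fderiv ℝ (fun p : Vel × Vel => φ (toTorus p.1, p.2)) (y, v) (v, 0) := by
  rw [transport]
  simpa using (hφ.hasDerivAt_lift y v 0).deriv

lemma IsTestFunction.hasDerivAt (hφ : IsTestFunction φ) (z : Phase) (s : ℝ) :
    HasDerivAt (fun s => φ (freeFlow s z)) (transport φ (freeFlow s z)) s := by
  obtain ⟨⟨y, v⟩, rfl⟩ := isOpenQuotientMap_phase.surjective z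
  have := hφ.hasDerivAt_lift y v s
  rwa [← hφ.transport_toTorus, ← freeFlow_toTorus] at this

lemma IsTestFunction.continuous_transport (hφ : IsTestFunction φ) : Continuous (transport φ) := by
  refine isOpenQuotientMap_phase.isQuotientMap.continuous_iff.2 ?_
  have h1 : Continuous (fderiv ℝ (fun p : Vel × Vel => φ (toTorus p.1, p.2))) :=
    hφ.1.continuous_fderiv (by simp)
  have h2 : transport φ ∘ (fun p : Vel × Vel => ((toTorus p.1, p.2) : Phase)) = fun p =>
      fderiv ℝ (fun p : Vel × Vel => φ (toTorus p.1, p.2)) p (p.2, 0) := by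
    ext p
    exact hφ.transport_toTorus p.1 p.2
  rw [h2]
  exact h1.clm_apply (by fun_prop)

lemma IsTestFunction.hasCompactSupport_transport (hφ : IsTestFunction φ) : HasCompactSupport (transport φ) := by
  refine hφ.2.mono' fun z hz => ?_
  by_contra hzs
  refine hz ?_
  have h1 : φ =ᶠ[nhds z] 0 := notMem_tsupport_iff_eventuallyEq.1 hzs
  have h2 : Filter.Tendsto (fun s : ℝ => freeFlow s z) (nhds 0) (nhds z) := by
    have : Continuous fun s : ℝ => freeFlow s z :=
      continuous_freeFlow.comp (by fun_prop : Continuous fun s : ℝ => (s, z))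
    simpa using this.tendsto 0
  have h3 : (fun s : ℝ => φ (freeFlow s z)) =ᶠ[nhds 0] fun _ => 0 := h2.eventually h1
  rw [transport, h3.deriv_eq]
  simp

/-- The collision frequency may be unbounded and is only known to be measurable, but it is dominated
by the continuous function `C (1 + |v|)`, which is bounded on the support of `φ`. -/
lemma IsTestFunction.exists_bound (hφ : IsTestFunction φ) {g₀ : Vel → ℝ} {g : Vel → ℝ≥0∞} (hb : IsBackground g₀ g) :
    ∃ M, (∀ z, ‖φ z‖ ≤ M) ∧ ∀ z, ‖transport φ z - lossRate g₀ z.2 * φ z‖ ≤ M := by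
  obtain ⟨C, hC⟩ := hb.loss_le
  obtain ⟨M₁, h₁⟩ := hφ.2.exists_bound_of_continuous hφ.continuous
  obtain ⟨M₂, h₂⟩ := hφ.hasCompactSupport_transport.exists_bound_of_continuous
    hφ.continuous_transport
  have hc : Continuous fun z : Phase => (C * (1 + ‖z.2‖)) * φ z := by
    have := hφ.continuous
    fun_prop
  obtain ⟨M₃, h₃⟩ := (hφ.2.mul_left (f := fun z : Phase => C * (1 + ‖z.2‖))).exists_bound_of_continuous hc
  refine ⟨max M₁ (M₂ + M₃), fun z => (h₁ z).trans (le_max_left _ _), fun z => ?_⟩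
  refine le_trans ?_ (le_max_right _ _)
  refine (norm_sub_le _ _).trans (add_le_add (h₂ z) (le_trans ?_ (h₃ z)))
  rw [Pi.mul_apply, norm_mul, norm_mul, Real.norm_of_nonneg (hb.loss_nonneg _)]
  gcongr
  exact (hC z.2).trans (le_abs_self _)

/-- The damped flow of a test function, integrated along a trajectory. -/
lemma IsTestFunction.integral_damped (hφ : IsTestFunction φ) (L : Vel → ℝ) (z : Phase) {r t : ℝ} (hrt : r ≤ t) :
    ∫ s in Ioc r t, Real.exp (-((s - r) * L z.2)) * (transport φ (freeFlow (s - r) z)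
      - L z.2 * φ (freeFlow (s - r) z))
      = Real.exp (-((t - r) * L z.2)) * φ (freeFlow (t - r) z) - φ z := by
  have hd : ∀ s ∈ uIcc r t, HasDerivAt
      (fun s => Real.exp (-((s - r) * L z.2)) * φ (freeFlow (s - r) z))
      (Real.exp (-((s - r) * L z.2)) * (transport φ (freeFlow (s - r) z)
        - L z.2 * φ (freeFlow (s - r) z))) s := by
    intro s _
    have h1 : HasDerivAt (fun s : ℝ => -((s - r) * L z.2)) (-(1 * L z.2)) s :=
      (((hasDerivAt_id s).sub_const r).mul_const _).neg
    have h2 : HasDerivAt (fun s : ℝ => φ (freeFlow (s - r) z))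
        (transport φ (freeFlow (s - r) z)) s := by
      simpa using (hφ.hasDerivAt z (s - r)).comp_sub_const s r
    exact (h1.exp.mul h2).congr_deriv (by ring)
  have hcont : Continuous fun s => Real.exp (-((s - r) * L z.2)) *
      (transport φ (freeFlow (s - r) z) - L z.2 * φ (freeFlow (s - r) z)) := by
    have h1 : Continuous fun s : ℝ => freeFlow (s - r) z :=
      continuous_freeFlow.comp (by fun_prop : Continuous fun s : ℝ => (s - r, z))
    have h2 := hφ.continuous
    have h3 := hφ.continuous_transport
    fun_prop
  rw [← intervalIntegral.integral_of_le hrt,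
    intervalIntegral.integral_eq_sub_of_hasDerivAt hd (hcont.intervalIntegrable _ _)]
  simp

end TestFunction

end

section

attribute [local irreducible] crossSection scatter toTorus

/-! ### Existence of a mild solution -/

/-- An identity tested on nonnegative functions is an equality of measures, hence also holds for
signed integrands. -/
lemma integral_eq_of_lintegral_eq {X Y : Type*} [MeasurableSpace X] [MeasurableSpace Y]
    {μ : Measure X} {ν : Measure Y} {w : X → ℝ≥0∞} {e : Y → ℝ≥0∞} {θ : Y → X} (hw : Measurable w)
    (he : Measurable e) (hθ : Measurable θ) (hwt : ∀ᵐ x ∂μ, w x < ⊤) (het : ∀ y, e y < ⊤)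
    (h : ∀ ψ : X → ℝ≥0∞, Measurable ψ → ∫⁻ x, ψ x * w x ∂μ = ∫⁻ y, e y * ψ (θ y) ∂ν)
    {φ : X → ℝ} (hφ : Measurable φ) :
    ∫ x, (w x).toReal * φ x ∂μ = ∫ y, (e y).toReal * φ (θ y) ∂ν := by
  have key : μ.withDensity w = (ν.withDensity e).map θ := by
    refine Measure.ext_of_lintegral _ fun ψ hψ => ?_
    rw [lintegral_map hψ hθ, lintegral_withDensity_eq_lintegral_mul _ hw hψ,
      lintegral_withDensity_eq_lintegral_mul _ he (g := fun y => ψ (θ y)) (hψ.comp hθ)]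
    simpa [mul_comm] using h ψ hψ
  have h1 := integral_withDensity_eq_integral_toReal_smul hw hwt φ
  have h2 := integral_withDensity_eq_integral_toReal_smul he
    (Filter.Eventually.of_forall het : ∀ᵐ y ∂ν, e y < ⊤) (fun y => φ (θ y))
  simp only [smul_eq_mul] at h1 h2
  rw [← h1, ← h2, key, integral_map hθ.aemeasurable hφ.aestronglyMeasurable]

/-- Initial data for which the series of collisions has finite moments. -/
structure IsInitial (f : Phase → ℝ≥0∞) : Prop where
  measurable : Measurable f
  mass : ∫⁻ z, f z ≠ ⊤
  moment : ∫⁻ z, velWeight z * f z ≠ ⊤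

section Existence

variable {g₀ : Vel → ℝ} {g : Vel → ℝ≥0∞} {f : Phase → ℝ≥0∞}

lemma IsBackground.exists_lossE_le (hb : IsBackground g₀ g) :
    ∃ C : ℝ≥0∞, C ≠ ⊤ ∧ ∀ z : Phase, lossE g z.2 ≤ C * velWeight z := by
  obtain ⟨C, hC⟩ := hb.loss_le
  refine ⟨ENNReal.ofReal C, ENNReal.ofReal_ne_top, fun z => ?_⟩
  rw [← hb.loss, velWeight, ← ENNReal.ofReal_mul' (by positivity)]
  exact ENNReal.ofReal_le_ofReal (hC _)

lemma lintegral_solutionE_lt_top (hb : IsBackground g₀ g) (hf : IsInitial f) {t : ℝ} (ht : 0 ≤ t) :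
    ∫⁻ z, solutionE g₀ g f t z < ⊤ :=
  (lintegral_solutionE_le hb hf.measurable ht).trans_lt hf.mass.lt_top

lemma lintegral_lintegral_solutionE_lt_top (hb : IsBackground g₀ g) (hf : IsInitial f) (t : ℝ) :
    ∫⁻ s in Ioc 0 t, ∫⁻ z, solutionE g₀ g f s z < ⊤ := by
  calc ∫⁻ s in Ioc 0 t, ∫⁻ z, solutionE g₀ g f s z ≤ ∫⁻ _ in Ioc 0 t, ∫⁻ z, f z :=
        setLIntegral_mono measurable_const fun s hs => lintegral_solutionE_le hb hf.measurable hs.1.le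
    _ < ⊤ := by
        rw [setLIntegral_const]
        exact ENNReal.mul_lt_top hf.mass.lt_top (by simp)

/-- This is where the first moment is needed. The finiteness places the time integral of the
solution in `D(B)` and makes the total emission up to time `t` finite. -/
lemma lintegral_loss_solutionE_lt_top (hb : IsBackground g₀ g) (hf : IsInitial f) (t : ℝ) :
    ∫⁻ s in Ioc 0 t, ∫⁻ z, solutionE g₀ g f s z * lossE g z.2 < ⊤ := by
  obtain ⟨C, hC, hle⟩ := hb.exists_lossE_le
  set K := C * ((∫⁻ z, velWeight z * f z) + weightRate g * (ENNReal.ofReal t * ∫⁻ z, f z)) with hK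
  calc ∫⁻ s in Ioc 0 t, ∫⁻ z, solutionE g₀ g f s z * lossE g z.2 ≤ ∫⁻ _ in Ioc 0 t, K := by
        refine setLIntegral_mono measurable_const fun s hs => ?_
        calc ∫⁻ z, solutionE g₀ g f s z * lossE g z.2
            ≤ ∫⁻ z, C * (velWeight z * solutionE g₀ g f s z) := by
              refine lintegral_mono fun z => ?_
              dsimp only
              rw [mul_comm, ← mul_assoc]
              gcongr
              exact hle z
          _ = C * ∫⁻ z, velWeight z * solutionE g₀ g f s z := by
              have := measurable_solutionE_apply hb hf.measurable s
              rw [lintegral_const_mul _ (by fun_prop)]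
          _ ≤ K := by
              rw [hK]
              gcongr
              refine (lintegral_velWeight_solutionE_le hb hf.measurable hs.1.le).trans ?_
              gcongr
              exact hs.2
    _ < ⊤ := by
        rw [setLIntegral_const]
        refine ENNReal.mul_lt_top (ENNReal.mul_lt_top hC.lt_top (ENNReal.add_lt_top.2
          ⟨hf.moment.lt_top, ENNReal.mul_lt_top hb.weightRate_ne_top.lt_top
            (ENNReal.mul_lt_top ENNReal.ofReal_lt_top hf.mass.lt_top)⟩)) (by simp)

lemma lintegral_gainE_solutionE (hb : IsBackground g₀ g) (hf : IsInitial f) (s : ℝ) :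
    ∫⁻ z, gainE g (solutionE g₀ g f s) z = ∫⁻ z, solutionE g₀ g f s z * lossE g z.2 := by
  have := lintegral_gainE hb.measurable (f := solutionE g₀ g f s) (ψ := 1)
    (measurable_solutionE_apply hb hf.measurable s) measurable_const
  simpa [adjointGainE_one] using this

/-- The real-valued solution. -/
def solutionR (g₀ : Vel → ℝ) (g : Vel → ℝ≥0∞) (f : Phase → ℝ≥0∞) (t : ℝ) (z : Phase) : ℝ :=
  if 0 ≤ t then (solutionE g₀ g f t z).toReal else 0

lemma measurable_solutionR (hb : IsBackground g₀ g) (hf : IsInitial f) :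
    Measurable (Function.uncurry (solutionR g₀ g f)) := by
  refine Measurable.ite (measurableSet_le measurable_const measurable_fst) ?_ measurable_const
  exact (measurable_solutionE hb hf.measurable).ennreal_toReal

lemma integrable_solutionR (hb : IsBackground g₀ g) (hf : IsInitial f) (t : ℝ) :
    Integrable (solutionR g₀ g f t) := by
  -- The mass bound concerns nonnegative times only; `solutionR` is set to zero at the others so
  -- that every time slice defines an element of `L¹`.
  by_cases ht : 0 ≤ t
  · have : solutionR g₀ g f t = fun z => (solutionE g₀ g f t z).toReal := by
      ext z; simp [solutionR, ht]
    rw [this]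
    exact integrable_toReal_of_lintegral_ne_top
      (measurable_solutionE_apply hb hf.measurable t).aemeasurable
      (lintegral_solutionE_lt_top hb hf ht).ne
  · have : solutionR g₀ g f t = fun z => 0 := by
      ext z; simp [solutionR, ht]
    rw [this]
    exact integrable_zero _ _ _

lemma integrable_solutionR_prod (hb : IsBackground g₀ g) (hf : IsInitial f) (t : ℝ) :
    Integrable (Function.uncurry (solutionR g₀ g f)) ((volume.restrict (Ioc 0 t)).prod volume) := by
  have hm := measurable_solutionR hb hf
  refine ⟨hm.aestronglyMeasurable, ?_⟩
  rw [HasFiniteIntegral, lintegral_prod _ (by fun_prop)]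
  refine lt_of_le_of_lt ?_ (lintegral_lintegral_solutionE_lt_top hb hf t)
  refine lintegral_mono fun s => lintegral_mono fun z => ?_
  simp only [Function.uncurry, solutionR]
  split_ifs
  · rw [Real.enorm_of_nonneg ENNReal.toReal_nonneg]
    exact ENNReal.ofReal_toReal_le
  · simp

/-- The solution of the linear Boltzmann equation in `L¹`. -/
def solution (hb : IsBackground g₀ g) (hf : IsInitial f) (t : ℝ) : L1 :=
  (integrable_solutionR hb hf t).toL1 _

lemma coeFn_solution (hb : IsBackground g₀ g) (hf : IsInitial f) {t : ℝ} (ht : 0 ≤ t) :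
    solution hb hf t =ᵐ[volume] fun z => (solutionE g₀ g f t z).toReal := by
  refine (Integrable.coeFn_toL1 _).trans (Filter.Eventually.of_forall fun z => ?_)
  simp [solutionR, ht]

lemma intervalIntegrable_solution (hb : IsBackground g₀ g) (hf : IsInitial f) {t : ℝ}
    (ht : 0 ≤ t) : IntervalIntegrable (solution hb hf) volume 0 t := by
  rw [intervalIntegrable_iff_integrableOn_Ioc_of_le ht]
  exact integrable_toL1 (measurable_solutionR hb hf) (integrable_solutionR hb hf)
    (integrable_solutionR_prod hb hf t)

/-- The time integral of the solution. -/
def timeIntegralE (g₀ : Vel → ℝ) (g : Vel → ℝ≥0∞) (f : Phase → ℝ≥0∞) (t : ℝ) (z : Phase) : ℝ≥0∞ :=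
  ∫⁻ s in Ioc 0 t, solutionE g₀ g f s z

lemma measurable_timeIntegralE (hb : IsBackground g₀ g) (hf : IsInitial f) (t : ℝ) :
    Measurable (timeIntegralE g₀ g f t) :=
  ((measurable_solutionE hb hf.measurable).comp measurable_swap).lintegral_prod_right'
    (ν := volume.restrict (Ioc 0 t))

lemma coeFn_integral_solution_real (hb : IsBackground g₀ g) (hf : IsInitial f) {t : ℝ}
    (ht : 0 ≤ t) : (∫ θ in (0 : ℝ)..t, solution hb hf θ : L1)
      =ᵐ[volume] fun z => ∫ s in Ioc 0 t, solutionR g₀ g f s z := by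
  rw [intervalIntegral.integral_of_le ht]
  exact coeFn_integral_toL1 (measurable_solutionR hb hf) (integrable_solutionR hb hf)
    (integrable_solutionR_prod hb hf t)

lemma coeFn_integral_solution (hb : IsBackground g₀ g) (hf : IsInitial f) {t : ℝ} (ht : 0 ≤ t) :
    (∫ θ in (0 : ℝ)..t, solution hb hf θ : L1)
      =ᵐ[volume] fun z => (timeIntegralE g₀ g f t z).toReal := by
  have hm := measurable_solutionE hb hf.measurable
  have hlt : ∀ᵐ z, timeIntegralE g₀ g f t z < ⊤ := by
    refine ae_lt_top (measurable_timeIntegralE hb hf t) ?_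
    have := (lintegral_lintegral_solutionE_lt_top hb hf t).ne
    rwa [lintegral_lintegral_swap hm.aemeasurable] at this
  filter_upwards [coeFn_integral_solution_real hb hf ht, hlt] with z h1 h2
  have hmz : Measurable fun s => solutionE g₀ g f s z :=
    hm.comp (f := fun s : ℝ => (s, z)) (by fun_prop)
  rw [h1, timeIntegralE, ← integral_toReal hmz.aemeasurable (ae_lt_top hmz h2.ne)]
  refine setIntegral_congr_fun measurableSet_Ioc fun s hs => ?_
  simp [solutionR, hs.1.le]

/-- Tonelli: the gain of the time integral is the total source emitted by collisions up to time `t`.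
-/
lemma gainE_timeIntegralE (hb : IsBackground g₀ g) (hf : IsInitial f) (t : ℝ) (z : Phase) :
    gainE g (timeIntegralE g₀ g f t) z
      = ∫⁻ s in Ioc 0 t, gainE g (solutionE g₀ g f s) z := by
  have hg := hb.measurable
  have hm := measurable_solutionE hb hf.measurable
  have hF : Measurable fun q : ℝ × Sph × Vel =>
      solutionE g₀ g f q.1 (z.1, scatter z.2 q.2.1 q.2.2) :=
    hm.comp (f := fun q : ℝ × Sph × Vel => (q.1, (z.1, scatter z.2 q.2.1 q.2.2))) (by fun_prop)
  simp only [gainE, timeIntegralE]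
  rw [lintegral_lintegral_swap (by fun_prop)]
  refine lintegral_congr fun p => ?_
  have hFp : Measurable fun s : ℝ => solutionE g₀ g f s (z.1, scatter z.2 p.1 p.2) :=
    hF.comp (f := fun s : ℝ => (s, p)) (by fun_prop)
  rw [← lintegral_mul_const _ hFp, ← lintegral_mul_const _ (by fun_prop)]

/-- The solution is a superposition of damped trajectories started by the emission measure `ρ`.
Along each trajectory the time integral of `transport φ - Λ φ` with damping is the final value of
`φ` with damping minus the initial value. Integrating over `ρ`, the final values give `f_t`, and the
initial ones give everything emitted, namely `f₀ + b`. -/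
lemma isA_solution (hb : IsBackground g₀ g) (hf : IsInitial f) {t : ℝ} (ht : 0 ≤ t) {f₀ b : L1}
    (hf₀ : f₀ =ᵐ[volume] fun z => (f z).toReal)
    (hbt : b =ᵐ[volume] fun z => (gainE g (timeIntegralE g₀ g f t) z).toReal) :
    IsA g₀ (∫ θ in (0 : ℝ)..t, solution hb hf θ) (solution hb hf t - f₀ - b) := by
  intro φ hφ
  obtain ⟨M, hM1, hM2⟩ := hφ.exists_bound hb
  have hL := hb.measurable_loss
  have hφm : Measurable φ := hφ.continuous.measurable
  set η : Phase → ℝ := fun z => transport φ z - lossRate g₀ z.2 * φ z with hη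
  have hηm : Measurable η := by
    have := hφ.continuous_transport.measurable
    fun_prop
  set u := solutionE g₀ g f with hu
  have hum := measurable_solutionE hb hf.measurable
  set q : ℝ → Phase → ℝ≥0∞ := fun s => gainE g (u s) with hq
  have hqm : Measurable (Function.uncurry q) := measurable_gainE hb.measurable hum
  set ρ := initMeasure f + sourceMeasure q with hρ
  have hev : Evolves (lossRate g₀) ρ u := evolves_solutionE hb hf.measurable
  set ρt := ρ.restrict {p | p.1 ≤ t} with hρt
  have hρl : ∀ F : ℝ × Phase → ℝ≥0∞, Measurable F → ∫⁻ p, F p ∂ρt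
      = (∫⁻ z, f z * F (0, z)) + ∫⁻ s in Ioc 0 t, ∫⁻ z, q s z * F (s, z) := by
    intro F hF
    rw [hρt, hρ, Measure.restrict_add, lintegral_add_measure, lintegral_initMeasure hf.measurable
      hF ht, lintegral_sourceMeasure hqm hF]
  have hfinq : ∫⁻ s in Ioc 0 t, ∫⁻ z, q s z < ⊤ := by
    simp only [hq, hu, lintegral_gainE_solutionE hb hf]
    exact lintegral_loss_solutionE_lt_top hb hf t
  have : IsFiniteMeasure ρt := by
    refine ⟨?_⟩
    rw [← lintegral_one, hρl _ measurable_const]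
    simpa using ⟨hf.mass.lt_top, hfinq⟩
  have hρ0 : ∀ᵐ p ∂ρt, 0 ≤ p.1 := by
    refine ae_restrict_of_ae ?_
    rw [hρ, ae_add_measure_iff]
    exact ⟨initMeasure_fst_neg _, sourceMeasure_fst_neg _⟩
  -- the solution at time `s`, tested against `ψ`
  have hA : ∀ s, 0 ≤ s → ∀ ψ : Phase → ℝ, Measurable ψ → ∫ z, (u s z).toReal * ψ z
      = ∫ p in {p | p.1 ≤ s}, Real.exp (-((s - p.1) * lossRate g₀ p.2.2)) *
        ψ (freeFlow (s - p.1) p.2) ∂ρ := by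
    intro s hs ψ hψ
    have := integral_eq_of_lintegral_eq (μ := volume) (w := u s)
      (e := fun p : ℝ × Phase => damp (lossRate g₀) (s - p.1) p.2.2)
      (θ := fun p : ℝ × Phase => freeFlow (s - p.1) p.2)
      (measurable_solutionE_apply hb hf.measurable s)
      (measurable_damp hL (by fun_prop) (by fun_prop)) (by fun_prop)
      (ae_lt_top (measurable_solutionE_apply hb hf.measurable s)
        (lintegral_solutionE_lt_top hb hf hs).ne)
      (fun p => ENNReal.ofReal_lt_top) (hev s hs) hψ
    simpa only [damp, ENNReal.toReal_ofReal (Real.exp_nonneg _)] using this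
  -- the emitted particles, tested against `φ`
  have hC : ∫ p, φ p.2 ∂ρt = (∫ z, f₀ z * φ z) + ∫ z, b z * φ z := by
    have hgm : Measurable (gainE g (timeIntegralE g₀ g f t)) :=
      (measurable_gainE (α := Unit) hb.measurable (f := fun _ => timeIntegralE g₀ g f t)
        ((measurable_timeIntegralE hb hf t).comp measurable_snd)).comp
        (f := fun z : Phase => ((), z)) (by fun_prop)
    have hgt : ∫⁻ z, gainE g (timeIntegralE g₀ g f t) z < ⊤ := by
      simp_rw [gainE_timeIntegralE hb hf]
      rw [← lintegral_lintegral_swap hqm.aemeasurable]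
      exact hfinq
    have hft := ae_lt_top hf.measurable hf.mass
    have hgt' := ae_lt_top hgm hgt.ne
    have h1 := integral_eq_of_lintegral_eq (μ := volume) (ν := ρt)
      (w := fun z => f z + gainE g (timeIntegralE g₀ g f t) z)
      (e := fun _ => 1) (θ := Prod.snd) (hf.measurable.add hgm) measurable_const
      measurable_snd
      (by filter_upwards [hft, hgt'] with z h1 h2; exact ENNReal.add_lt_top.2 ⟨h1, h2⟩)
      (fun _ => ENNReal.one_lt_top) ?_ hφm
    · simp only [ENNReal.toReal_one, one_mul] at h1
      rw [← h1, ← integral_add]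
      · refine integral_congr_ae ?_
        filter_upwards [hft, hgt', hf₀, hbt] with z h1 h2 h3 h4
        rw [h3, h4, ENNReal.toReal_add h1.ne h2.ne, add_mul]
      · exact (L1.integrable_coeFn f₀).mul_bdd hφm.aestronglyMeasurable
          (Filter.Eventually.of_forall hM1)
      · exact (L1.integrable_coeFn b).mul_bdd hφm.aestronglyMeasurable
          (Filter.Eventually.of_forall hM1)
    · intro ψ hψ
      rw [hρl _ (by fun_prop)]
      simp only [one_mul, mul_add]
      have hfm := hf.measurable
      rw [lintegral_add_left (by fun_prop)]
      congr 1
      · simp_rw [mul_comm]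
      · simp_rw [gainE_timeIntegralE hb hf]
        rw [lintegral_lintegral_swap (by fun_prop)]
        refine lintegral_congr fun z => ?_
        have : Measurable fun s => q s z := hqm.comp (f := fun s : ℝ => (s, z)) (by fun_prop)
        rw [← lintegral_const_mul _ this]
        simp_rw [mul_comm]
  -- The contribution at time `s` of a particle emitted at `p`, extended by zero to times before its
  -- emission so that all `s ≤ t` share the finite measure `ρt`.
  set K : ℝ → ℝ × Phase → ℝ := fun s p => if p.1 ≤ s then
    Real.exp (-((s - p.1) * lossRate g₀ p.2.2)) * η (freeFlow (s - p.1) p.2) else 0 with hK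
  have hKm : Measurable (Function.uncurry K) :=
    Measurable.ite (measurableSet_le measurable_snd.fst measurable_fst) (by fun_prop)
      measurable_const
  have hKb : ∀ s p, ‖K s p‖ ≤ M := by
    intro s p
    have hM0 : 0 ≤ M := (norm_nonneg _).trans (hM1 p.2)
    simp only [hK]
    split_ifs with h
    · rw [norm_mul, Real.norm_of_nonneg (Real.exp_nonneg _)]
      refine (mul_le_of_le_one_left (norm_nonneg _) ?_).trans (hM2 _)
      rw [Real.exp_le_one_iff, neg_nonpos]
      exact mul_nonneg (sub_nonneg.2 h) (hb.loss_nonneg _)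
    · simpa using hM0
  have hKs : ∀ s ∈ Ioc 0 t, ∫ z, solutionR g₀ g f s z * η z = ∫ p, K s p ∂ρt := by
    intro s hs
    have h1 : ∫ z, solutionR g₀ g f s z * η z = ∫ z, (u s z).toReal * η z := by
      simp [solutionR, hs.1.le, hu]
    rw [h1, hA s hs.1.le η hηm, ← integral_indicator (measurableSet_fst_le s)]
    have h2 : ∀ p, {p : ℝ × Phase | p.1 ≤ s}.indicator (fun p =>
        Real.exp (-((s - p.1) * lossRate g₀ p.2.2)) * η (freeFlow (s - p.1) p.2)) p
        = {p : ℝ × Phase | p.1 ≤ t}.indicator (K s) p := by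
      intro p
      by_cases hp : p.1 ≤ s
      · simp [indicator, hK, hp, hp.trans hs.2]
      · simp [indicator, hK, hp]
    simp_rw [h2]
    rw [integral_indicator (measurableSet_fst_le t)]
  have hKp : ∀ᵐ p ∂ρt, ∫ s in Ioc 0 t, K s p
      = Real.exp (-((t - p.1) * lossRate g₀ p.2.2)) * φ (freeFlow (t - p.1) p.2) - φ p.2 := by
    filter_upwards [hρ0, ae_restrict_mem (measurableSet_fst_le t)] with p hp0 hpt
    rw [← hφ.integral_damped (lossRate g₀) p.2 hpt, ← integral_indicator measurableSet_Ioc,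
      ← integral_indicator measurableSet_Ioc]
    refine integral_congr_ae ?_
    -- At the emission time itself the indicators disagree; this is one null point.
    filter_upwards [Measure.ae_ne volume p.1] with s hs
    rcases lt_trichotomy p.1 s with h | h | h
    · simp [indicator, hK, hη, h, h.le, hp0.trans_lt h]
    · exact absurd h.symm hs
    · simp [indicator, hK, h.not_ge, h.not_gt]
  have hsolη : Integrable (Function.uncurry fun s z => solutionR g₀ g f s z * η z)
      ((volume.restrict (Ioc 0 t)).prod volume) :=
    (integrable_solutionR_prod hb hf t).mul_bdd (hηm.comp measurable_snd).aestronglyMeasurable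
      (Filter.Eventually.of_forall fun p => hM2 p.2)
  have hLHS : ∫ z, (∫ θ in (0 : ℝ)..t, solution hb hf θ : L1) z * η z
      = ∫ p, (Real.exp (-((t - p.1) * lossRate g₀ p.2.2)) * φ (freeFlow (t - p.1) p.2)
        - φ p.2) ∂ρt := by
    calc ∫ z, (∫ θ in (0 : ℝ)..t, solution hb hf θ : L1) z * η z
        = ∫ z, ∫ s in Ioc 0 t, solutionR g₀ g f s z * η z := by
          refine integral_congr_ae ?_
          filter_upwards [coeFn_integral_solution_real hb hf ht] with z hz
          rw [hz, integral_mul_const]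
      _ = ∫ s in Ioc 0 t, ∫ z, solutionR g₀ g f s z * η z := (integral_integral_swap hsolη).symm
      _ = ∫ s in Ioc 0 t, ∫ p, K s p ∂ρt := setIntegral_congr_fun measurableSet_Ioc hKs
      _ = ∫ p, (∫ s in Ioc 0 t, K s p) ∂ρt := by
          refine integral_integral_swap ?_
          exact Integrable.of_bound hKm.aestronglyMeasurable M
            (Filter.Eventually.of_forall fun x => hKb x.1 x.2)
      _ = _ := integral_congr_ae hKp
  have hint : ∀ F : L1, Integrable fun z => F z * φ z := fun F =>
    (L1.integrable_coeFn F).mul_bdd hφm.aestronglyMeasurable (Filter.Eventually.of_forall hM1)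
  have hRHS : ∫ z, (solution hb hf t - f₀ - b : L1) z * φ z
      = (∫ z, (u t z).toReal * φ z) - ((∫ z, f₀ z * φ z) + ∫ z, b z * φ z) := by
    have h1 : ∫ z, (u t z).toReal * φ z = ∫ z, solution hb hf t z * φ z := by
      refine integral_congr_ae ?_
      filter_upwards [coeFn_solution hb hf ht] with z hz
      rw [hz]
    rw [h1, ← sub_sub, ← integral_sub (hint _) (hint _),
      ← integral_sub ((hint _).sub' (hint _)) (hint _)]
    refine integral_congr_ae ?_
    filter_upwards [Lp.coeFn_sub (solution hb hf t - f₀) b, Lp.coeFn_sub (solution hb hf t) f₀]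
      with z h2 h3
    rw [h2, Pi.sub_apply, h3, Pi.sub_apply]
    ring
  have hexp : ∀ p ∈ {p : ℝ × Phase | p.1 ≤ t},
      ‖Real.exp (-((t - p.1) * lossRate g₀ p.2.2)) * φ (freeFlow (t - p.1) p.2)‖ ≤ M := by
    intro p hp
    rw [norm_mul, Real.norm_of_nonneg (Real.exp_nonneg _)]
    refine (mul_le_of_le_one_left (norm_nonneg _) ?_).trans (hM1 _)
    rw [Real.exp_le_one_iff, neg_nonpos]
    exact mul_nonneg (sub_nonneg.2 hp) (hb.loss_nonneg _)
  rw [hLHS, hRHS, hA t ht φ hφm, ← hC, integral_sub]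
  · refine Integrable.of_bound (Measurable.aestronglyMeasurable (by fun_prop)) M ?_
    filter_upwards [ae_restrict_mem (measurableSet_fst_le t)] with p hp
    exact hexp p hp
  · exact Integrable.of_bound (hφm.comp measurable_snd).aestronglyMeasurable M
      (Filter.Eventually.of_forall fun p => hM1 p.2)

lemma isMildSolution_solution (hb : IsBackground g₀ g) (hf : IsInitial f) {f₀ : L1}
    (hf₀ : f₀ =ᵐ[volume] fun z => (f z).toReal) {T : ℝ} (hT : 0 ≤ T) :
    IsMildSolution (IsAPlusB g₀) T f₀ (solution hb hf) := by
  refine ⟨intervalIntegrable_solution hb hf hT, fun t ht => ?_⟩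
  have hfin : ∫⁻ z, timeIntegralE g₀ g f t z * lossE g z.2 ≠ ⊤ := by
    have := lintegral_loss_solutionE_lt_top hb hf t
    have hm := measurable_solutionE hb hf.measurable
    have hl := measurable_lossE hb.measurable
    rw [lintegral_lintegral_swap (Measurable.aemeasurable
      (hm.mul (hl.comp measurable_snd.snd)))] at this
    refine ne_of_eq_of_ne (lintegral_congr fun z => ?_) this.ne
    have hmz : Measurable fun s => solutionE g₀ g f s z :=
      hm.comp (f := fun s : ℝ => (s, z)) (by fun_prop)
    rw [timeIntegralE, lintegral_mul_const _ hmz]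
  obtain ⟨b, hB, hbt⟩ := exists_isB hb (measurable_timeIntegralE hb hf t)
    (coeFn_integral_solution hb hf ht.1) hfin
  exact ⟨_, b, isA_solution hb hf ht.1 hf₀ hbt, hB, by abel⟩

end Existence

end

section

attribute [local irreducible] crossSection scatter

/-! ### Fourier series on the torus -/

section Fourier

open UnitAddTorus Filter Topology

/-- Trigonometric polynomials are uniformly dense, so `u` integrates to zero against every
continuous function. Thickened indicators carry this over to closed sets, which determine `u`. -/
lemma ae_eq_zero_of_integral_mFourier_eq_zero {u : Torus → ℂ} (hu : Integrable u)
    (h : ∀ k : Fin 3 → ℤ, ∫ x, u x * mFourier k x = 0) : u =ᵐ[volume] 0 := by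
  have hcont : ∀ χ : C(Torus, ℂ), ∫ x, u x * χ x = 0 := by
    have hint : ∀ χ : C(Torus, ℂ), Integrable fun x => u x * χ x := fun χ =>
      hu.mul_bdd χ.continuous.aestronglyMeasurable
        (Filter.Eventually.of_forall fun x => χ.norm_coe_le_norm x)
    let ℓ : C(Torus, ℂ) →ₗ[ℂ] ℂ :=
      { toFun := fun χ => ∫ x, u x * χ x
        map_add' := fun χ₁ χ₂ => by
          rw [← integral_add (hint _) (hint _)]
          simp [mul_add]
        map_smul' := fun c χ => by
          simp only [RingHom.id_apply, smul_eq_mul, ← integral_const_mul]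
          refine integral_congr_ae (Filter.Eventually.of_forall fun x => ?_)
          simp only [ContinuousMap.smul_apply, smul_eq_mul]
          ring }
    let ℓc : C(Torus, ℂ) →L[ℂ] ℂ := ℓ.mkContinuous (∫ x, ‖u x‖) fun χ => by
      calc ‖∫ x, u x * χ x‖ ≤ ∫ x, ‖u x * χ x‖ := norm_integral_le_integral_norm _
        _ ≤ ∫ x, ‖u x‖ * ‖χ‖ := by
            refine integral_mono (hint χ).norm (hu.norm.mul_const _) fun x => ?_
            rw [norm_mul]
            gcongr
            exact χ.norm_coe_le_norm x
        _ = _ := integral_mul_const _ _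
    intro χ
    have hker : (Submodule.span ℂ (range (mFourier (d := Fin 3)))).topologicalClosure
        ≤ LinearMap.ker ℓc.toLinearMap := by
      refine Submodule.topologicalClosure_minimal _ (Submodule.span_le.2 ?_) ℓc.isClosed_ker
      rintro _ ⟨k, rfl⟩
      exact h k
    rw [span_mFourier_closure_eq_top] at hker
    exact hker (Submodule.mem_top (x := χ))
  refine ae_eq_zero_of_forall_setIntegral_isClosed_eq_zero hu fun s hs => ?_
  have hpos : ∀ n : ℕ, 0 < 1 / ((n : ℝ) + 1) := fun n => Nat.one_div_pos_of_nat
  have hlim := thickenedIndicator_tendsto_indicator_closure hpos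
    tendsto_one_div_add_atTop_nhds_zero_nat s
  rw [hs.closure_eq, tendsto_pi_nhds] at hlim
  have h1 : Tendsto (fun n : ℕ => ∫ x, u x * ((thickenedIndicator (hpos n) s x : ℝ) : ℂ)) atTop
      (𝓝 (∫ x, s.indicator u x)) := by
    refine tendsto_integral_of_dominated_convergence (fun x => ‖u x‖) (fun n => ?_) hu.norm
      (fun n => Filter.Eventually.of_forall fun x => ?_) (Filter.Eventually.of_forall fun x => ?_)
    · refine hu.aestronglyMeasurable.mul (Continuous.aestronglyMeasurable ?_)
      have := (thickenedIndicator (hpos n) s).continuous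
      fun_prop
    · rw [norm_mul]
      refine mul_le_of_le_one_right (norm_nonneg _) ?_
      simpa using thickenedIndicator_le_one (hpos n) s x
    · have h2 : Tendsto (fun n : ℕ => u x * ((thickenedIndicator (hpos n) s x : ℝ) : ℂ)) atTop
          (𝓝 (u x * (((s.indicator (fun _ => (1 : NNReal)) x : NNReal) : ℝ) : ℂ))) := by
        refine Tendsto.const_mul _ ?_
        exact (Complex.continuous_ofReal.comp NNReal.continuous_coe).continuousAt.tendsto.comp
          (hlim x)
      convert h2 using 2
      by_cases hx : x ∈ s <;> simp [hx]
  rw [← integral_indicator hs.measurableSet]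
  refine tendsto_nhds_unique h1 (tendsto_const_nhds.congr fun n => ?_)
  symm
  exact hcont ⟨fun x => ((thickenedIndicator (hpos n) s x : ℝ) : ℂ), by
    have := (thickenedIndicator (hpos n) s).continuous
    fun_prop⟩

/-- The frequency `2 π i k · v` of the Fourier mode `k` along a trajectory with velocity `v`. -/
def freq (k : Fin 3 → ℤ) (v : Vel) : ℂ := ((2 * Real.pi * ∑ i, (k i : ℝ) * v i : ℝ) : ℂ) * Complex.I

lemma freq_smul (k : Fin 3 → ℤ) (s : ℝ) (v : Vel) : freq k (s • v) = s * freq k v := by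
  have : ∑ i, (k i : ℝ) * (s • v) i = s * ∑ i, (k i : ℝ) * v i := by
    rw [Finset.mul_sum]
    exact Finset.sum_congr rfl fun i _ => by simp; ring
  rw [freq, freq, this]
  push_cast; ring

lemma freq_add (k : Fin 3 → ℤ) (v w : Vel) : freq k (v + w) = freq k v + freq k w := by
  simp only [freq, PiLp.add_apply, mul_add, Finset.sum_add_distrib]
  push_cast; ring

lemma freq_re (k : Fin 3 → ℤ) (v : Vel) : (freq k v).re = 0 := by
  simp [freq]

lemma contDiff_freq (k : Fin 3 → ℤ) : ContDiff ℝ ∞ (freq k) := by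
  unfold freq
  have h : ∀ i : Fin 3, ContDiff ℝ ∞ fun v : Vel => v i := fun i =>
    (EuclideanSpace.proj (𝕜 := ℝ) i).contDiff
  refine ContDiff.mul ?_ contDiff_const
  refine Complex.ofRealCLM.contDiff.comp ?_
  exact contDiff_const.mul (ContDiff.sum fun i _ => contDiff_const.mul (h i))

lemma norm_freq_le (k : Fin 3 → ℤ) : ∃ C, 0 ≤ C ∧ ∀ v, ‖freq k v‖ ≤ C * ‖v‖ := by
  refine ⟨2 * Real.pi * ∑ i, |(k i : ℝ)|, by positivity, fun v => ?_⟩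
  rw [freq, norm_mul, Complex.norm_I, mul_one, Complex.norm_real, Real.norm_eq_abs, abs_mul,
    abs_of_nonneg (by positivity : 0 ≤ 2 * Real.pi), mul_assoc (2 * Real.pi)]
  refine mul_le_mul_of_nonneg_left ?_ (by positivity)
  rw [Finset.sum_mul]
  refine (Finset.abs_sum_le_sum_abs _ _).trans (Finset.sum_le_sum fun i _ => ?_)
  rw [abs_mul]
  gcongr
  exact PiLp.norm_apply_le v i

lemma mFourier_toTorus (k : Fin 3 → ℤ) (y : Vel) :
    mFourier k (toTorus y) = Complex.exp (freq k y) := by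
  simp only [mFourier, ContinuousMap.coe_mk, toTorus, fourier_coe_apply, freq]
  rw [← Complex.exp_sum]
  congr 1
  push_cast
  rw [Finset.mul_sum, Finset.sum_mul]
  refine Finset.sum_congr rfl fun i _ => ?_
  ring

lemma mFourier_add_toTorus (k : Fin 3 → ℤ) (x : Torus) (y : Vel) :
    mFourier k (x + toTorus y) = mFourier k x * Complex.exp (freq k y) := by
  obtain ⟨w, rfl⟩ := isOpenQuotientMap_toTorus.surjective x
  rw [← toTorus_add, mFourier_toTorus, mFourier_toTorus, freq_add, Complex.exp_add]

lemma norm_mFourier_apply (k : Fin 3 → ℤ) (x : Torus) : ‖mFourier k x‖ ≤ 1 :=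
  ((mFourier k).norm_coe_le_norm x).trans_eq mFourier_norm

/-- The estimate for the resolvent of the transport operator on the torus, at a fixed velocity. -/
lemma lintegral_le_of_fourier {H m : Torus → ℝ} (hH : Integrable H) (hm : Integrable m)
    (hmm : Measurable m) (v : Vel) {c : ℝ} (hc : 0 < c)
    (h : ∀ k, (c - freq k v) * ∫ x, (H x : ℂ) * mFourier k x = ∫ x, (m x : ℂ) * mFourier k x) :
    ENNReal.ofReal c * ∫⁻ x, ‖H x‖ₑ ≤ ∫⁻ x, ‖m x‖ₑ := by
  have htm : Measurable toTorus := continuous_toTorus.measurable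
  -- The integral of `K` over `s > 0` is the resolvent `(c + v · ∂ₓ)⁻¹ m` along characteristics. Its
  -- norm is at most `c⁻¹ ‖m‖` because translations preserve the norm.
  set K : Torus → ℝ → ℝ := fun x s => Real.exp (-(c * s)) * m (x - toTorus (s • v)) with hK
  have hKm : Measurable (Function.uncurry K) := by
    simp only [hK, Function.uncurry_def]
    fun_prop
  have hexp : ∫⁻ s in Ioi (0 : ℝ), ENNReal.ofReal (Real.exp (-(c * s))) = ENNReal.ofReal (c⁻¹) := by
    rw [← ofReal_integral_eq_lintegral_ofReal]
    · congr 1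
      have := integral_exp_mul_Ioi (a := -c) (by linarith) 0
      simp only [neg_mul, mul_zero, Real.exp_zero] at this
      rw [this, neg_div_neg_eq, one_div]
    · have := integrableOn_exp_mul_Ioi (a := -c) (by linarith) 0
      simp only [neg_mul] at this
      exact this
    · exact Filter.Eventually.of_forall fun s => Real.exp_nonneg _
  have hKl : ∫⁻ x, ∫⁻ s in Ioi (0 : ℝ), ‖K x s‖ₑ = ENNReal.ofReal c⁻¹ * ∫⁻ x, ‖m x‖ₑ := by
    rw [lintegral_lintegral_swap (by fun_prop), ← hexp, ← lintegral_mul_const _ (by fun_prop)]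
    refine lintegral_congr fun s => ?_
    simp only [hK, enorm_mul]
    rw [lintegral_const_mul _ (by fun_prop), Real.enorm_of_nonneg (Real.exp_nonneg _)]
    congr 1
    exact lintegral_sub_right_eq_self (fun x => ‖m x‖ₑ) (toTorus (s • v))
  have hKi : Integrable (Function.uncurry K) (volume.prod (volume.restrict (Ioi 0))) := by
    refine ⟨hKm.aestronglyMeasurable, ?_⟩
    rw [HasFiniteIntegral, lintegral_prod _ (by fun_prop)]
    refine hKl.trans_lt (ENNReal.mul_lt_top ENNReal.ofReal_lt_top hm.2)
  set R : Torus → ℝ := fun x => ∫ s in Ioi (0 : ℝ), K x s with hR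
  have hRi : Integrable R := hKi.integral_prod_left
  have hne : ∀ k, (c - freq k v : ℂ) ≠ 0 := fun k h0 => by
    have := congrArg Complex.re h0
    simp [freq_re] at this
    exact hc.ne' this
  have hRk : ∀ k, (c - freq k v) * ∫ x, (R x : ℂ) * mFourier k x
      = ∫ x, (m x : ℂ) * mFourier k x := by
    intro k
    have h1 : ∀ s : ℝ, ∫ x, (m (x - toTorus (s • v)) : ℂ) * mFourier k x
        = (∫ x, (m x : ℂ) * mFourier k x) * Complex.exp (s * freq k v) := by
      intro s
      rw [← integral_mul_const, ← integral_add_right_eq_self _ (toTorus (s • v))]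
      refine integral_congr_ae (Filter.Eventually.of_forall fun x => ?_)
      simp only [add_sub_cancel_right, mFourier_add_toTorus, freq_smul]
      ring
    have h2 : ∫ x, (R x : ℂ) * mFourier k x
        = ∫ s in Ioi (0 : ℝ), ∫ x, (K x s : ℂ) * mFourier k x := by
      rw [← integral_integral_swap]
      · refine integral_congr_ae (Filter.Eventually.of_forall fun x => ?_)
        simp only [hR]
        rw [integral_mul_const, integral_complex_ofReal]
      · refine Integrable.mul_bdd (c := 1) hKi.ofReal ?_
          (Filter.Eventually.of_forall fun p => norm_mFourier_apply k p.1)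
        exact ((mFourier k).continuous.comp continuous_fst).aestronglyMeasurable
    have h3 : ∀ s : ℝ, ∫ x, (K x s : ℂ) * mFourier k x
        = Complex.exp (-(c - freq k v) * s) * ∫ x, (m x : ℂ) * mFourier k x := by
      intro s
      have : ∀ x, (K x s : ℂ) * mFourier k x
          = Complex.exp (-(c * s)) * ((m (x - toTorus (s • v)) : ℂ) * mFourier k x) := by
        intro x
        simp only [hK]
        push_cast
        ring
      simp_rw [this]
      rw [integral_const_mul, h1, mul_left_comm, ← Complex.exp_add, mul_comm]
      congr 2
      ring
    have h4 := integral_exp_mul_complex_Ioi (a := -(c - freq k v)) (by simp [freq_re, hc]) 0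
    simp only [Complex.ofReal_zero, mul_zero, Complex.exp_zero, neg_div_neg_eq] at h4
    simp_rw [h2, h3]
    rw [integral_mul_const, h4, ← mul_assoc, mul_one_div_cancel (hne k), one_mul]
  -- Both functions satisfy the same equation on every mode, and `c - freq k v` has real part `c >
  -- 0`, so it can be cancelled.
  have hHR : H =ᵐ[volume] R := by
    have := ae_eq_zero_of_integral_mFourier_eq_zero (u := fun x => (H x : ℂ) - R x)
      (hH.ofReal.sub hRi.ofReal) fun k => by
        have hint : ∀ w : Torus → ℝ, Integrable w → Integrable fun x => (w x : ℂ) * mFourier k x :=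
          fun w hw => hw.ofReal.mul_bdd (mFourier k).continuous.aestronglyMeasurable
            (Filter.Eventually.of_forall fun x => norm_mFourier_apply k x)
        simp_rw [sub_mul]
        rw [integral_sub (hint _ hH) (hint _ hRi), sub_eq_zero]
        exact mul_left_cancel₀ (hne k) ((h k).trans (hRk k).symm)
    filter_upwards [this] with x hx
    have : (H x : ℂ) - R x = 0 := hx
    exact_mod_cast sub_eq_zero.1 this
  have hle : ∫⁻ x, ‖H x‖ₑ ≤ ENNReal.ofReal c⁻¹ * ∫⁻ x, ‖m x‖ₑ := by
    rw [← hKl]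
    refine lintegral_mono_ae ?_
    filter_upwards [hHR] with x hx
    rw [hx]
    exact enorm_integral_le_lintegral_enorm _
  calc ENNReal.ofReal c * ∫⁻ x, ‖H x‖ₑ
      ≤ ENNReal.ofReal c * (ENNReal.ofReal c⁻¹ * ∫⁻ x, ‖m x‖ₑ) := by gcongr
    _ = ∫⁻ x, ‖m x‖ₑ := by
      rw [← mul_assoc, ← ENNReal.ofReal_mul hc.le, mul_inv_cancel₀ hc.ne', ENNReal.ofReal_one,
        one_mul]

end Fourier

end

section

attribute [local irreducible] crossSection scatter toTorus

/-! ### The transport operator on Fourier modes -/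

section Uniqueness

open UnitAddTorus

variable {g₀ : Vel → ℝ} {g : Vel → ℝ≥0∞}

lemma isTestFunction_mode (k : Fin 3 → ℤ) (ℓ : ℂ →L[ℝ] ℝ) {β : Vel → ℝ} (hβ : ContDiff ℝ ∞ β)
    (hβc : HasCompactSupport β) :
    IsTestFunction fun z : Phase => β z.2 * ℓ (mFourier k z.1) := by
  refine ⟨?_, ?_⟩
  · simp only [mFourier_toTorus]
    refine (hβ.comp contDiff_snd).mul (ℓ.contDiff.comp ?_)
    exact ((contDiff_freq k).comp contDiff_fst).cexp
  · refine HasCompactSupport.intro (isCompact_univ.prod hβc) fun z hz => ?_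
    have : β z.2 = 0 := by
      by_contra h
      exact hz ⟨mem_univ _, subset_tsupport _ h⟩
    simp [this]

lemma transport_mode (k : Fin 3 → ℤ) (ℓ : ℂ →L[ℝ] ℝ) (β : Vel → ℝ) (z : Phase) :
    transport (fun z : Phase => β z.2 * ℓ (mFourier k z.1)) z
      = β z.2 * ℓ (freq k z.2 * mFourier k z.1) := by
  have h1 : HasDerivAt (fun s : ℝ => mFourier k z.1 * Complex.exp (freq k (s • z.2)))
      (freq k z.2 * mFourier k z.1) 0 := by
    simp_rw [freq_smul]
    have h2 : HasDerivAt (fun s : ℝ => (s : ℂ) * freq k z.2) (1 * freq k z.2) 0 :=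
      Complex.ofRealCLM.hasDerivAt.mul_const _
    have h3 := h2.cexp.const_mul (mFourier k z.1)
    simp only [Complex.ofReal_zero, zero_mul, Complex.exp_zero, one_mul] at h3
    rwa [mul_comm (mFourier k z.1) (freq k z.2)] at h3
  have h4 := ((ℓ.hasFDerivAt.comp_hasDerivAt (0 : ℝ) h1).const_mul (β z.2)).deriv
  rw [transport, ← h4]
  congr 1
  ext s
  simp [freeFlow, mFourier_add_toTorus]

/-- Products `β(v) e_k(x)` are eigenfunctions of the transport at fixed `v`. Testing with them and
letting `β` vary gives the identity at almost every velocity. -/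
lemma IsA.fourier (hb : IsBackground g₀ g) {H a : L1} (h : IsA g₀ H a) (k : Fin 3 → ℤ) :
    ∀ᵐ v : Vel, (freq k v - lossRate g₀ v) * ∫ x : Torus, (H (x, v) : ℂ) * mFourier k x
      = ∫ x : Torus, (a (x, v) : ℂ) * mFourier k x := by
  -- Multiplying `H` by the frequencies may destroy integrability. Division by `w` restores it, and
  -- `w` is smooth, so `β / w` is still admissible in a test function.
  set w : Vel → ℝ := fun v => 1 + ‖v‖ ^ 2 with hw
  have hw0 : ∀ v, 0 < w v := fun v => by positivity
  have hwd : ContDiff ℝ ∞ w := contDiff_const.add (contDiff_norm_sq ℝ)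
  have hL := hb.measurable_loss
  have hfm : Measurable (freq k) := (contDiff_freq k).continuous.measurable
  have hem : Measurable (mFourier k) := (mFourier k).continuous.measurable
  have hwm : Measurable w := hwd.continuous.measurable
  have hHi : Integrable fun z : Phase => (H z : ℂ) := (L1.integrable_coeFn H).ofReal
  have hai : Integrable fun z : Phase => (a z : ℂ) := (L1.integrable_coeFn a).ofReal
  set c : Phase → ℂ := fun z => (freq k z.2 - lossRate g₀ z.2) * mFourier k z.1 * (w z.2)⁻¹ with hc
  set d : Phase → ℂ := fun z => mFourier k z.1 * (w z.2)⁻¹ with hd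
  have hcm : Measurable c := by fun_prop
  have hdm : Measurable d := by fun_prop
  have hdb : ∀ z, ‖d z‖ ≤ 1 := by
    intro z
    rw [hd, norm_mul, Complex.norm_real, norm_inv, Real.norm_of_nonneg (hw0 _).le]
    refine mul_le_one₀ (norm_mFourier_apply k z.1) (by have := hw0 z.2; positivity) ?_
    exact inv_le_one_of_one_le₀ (by simp [hw])
  obtain ⟨C, hC⟩ : ∃ C, ∀ z, ‖c z‖ ≤ C := by
    obtain ⟨C₁, h1, hC₁⟩ := norm_freq_le k
    obtain ⟨C₂, hC₂⟩ := hb.loss_le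
    refine ⟨C₁ + 2 * |C₂|, fun z => ?_⟩
    rw [hc, norm_mul, norm_mul, Complex.norm_real, norm_inv, Real.norm_of_nonneg (hw0 _).le,
      ← div_eq_mul_inv, div_le_iff₀ (hw0 _)]
    have hv : ‖z.2‖ ≤ w z.2 := by simp only [hw]; nlinarith [sq_nonneg (‖z.2‖ - 1)]
    have hv' : 1 + ‖z.2‖ ≤ 2 * w z.2 := by simp only [hw]; nlinarith [sq_nonneg (‖z.2‖ - 1)]
    calc ‖freq k z.2 - lossRate g₀ z.2‖ * ‖mFourier k z.1‖
        ≤ ‖freq k z.2 - lossRate g₀ z.2‖ :=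
          mul_le_of_le_one_right (norm_nonneg _) (norm_mFourier_apply k z.1)
      _ ≤ ‖freq k z.2‖ + lossRate g₀ z.2 := by
          refine (norm_sub_le _ _).trans_eq ?_
          rw [Complex.norm_real, Real.norm_of_nonneg (hb.loss_nonneg _)]
      _ ≤ C₁ * ‖z.2‖ + |C₂| * (1 + ‖z.2‖) := by
          refine add_le_add (hC₁ _) ((hC₂ _).trans ?_)
          gcongr
          exact le_abs_self _
      _ ≤ C₁ * w z.2 + |C₂| * (2 * w z.2) := by gcongr
      _ = _ := by ring
  set J : Phase → ℂ := fun z => H z * c z - a z * d z with hJ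
  have hJi : Integrable J :=
    (hHi.mul_bdd hcm.aestronglyMeasurable (Filter.Eventually.of_forall hC)).sub
      (hai.mul_bdd hdm.aestronglyMeasurable (Filter.Eventually.of_forall hdb))
  have hJ0 : ∀ β : Vel → ℝ, ContDiff ℝ ∞ β → HasCompactSupport β →
      ∫ v, β v • ∫ x : Torus, J (x, v) = 0 := by
    intro β hβ hβc
    obtain ⟨M, hM⟩ := hβc.exists_bound_of_continuous hβ.continuous
    have hβJ : Integrable fun z : Phase => β z.2 • J z := by
      refine hJi.bdd_smul M ?_ (Filter.Eventually.of_forall fun z => hM z.2)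
      exact (hβ.continuous.comp continuous_snd).aestronglyMeasurable
    have hsw : ∫ v, β v • ∫ x : Torus, J (x, v) = ∫ z : Phase, β z.2 • J z := by
      rw [Measure.volume_eq_prod, integral_prod_symm _ hβJ]
      refine integral_congr_ae (Filter.Eventually.of_forall fun v => ?_)
      simp only [integral_smul]
    -- Test functions are real-valued, so the complex mode enters through a real functional; the
    -- real and imaginary parts suffice in the end.
    have hℓ : ∀ ℓ : ℂ →L[ℝ] ℝ, ℓ (∫ z : Phase, β z.2 • J z) = 0 := by
      intro ℓ
      have hβw : ContDiff ℝ ∞ fun v => β v * (w v)⁻¹ := hβ.mul (hwd.inv fun v => (hw0 v).ne')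
      have hβwc : HasCompactSupport fun v => β v * (w v)⁻¹ := hβc.mul_right
      have htest := isTestFunction_mode k ℓ hβw hβwc
      have hφ := h _ htest
      obtain ⟨M', hM1, hM2⟩ := htest.exists_bound hb
      rw [← ℓ.integral_comp_comm hβJ]
      rw [← sub_eq_zero, ← integral_sub] at hφ
      · rw [← hφ]
        refine integral_congr_ae (Filter.Eventually.of_forall fun z => ?_)
        dsimp only
        rw [transport_mode k ℓ (fun v => β v * (w v)⁻¹) z]
        have e1 : β z.2 • J z = (β z.2 * (w z.2)⁻¹) • (H z • (freq k z.2 * mFourier k z.1)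
            - (H z * lossRate g₀ z.2 + a z) • mFourier k z.1) := by
          simp only [hJ, hc, hd, Complex.real_smul]
          push_cast
          ring
        rw [e1, map_smul, map_sub, map_smul, map_smul]
        simp only [smul_eq_mul]
        ring
      · refine (L1.integrable_coeFn H).mul_bdd ?_ (Filter.Eventually.of_forall hM2)
        have h1 := htest.continuous_transport.measurable
        have h2 := htest.continuous.measurable
        exact (h1.sub ((hL.comp measurable_snd).mul h2)).aestronglyMeasurable
      · exact (L1.integrable_coeFn a).mul_bdd htest.continuous.aestronglyMeasurable
          (Filter.Eventually.of_forall hM1)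
    rw [hsw]
    exact Complex.ext (hℓ Complex.reCLM) (hℓ Complex.imCLM)
  have hJl : LocallyIntegrable fun v : Vel => ∫ x : Torus, J (x, v) :=
    (Integrable.integral_prod_right hJi).locallyIntegrable
  filter_upwards [ae_eq_zero_of_integral_contDiff_smul_eq_zero hJl hJ0, hHi.prod_left_ae,
    hai.prod_left_ae] with v hv h1 h2
  have hint : ∀ {q : Torus → ℂ}, Integrable q → Integrable fun x => q x * mFourier k x :=
    fun hq => hq.mul_bdd hem.aestronglyMeasurable
      (Filter.Eventually.of_forall fun x => norm_mFourier_apply k x)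
  have hJv : ∀ x, J (x, v) = ((w v)⁻¹ : ℂ) * ((freq k v - lossRate g₀ v) *
      ((H (x, v) : ℂ) * mFourier k x) - (a (x, v) : ℂ) * mFourier k x) := by
    intro x
    simp only [hJ, hc, hd]
    push_cast
    ring
  simp_rw [hJv] at hv
  rw [integral_const_mul, integral_sub ((hint h1).const_mul _) (hint h2), integral_const_mul] at hv
  have hwne : ((w v)⁻¹ : ℂ) ≠ 0 := inv_ne_zero (by exact_mod_cast (hw0 v).ne')
  exact sub_eq_zero.1 ((mul_eq_zero.1 hv).resolve_left hwne)

/-- The resolvent estimate for the operator `A`. -/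
lemma IsA.resolvent_le (hb : IsBackground g₀ g) {H a : L1} (h : IsA g₀ H a) {r : ℝ} (hr : 0 < r) :
    ENNReal.ofReal r * ‖H‖ₑ + ∫⁻ z, ‖H z‖ₑ * lossE g z.2 ≤ ‖r • H - a‖ₑ := by
  have hHm : Measurable H := (Lp.stronglyMeasurable H).measurable
  have ham : Measurable a := (Lp.stronglyMeasurable a).measurable
  have hlm := measurable_lossE hb.measurable
  set m : Phase → ℝ := fun z => r * H z - a z with hm
  have hmm : Measurable m := by fun_prop
  have hmi : Integrable m := ((L1.integrable_coeFn H).const_mul r).sub (L1.integrable_coeFn a)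
  have h1 : ‖r • H - a‖ₑ = ∫⁻ z, ‖m z‖ₑ := by
    rw [Lp.enorm_def, eLpNorm_one_eq_lintegral_enorm]
    refine lintegral_congr_ae ?_
    filter_upwards [Lp.coeFn_sub (r • H) a, Lp.coeFn_smul r H] with z h1 h2
    rw [h1, Pi.sub_apply, h2, Pi.smul_apply, smul_eq_mul]
  have h2 : ENNReal.ofReal r * ‖H‖ₑ + ∫⁻ z, ‖H z‖ₑ * lossE g z.2
      = ∫⁻ z, ENNReal.ofReal (r + lossRate g₀ z.2) * ‖H z‖ₑ := by
    rw [Lp.enorm_def, eLpNorm_one_eq_lintegral_enorm, ← lintegral_const_mul _ (by fun_prop),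
      ← lintegral_add_left (by fun_prop)]
    refine lintegral_congr fun z => ?_
    rw [ENNReal.ofReal_add hr.le (hb.loss_nonneg _), hb.loss]
    ring
  have hLm := hb.measurable_loss
  have key : ∀ F : Phase → ℝ≥0∞, Measurable F → ∫⁻ z, F z = ∫⁻ v, ∫⁻ x, F (x, v) := fun F hF => by
    rw [Measure.volume_eq_prod, lintegral_prod_symm _ hF.aemeasurable]
  rw [h1, h2, key _ (by fun_prop), key _ (by fun_prop)]
  refine lintegral_mono_ae ?_
  filter_upwards [ae_all_iff.2 (h.fourier hb), (L1.integrable_coeFn H).prod_left_ae,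
    hmi.prod_left_ae, (L1.integrable_coeFn a).prod_left_ae] with v hv hHv hmv hav
  rw [lintegral_const_mul _ (by fun_prop)]
  -- The damping constant at velocity `v` is `c = r + Λ(v)`, so the loss term appears on the left of
  -- the estimate.
  refine lintegral_le_of_fourier hHv hmv (by fun_prop) v (by linarith [hb.loss_nonneg v]) fun k => ?_
  have hint : ∀ {q : Torus → ℝ}, Integrable q → Integrable fun x => (q x : ℂ) * mFourier k x :=
    fun hq => hq.ofReal.mul_bdd (mFourier k).continuous.aestronglyMeasurable
      (Filter.Eventually.of_forall fun x => norm_mFourier_apply k x)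
  have e1 : ∀ x, (m (x, v) : ℂ) * mFourier k x
      = r * ((H (x, v) : ℂ) * mFourier k x) - (a (x, v) : ℂ) * mFourier k x := by
    intro x
    simp only [hm]
    push_cast
    ring
  simp_rw [e1]
  rw [integral_sub ((hint hHv).const_mul _) (hint hav), integral_const_mul, ← hv k]
  push_cast
  ring

lemma IsA.eq_zero (hb : IsBackground g₀ g) {a : L1} (h : IsA g₀ 0 a) : a = 0 := by
  have ham : Measurable a := (Lp.stronglyMeasurable a).measurable
  have h1 : ∀ᵐ v : Vel, ∀ᵐ x : Torus, a (x, v) = 0 := by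
    filter_upwards [ae_all_iff.2 (h.fourier hb), (L1.integrable_coeFn a).prod_left_ae] with v hv hav
    have h2 := ae_eq_zero_of_integral_mFourier_eq_zero (u := fun x => (a (x, v) : ℂ)) hav.ofReal
      fun k => by simp [← hv k]
    filter_upwards [h2] with x hx
    have : ((a (x, v) : ℝ) : ℂ) = 0 := hx
    exact_mod_cast this
  rw [Lp.eq_zero_iff_ae_eq_zero]
  have hs : MeasurableSet {z : Phase | a z = 0} := ham (measurableSet_singleton 0)
  have h3 : ∀ᵐ q : Vel × Torus, a (q.2, q.1) = 0 :=
    (Measure.ae_prod_iff_ae_ae (measurable_swap hs)).2 h1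
  exact (Measure.measurePreserving_swap (μ := (volume : Measure Torus))
    (ν := (volume : Measure Vel))).quasiMeasurePreserving.ae h3

end Uniqueness

/-! ### Uniqueness of mild solutions -/

section MildUniqueness

variable {g₀ : Vel → ℝ} {g : Vel → ℝ≥0∞}

/-- With `r = s⁻¹`, the loss `‖Λ H‖` in the resolvent estimate for `A` absorbs the gain `‖B H‖`. -/
lemma IsAPlusB.norm_le (hb : IsBackground g₀ g) {H h : L1} (hH : IsAPlusB g₀ H h) {s : ℝ}
    (hs : 0 < s) : ‖H‖ ≤ ‖H - s • h‖ := by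
  obtain ⟨a, b, ha, hB, rfl⟩ := hH
  have hr : 0 < s⁻¹ := inv_pos.2 hs
  have h1 := ha.resolvent_le hb hr
  -- Integrability of `Λ H` is not part of the domain; it is a consequence of the resolvent
  -- estimate.
  have hfin : ∫⁻ z, ‖H z‖ₑ * lossE g z.2 ≠ ⊤ :=
    ne_top_of_le_ne_top enorm_ne_top (le_add_self.trans h1)
  have h2 := (isB_norm_le hb hB hfin)
  have h3 : ENNReal.ofReal s⁻¹ * ‖H‖ₑ + ‖b‖ₑ ≤ ‖s⁻¹ • H - a‖ₑ := le_trans (by gcongr) h1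
  rw [← ofReal_norm, ← ofReal_norm, ← ofReal_norm,
    ← ENNReal.ofReal_mul hr.le, ← ENNReal.ofReal_add (by positivity) (norm_nonneg _),
    ENNReal.ofReal_le_ofReal_iff (norm_nonneg _)] at h3
  have h4 : ‖s⁻¹ • H - a‖ ≤ ‖s⁻¹ • H - (a + b)‖ + ‖b‖ := by
    have : s⁻¹ • H - a = (s⁻¹ • H - (a + b)) + b := by abel
    rw [this]
    exact norm_add_le _ _
  have h5 : ‖H - s • (a + b)‖ = s * ‖s⁻¹ • H - (a + b)‖ := by
    rw [← Real.norm_of_nonneg hs.le, ← norm_smul, Real.norm_of_nonneg hs.le, smul_sub,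
      smul_inv_smul₀ hs.ne']
  rw [h5]
  have h6 : s⁻¹ * ‖H‖ ≤ ‖s⁻¹ • H - (a + b)‖ := by linarith
  rwa [inv_mul_le_iff₀ hs] at h6

lemma IsA.sub (hb : IsBackground g₀ g) {F F' a a' : L1} (h : IsA g₀ F a) (h' : IsA g₀ F' a') :
    IsA g₀ (F - F') (a - a') := by
  intro φ hφ
  obtain ⟨M, hM1, hM2⟩ := hφ.exists_bound hb
  have hL := hb.measurable_loss
  have hm : Measurable fun z : Phase => transport φ z - lossRate g₀ z.2 * φ z :=
    hφ.continuous_transport.measurable.sub ((hL.comp measurable_snd).mul hφ.continuous.measurable)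
  have hi1 : ∀ G : L1, Integrable fun z => G z * (transport φ z - lossRate g₀ z.2 * φ z) :=
    fun G => (L1.integrable_coeFn G).mul_bdd hm.aestronglyMeasurable
      (Filter.Eventually.of_forall hM2)
  have hi2 : ∀ G : L1, Integrable fun z => G z * φ z :=
    fun G => (L1.integrable_coeFn G).mul_bdd hφ.continuous.aestronglyMeasurable
      (Filter.Eventually.of_forall hM1)
  have e1 : ∫ z, (F - F') z * (transport φ z - lossRate g₀ z.2 * φ z)
      = ∫ z, F z * (transport φ z - lossRate g₀ z.2 * φ z)
        - F' z * (transport φ z - lossRate g₀ z.2 * φ z) := by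
    refine integral_congr_ae ?_
    filter_upwards [Lp.coeFn_sub F F'] with z hz
    rw [hz, Pi.sub_apply, sub_mul]
  have e2 : ∫ z, (a - a') z * φ z = ∫ z, a z * φ z - a' z * φ z := by
    refine integral_congr_ae ?_
    filter_upwards [Lp.coeFn_sub a a'] with z hz
    rw [hz, Pi.sub_apply, sub_mul]
  rw [e1, e2, integral_sub (hi1 _) (hi1 _), integral_sub (hi2 _) (hi2 _), h φ hφ, h' φ hφ]

/-- The representative of `F - F'` is a difference only almost everywhere, so `gainIntegrand_ae_eq`
is needed before the integrands can be subtracted. -/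
lemma IsB.sub (hb : IsBackground g₀ g) {F F' b b' : L1} (h : IsB g₀ F b) (h' : IsB g₀ F' b') :
    IsB g₀ (F - F') (b - b') := by
  have hae : ∀ᵐ z : Phase, ∀ᵐ p : Sph × Vel ∂(surf.prod volume),
      gainIntegrand g₀ (F - F' : L1) z p.1 p.2
        = gainIntegrand g₀ F z p.1 p.2 - gainIntegrand g₀ F' z p.1 p.2 := by
    filter_upwards [gainIntegrand_ae_eq hb (Lp.coeFn_sub F F'),
      gainIntegrand_ae_eq hb (Filter.EventuallyEq.refl _ (F : Phase → ℝ)),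
      gainIntegrand_ae_eq hb (Filter.EventuallyEq.refl _ (F' : Phase → ℝ))] with z h1 h2 h3
    filter_upwards [h1, h2, h3] with p h1 h2 h3
    rw [h1, h2, h3, Pi.sub_apply]
    ring
  have hint : ∀ᵐ z : Phase, Integrable
      (fun p : Sph × Vel => gainIntegrand g₀ (F - F' : L1) z p.1 p.2) (surf.prod volume) := by
    filter_upwards [hae, h.1, h'.1] with z h1 h2 h3
    exact (h2.sub h3).congr (h1.mono fun p hp => hp.symm)
  refine ⟨hint, ?_⟩
  filter_upwards [hae, h.1, h'.1, hint, h.2, h'.2, Lp.coeFn_sub b b'] with z h1 h2 h3 h4 h5 h6 h7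
  rw [h7, Pi.sub_apply, h5, h6]
  simp only [gainTerm]
  rw [← integral_prod _ h2, ← integral_prod _ h3, ← integral_prod _ h4, ← integral_sub h2 h3]
  exact integral_congr_ae (h1.mono fun p hp => hp.symm)

lemma IsAPlusB.sub (hb : IsBackground g₀ g) {F F' h h' : L1} (hF : IsAPlusB g₀ F h)
    (hF' : IsAPlusB g₀ F' h') : IsAPlusB g₀ (F - F') (h - h') := by
  obtain ⟨a, b, ha, hB, rfl⟩ := hF
  obtain ⟨a', b', ha', hB', rfl⟩ := hF'
  exact ⟨a - a', b - b', ha.sub hb ha', hB.sub hb hB', by abel⟩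

lemma IsAPlusB.eq_zero (hb : IsBackground g₀ g) {h : L1} (h0 : IsAPlusB g₀ 0 h) : h = 0 := by
  obtain ⟨a, b, ha, hB, rfl⟩ := h0
  have hz : ∫⁻ z, ‖(0 : L1) z‖ₑ * lossE g z.2 = 0 := by simp
  have hb0 := isB_norm_le hb hB (by rw [hz]; exact ENNReal.zero_ne_top)
  rw [hz, nonpos_iff_eq_zero, enorm_eq_zero] at hb0
  rw [ha.eq_zero hb, hb0, add_zero]

/-- Mild solutions of the linear Boltzmann equation are unique. -/
lemma IsMildSolution.unique (hb : IsBackground g₀ g) {T : ℝ} {u₀ : L1} {u u' : ℝ → L1}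
    (hu : IsMildSolution (IsAPlusB g₀) T u₀ u) (hu' : IsMildSolution (IsAPlusB g₀) T u₀ u')
    {t : ℝ} (ht : t ∈ Icc (0 : ℝ) T) : u' t = u t := by
  have hT : 0 ≤ T := ht.1.trans ht.2
  have heq : ∀ t ∈ Icc (0 : ℝ) T,
      IsAPlusB g₀ (∫ θ in (0 : ℝ)..t, (u' θ - u θ)) (u' t - u t) := by
    intro t ht
    have hs : uIcc 0 t ⊆ uIcc 0 T := by
      rw [uIcc_of_le ht.1, uIcc_of_le hT]
      exact Icc_subset_Icc_right ht.2
    rw [intervalIntegral.integral_sub (hu'.1.mono_set hs) (hu.1.mono_set hs)]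
    have := (hu'.2 t ht).sub hb (hu.2 t ht)
    rwa [sub_sub_sub_cancel_right] at this
  have h0 := integral_eq_zero_of_dissipative (fun x y hxy s hs => IsAPlusB.norm_le hb hxy hs)
    (hu'.1.sub hu.1) heq ht
  -- The vanishing of the integral alone would give equality at almost every time; the equation at
  -- `t`, with `A + B` applied to zero, gives it at `t` itself.
  have h1 := heq t ht
  rw [h0] at h1
  exact sub_eq_zero.1 (h1.eq_zero hb)

end MildUniqueness

/-! ### The density of collision trees -/

/-- The measure `dt dν dv` on markers. -/
def markerMeasure : Measure Marker := volume.prod (surf.prod volume)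

instance : SigmaFinite markerMeasure := by
  unfold markerMeasure
  exact sigmaFinite_of_locallyFinite

/-- The measure on lists of `n` markers. -/
abbrev markersMeasure (n : ℕ) : Measure (Fin n → Marker) := Measure.pi fun _ => markerMeasure

instance (n : ℕ) : SigmaFinite (markersMeasure n) := Measure.pi.sigmaFinite _

/-- The measure on the trees with `n` collisions. -/
def levelMeasure (n : ℕ) : Measure (Phase × (Fin n → Marker)) :=
  volume.prod (markersMeasure n)

instance (n : ℕ) : SigmaFinite (levelMeasure n) := Measure.prod.instSigmaFinite

/-- The solution of the idealized equation at time `t`, on the trees with `n` collisions. -/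
def treeDensity (f₀ : Phase → ℝ) (g₀ : Vel → ℝ) : (n : ℕ) → Phase → (Fin n → Marker) → ℝ → ℝ
  | 0, z, _, t => f₀ z * Real.exp (-(t * lossRate g₀ z.2))
  | n + 1, z, m, t =>
      let last := m (Fin.last n)
      let before := rootAux n z (Fin.init m) last.1
      if last.1 ∈ Ioc 0 t then
        treeDensity f₀ g₀ n z (Fin.init m) last.1
          * (g₀ last.2.2 * crossSection before.2 last.2.2 last.2.1)
          * Real.exp (-((t - last.1) * lossRate g₀ (scatter before.2 last.2.1 last.2.2)))
      else 0

/-- The density of trees with values in `[0, ⊤]`. -/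
def treeDensityE (L : Vel → ℝ) (g : Vel → ℝ≥0∞) (f : Phase → ℝ≥0∞) :
    (n : ℕ) → Phase → (Fin n → Marker) → ℝ → ℝ≥0∞
  | 0, z, _, t => f z * damp L t z.2
  | n + 1, z, m, t =>
      let last := m (Fin.last n)
      let before := rootAux n z (Fin.init m) last.1
      if last.1 ∈ Ioc 0 t then
        treeDensityE L g f n z (Fin.init m) last.1
          * (g last.2.2 * ENNReal.ofReal (crossSection before.2 last.2.2 last.2.1))
          * damp L (t - last.1) (scatter before.2 last.2.1 last.2.2)
      else 0

/-- The recursion evaluates the pruned tree at the last collision time with an interval closed on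
the right, so simultaneous collisions are not excluded and monotonicity is not strict. -/
lemma times_of_treeDensity_ne_zero {f₀ : Phase → ℝ} {g₀ : Vel → ℝ} {n : ℕ} {z : Phase}
    {m : Fin n → Marker} {t : ℝ} (h : treeDensity f₀ g₀ n z m t ≠ 0) :
    (∀ j, (m j).1 ∈ Ioc 0 t) ∧ Monotone fun j => (m j).1 := by
  induction n generalizing t with
  | zero => exact ⟨fun j => j.elim0, fun j => j.elim0⟩
  | succ n ih =>
    simp only [treeDensity] at h
    split_ifs at h with hl
    · obtain ⟨h1, h2⟩ := ih (m := Fin.init m) (left_ne_zero_of_mul (left_ne_zero_of_mul h))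
      refine ⟨fun j => ?_, fun i j => ?_⟩
      · refine Fin.lastCases hl (fun j => ?_) j
        exact ⟨(h1 j).1, (h1 j).2.trans hl.2⟩
      · refine Fin.lastCases (fun hij => ?_) (fun j hij => ?_) j
        · refine Fin.lastCases le_rfl (fun i => ?_) i
          exact (h1 i).2
        · induction i using Fin.lastCases with
          | last => exact absurd hij (by simp [Fin.le_def])
          | cast i => exact h2 (Fin.castSucc_le_castSucc_iff.1 hij)
    · exact absurd rfl h

lemma treeDensity_eq_toReal {f₀ : Phase → ℝ} {g₀ : Vel → ℝ} {f : Phase → ℝ≥0∞} {g : Vel → ℝ≥0∞}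
    {n : ℕ} {z : Phase} {m : Fin n → Marker} (hz : f₀ z = (f z).toReal)
    (hm : ∀ j, g₀ (m j).2.2 = (g (m j).2.2).toReal) (t : ℝ) :
    treeDensity f₀ g₀ n z m t = (treeDensityE (lossRate g₀) g f n z m t).toReal := by
  induction n generalizing t with
  | zero => simp [treeDensity, treeDensityE, damp, hz, ENNReal.toReal_ofReal, Real.exp_nonneg]
  | succ n ih =>
    simp only [treeDensity, treeDensityE]
    rw [ih (m := Fin.init m) fun j => hm j.castSucc]
    split_ifs with hl
    · simp [damp, hm, ENNReal.toReal_ofReal, Real.exp_nonneg, crossSection_nonneg]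
    · rfl

lemma measurable_rootAux (n : ℕ) :
    Measurable fun q : (Phase × (Fin n → Marker)) × ℝ => rootAux n q.1.1 q.1.2 q.2 := by
  induction n with
  | zero => simp only [rootAux]; fun_prop
  | succ n ih =>
    simp only [rootAux]
    have hi : Measurable fun q : (Phase × (Fin (n + 1) → Marker)) × ℝ =>
        ((q.1.1, Fin.init q.1.2) : Phase × (Fin n → Marker)) :=
      measurable_fst.fst.prodMk (measurable_pi_lambda _ fun j =>
        (measurable_pi_apply _).comp measurable_fst.snd)
    have hl : Measurable fun q : (Phase × (Fin (n + 1) → Marker)) × ℝ => q.1.2 (Fin.last n) :=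
      (measurable_pi_apply _).comp measurable_fst.snd
    have h1 := ih.comp (hi.prodMk measurable_snd)
    have h2 := ih.comp (hi.prodMk hl.fst)
    simp only [Function.comp_def] at h1 h2
    exact Measurable.ite (measurableSet_lt measurable_snd hl.fst) h1 (by fun_prop)

lemma measurable_treeDensityE {L : Vel → ℝ} (hL : Measurable L) {g : Vel → ℝ≥0∞} (hg : Measurable g)
    {f : Phase → ℝ≥0∞} (hf : Measurable f) (n : ℕ) :
    Measurable fun q : (Phase × (Fin n → Marker)) × ℝ => treeDensityE L g f n q.1.1 q.1.2 q.2 := by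
  induction n with
  | zero =>
    simp only [treeDensityE]
    exact (hf.comp measurable_fst.fst).mul (measurable_damp hL measurable_snd measurable_fst.fst.snd)
  | succ n ih =>
    simp only [treeDensityE]
    have hi : Measurable fun q : (Phase × (Fin (n + 1) → Marker)) × ℝ =>
        ((q.1.1, Fin.init q.1.2) : Phase × (Fin n → Marker)) :=
      measurable_fst.fst.prodMk (measurable_pi_lambda _ fun j =>
        (measurable_pi_apply _).comp measurable_fst.snd)
    have hl : Measurable fun q : (Phase × (Fin (n + 1) → Marker)) × ℝ => q.1.2 (Fin.last n) :=
      (measurable_pi_apply _).comp measurable_fst.snd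
    have h1 := ih.comp (hi.prodMk hl.fst)
    have h2 := (measurable_rootAux n).comp (hi.prodMk hl.fst)
    simp only [Function.comp_def] at h1 h2
    refine Measurable.ite ?_ ?_ measurable_const
    · exact (measurableSet_lt measurable_const hl.fst).inter
        (measurableSet_le hl.fst measurable_snd)
    · refine (h1.mul (by fun_prop)).mul ?_
      exact measurable_damp hL (by fun_prop) (by fun_prop)

/-- Tonelli with the last marker split off; this is the measure-theoretic form of pruning. -/
lemma lintegral_levelMeasure_succ {n : ℕ} {G : (Phase × (Fin n → Marker)) × Marker → ℝ≥0∞}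
    (hG : Measurable G) :
    ∫⁻ p, G ((p.1, Fin.init p.2), p.2 (Fin.last n)) ∂(levelMeasure (n + 1))
      = ∫⁻ a, ∫⁻ p, G (p, a) ∂(levelMeasure n) ∂markerMeasure := by
  have hi : Measurable fun p : Phase × (Fin (n + 1) → Marker) =>
      (((p.1, Fin.init p.2), p.2 (Fin.last n)) : (Phase × (Fin n → Marker)) × Marker) :=
    (measurable_fst.prodMk (measurable_pi_lambda _ fun j =>
      (measurable_pi_apply _).comp measurable_snd)).prodMk
      ((measurable_pi_apply _).comp measurable_snd)
  have key : ∀ z : Phase, ∫⁻ m, G ((z, Fin.init m), m (Fin.last n))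
      ∂(markersMeasure (n + 1)) = ∫⁻ m, ∫⁻ a, G ((z, m), a) ∂markerMeasure ∂(markersMeasure n) := by
    intro z
    have hmp := measurePreserving_piFinSuccAbove (fun _ : Fin (n + 1) => markerMeasure) (Fin.last n)
    have hF : Measurable fun q : Marker × (Fin n → Marker) => G ((z, q.2), q.1) := by fun_prop
    have h1 := hmp.lintegral_comp hF
    rw [lintegral_prod_symm _ hF.aemeasurable] at h1
    rw [← h1]
    refine lintegral_congr fun m => ?_
    have h2 : (MeasurableEquiv.piFinSuccAbove (fun _ : Fin (n + 1) => Marker) (Fin.last n)) m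
        = (m (Fin.last n), Fin.init m) := by
      rw [← Fin.removeNth_last]; rfl
    rw [h2]
  have hGi := hG.comp hi
  simp only [Function.comp_def] at hGi
  rw [levelMeasure, lintegral_prod _ hGi.aemeasurable]
  simp_rw [key]
  rw [lintegral_lintegral_swap (μ := markerMeasure) (ν := levelMeasure n) (by fun_prop),
    levelMeasure, lintegral_prod _ (by fun_prop)]

/-- For each pair of indices, fixing all markers but one leaves a single forbidden value for its
time, which is a null set. -/
lemma ae_injective_times (n : ℕ) :
    ∀ᵐ p ∂(levelMeasure n), Function.Injective fun j => (p.2 j).1 := by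
  suffices h : ∀ᵐ m ∂(markersMeasure n),
      Function.Injective fun j => (m j).1 from Measure.quasiMeasurePreserving_snd.ae h
  cases n with
  | zero => exact Filter.Eventually.of_forall fun m i => i.elim0
  | succ n =>
    have h : ∀ i : Fin (n + 1), ∀ k : Fin n,
        ∀ᵐ m ∂(markersMeasure (n + 1)),
          (m i).1 ≠ (m (i.succAbove k)).1 := by
      intro i k
      have hmp := measurePreserving_piFinSuccAbove (fun _ : Fin (n + 1) => markerMeasure) i
      have hs : MeasurableSet {q : (Fin n → Marker) × Marker | q.2.1 ≠ (q.1 k).1} :=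
        (measurableSet_eq_fun (by fun_prop) (by fun_prop)).compl
      have h1 : ∀ᵐ q ∂((markersMeasure n).prod markerMeasure),
          q.2.1 ≠ (q.1 k).1 := by
        refine (Measure.ae_prod_iff_ae_ae hs).2 (Filter.Eventually.of_forall fun m => ?_)
        exact Measure.quasiMeasurePreserving_fst.ae (Measure.ae_ne volume (m k).1)
      exact hmp.quasiMeasurePreserving.ae
        (Measure.measurePreserving_swap.quasiMeasurePreserving.ae h1)
    filter_upwards [ae_all_iff.2 fun i => ae_all_iff.2 (h i)] with m hm i j hij
    by_contra hne
    obtain ⟨k, rfl⟩ := Fin.exists_succAbove_eq (Ne.symm hne)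
    exact hm i k hij

lemma lintegral_treeDensityE_zero {L : Vel → ℝ} (hL : Measurable L) {g : Vel → ℝ≥0∞}
    {f : Phase → ℝ≥0∞} (hf : Measurable f) {t : ℝ} (ht : 0 ≤ t) {ψ : Phase → ℝ≥0∞}
    (hψ : Measurable ψ) :
    ∫⁻ p, ψ (rootAux 0 p.1 p.2 t) * treeDensityE L g f 0 p.1 p.2 t ∂(levelMeasure 0)
      = ∫⁻ z, ψ z * collisionSeries L g f 0 t z := by
  have hd := measurable_damp hL (a := fun p : ℝ × Phase => t - p.1) (b := fun p => p.2.2)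
    (by fun_prop) (by fun_prop)
  have h1 := evolves_freeE hL hf t ht ψ hψ
  rw [lintegral_initMeasure hf (by fun_prop) ht] at h1
  simp only [collisionSeries, h1, rootAux, treeDensityE]
  have hd' : Measurable fun p : Phase × (Fin 0 → Marker) => damp L t p.1.2 :=
    measurable_damp hL measurable_const measurable_fst.snd
  have hm : Measurable fun p : Phase × (Fin 0 → Marker) =>
      ψ (freeFlow t p.1) * (f p.1 * damp L t p.1.2) :=
    (hψ.comp (measurable_freeFlow_comp measurable_const measurable_fst)).mul
      ((hf.comp measurable_fst).mul hd')
  rw [levelMeasure, lintegral_prod _ hm.aemeasurable]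
  refine lintegral_congr fun z => ?_
  dsimp only
  rw [lintegral_const, markersMeasure, Measure.pi_of_empty]
  simp only [measure_univ, sub_zero]
  ring

/-- Decomposition by the time `s` of the last collision, with that collision and the subsequent
damped flight moved onto the test function. -/
lemma lintegral_mul_collisionSeries_succ {L : Vel → ℝ} (hL : Measurable L) {g : Vel → ℝ≥0∞}
    (hg : Measurable g) {f : Phase → ℝ≥0∞} (hf : Measurable f) (n : ℕ) {t : ℝ} (ht : 0 ≤ t)
    {ψ : Phase → ℝ≥0∞} (hψ : Measurable ψ) :
    ∫⁻ z, ψ z * collisionSeries L g f (n + 1) t z = ∫⁻ s in Ioc 0 t, ∫⁻ z,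
      adjointGainE g (fun y => damp L (t - s) y.2 * ψ (freeFlow (t - s) y)) z
        * collisionSeries L g f n s z := by
  have hcs := measurable_collisionSeries hL hg hf n
  have hd := measurable_damp hL (a := fun p : ℝ × Phase => t - p.1) (b := fun p => p.2.2)
    (by fun_prop) (by fun_prop)
  have hq := measurable_gainE hg hcs
  rw [collisionSeries, evolves_duhamelE hL hq t ht ψ hψ,
    lintegral_sourceMeasure hq (by fun_prop)]
  refine lintegral_congr fun s => ?_
  have hΨ : Measurable fun y : Phase => damp L (t - s) y.2 * ψ (freeFlow (t - s) y) :=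
    (measurable_damp hL measurable_const measurable_snd).mul (by fun_prop)
  have h2 := lintegral_gainE hg (hcs.comp (f := fun z : Phase => (s, z)) (by fun_prop)) hΨ
  calc _ = ∫⁻ z : Phase, (damp L (t - s) z.2 * ψ (freeFlow (t - s) z)) *
        gainE g (collisionSeries L g f n s) z := lintegral_congr fun z => mul_comm _ _
    _ = _ := h2
    _ = _ := lintegral_congr fun z => mul_comm _ _

/-- The law at time `t` of the tagged particle of a tree with `n` collisions. -/
lemma lintegral_treeDensityE {L : Vel → ℝ} (hL : Measurable L) {g : Vel → ℝ≥0∞} (hg : Measurable g)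
    {f : Phase → ℝ≥0∞} (hf : Measurable f) (n : ℕ) {t : ℝ} (ht : 0 ≤ t) {ψ : Phase → ℝ≥0∞}
    (hψ : Measurable ψ) :
    ∫⁻ p, ψ (rootAux n p.1 p.2 t) * treeDensityE L g f n p.1 p.2 t ∂(levelMeasure n)
      = ∫⁻ z, ψ z * collisionSeries L g f n t z := by
  induction n generalizing t ψ with
  | zero => exact lintegral_treeDensityE_zero hL hf ht hψ
  | succ n ih =>
    set Ψ : ℝ → Phase → ℝ≥0∞ := fun s y => damp L s y.2 * ψ (freeFlow s y) with hΨ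
    have hΨm : ∀ s, Measurable (Ψ s) := fun s =>
      (measurable_damp hL measurable_const measurable_snd).mul (by fun_prop)
    rw [lintegral_mul_collisionSeries_succ hL hg hf n ht hψ]
    set G : (Phase × (Fin n → Marker)) × Marker → ℝ≥0∞ := fun q =>
      if q.2.1 ∈ Ioc 0 t then treeDensityE L g f n q.1.1 q.1.2 q.2.1 *
        (Ψ (t - q.2.1) ((rootAux n q.1.1 q.1.2 q.2.1).1,
            scatter (rootAux n q.1.1 q.1.2 q.2.1).2 q.2.2.1 q.2.2.2) * g q.2.2.2 *
          ENNReal.ofReal (crossSection (rootAux n q.1.1 q.1.2 q.2.1).2 q.2.2.2 q.2.2.1))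
      else 0 with hG
    have hGm : Measurable G := by
      have hr := (measurable_rootAux n).comp
        (f := fun q : (Phase × (Fin n → Marker)) × Marker => (q.1, q.2.1)) (by fun_prop)
      have hp := (measurable_treeDensityE hL hg hf n).comp
        (f := fun q : (Phase × (Fin n → Marker)) × Marker => (q.1, q.2.1)) (by fun_prop)
      simp only [Function.comp_def] at hr hp
      refine Measurable.ite ?_ (hp.mul ((Measurable.mul ?_ (by fun_prop)).mul (by fun_prop)))
        measurable_const
      · exact (measurable_fst.comp measurable_snd) measurableSet_Ioc
      · exact (measurable_damp hL (by fun_prop) (by fun_prop)).mul (by fun_prop)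
    have h2 : ∀ p : Phase × (Fin (n + 1) → Marker),
        ψ (rootAux (n + 1) p.1 p.2 t) * treeDensityE L g f (n + 1) p.1 p.2 t
          = G ((p.1, Fin.init p.2), p.2 (Fin.last n)) := by
      intro p
      simp only [rootAux, treeDensityE, hG]
      -- At `t` equal to the last collision time, the root has already scattered and the density
      -- already counts the tree, so the conventions agree.
      split_ifs with h3 h4 h4
      · exact absurd h3 h4.2.not_gt
      · simp
      · simp only [hΨ]
        ring
      · simp
    simp_rw [h2]
    rw [lintegral_levelMeasure_succ hGm, markerMeasure, lintegral_prod _ (by fun_prop)]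
    have h3 : ∀ s, ∫⁻ r : Sph × Vel, ∫⁻ p, G (p, s, r) ∂(levelMeasure n) ∂(surf.prod volume)
        = (Ioc 0 t).indicator (fun s => ∫⁻ z, adjointGainE g (Ψ (t - s)) z *
          collisionSeries L g f n s z) s := by
      intro s
      by_cases hs : s ∈ Ioc 0 t
      -- The induction hypothesis is used at the collision time `s` with the adjoint gain as test
      -- function: integrating out `(ν, w)` at fixed `s` produces exactly this function of the root
      -- of the pruned tree.
      · rw [indicator_of_mem hs, ← ih hs.1.le (measurable_adjointGainE hg (hΨm (t - s))),
          lintegral_lintegral_swap (by fun_prop)]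
        refine lintegral_congr fun p => ?_
        have := hΨm (t - s)
        simp only [hG, hs, if_true]
        rw [lintegral_const_mul _ (by fun_prop), mul_comm, adjointGainE]
      · simp only [indicator_of_notMem hs, hG, hs, if_false, lintegral_zero]
    simp_rw [h3]
    rw [lintegral_indicator measurableSet_Ioc]

/-! ### The idealized equation -/

section Idealized

lemma integral_exp_decay (c l τ t : ℝ) :
    ∫ s in τ..t, c * Real.exp (-((s - τ) * l)) * l = c - c * Real.exp (-((t - τ) * l)) := by
  have h : ∀ s ∈ uIcc τ t, HasDerivAt (fun s => -(c * Real.exp (-((s - τ) * l))))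
      (c * Real.exp (-((s - τ) * l)) * l) s := by
    intro s _
    have h1 : HasDerivAt (fun s : ℝ => -((s - τ) * l)) (-(1 * l)) s :=
      (((hasDerivAt_id s).sub_const τ).mul_const l).neg
    exact (h1.exp.const_mul c).neg.congr_deriv (by ring)
  rw [intervalIntegral.integral_eq_sub_of_hasDerivAt h
    (Continuous.intervalIntegrable (by fun_prop) _ _)]
  simp
  ring

lemma ite_mem_Ioc_eq_indicator {τ : ℝ} (hτ : 0 < τ) (h : ℝ → ℝ) :
    (fun s => if τ ∈ Ioc 0 s then h s else 0) = (Ici τ).indicator h := by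
  ext s
  simp [indicator_apply, hτ]

lemma integral_exp_decay_after {τ t : ℝ} (hτ : 0 < τ) (ht : 0 ≤ t) (c l : ℝ) :
    ∫ s in (0 : ℝ)..t, (if τ ∈ Ioc 0 s then c * Real.exp (-((s - τ) * l)) else 0) * l
      = if τ ∈ Ioc 0 t then c - c * Real.exp (-((t - τ) * l)) else 0 := by
  have h1 : (fun s => (if τ ∈ Ioc 0 s then c * Real.exp (-((s - τ) * l)) else 0) * l)
      = (Ici τ).indicator fun s => c * Real.exp (-((s - τ) * l)) * l := by
    rw [← ite_mem_Ioc_eq_indicator hτ]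
    ext s
    rw [ite_mul, zero_mul]
  have h2 : Ioc 0 t ∩ Ici τ = Icc τ t := by
    ext s
    simp only [mem_inter_iff, mem_Ioc, mem_Ici, mem_Icc]
    constructor
    · rintro ⟨⟨_, h⟩, h'⟩; exact ⟨h', h⟩
    · rintro ⟨h, h'⟩; exact ⟨⟨hτ.trans_le h, h'⟩, h⟩
  rw [h1, intervalIntegral.integral_of_le ht, setIntegral_indicator measurableSet_Ici, h2]
  split_ifs with h
  · rw [integral_Icc_eq_integral_Ioc, ← intervalIntegral.integral_of_le h.2, integral_exp_decay]
  · rw [Icc_eq_empty fun h' => h ⟨hτ, h'⟩]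
    simp

/-- The solution of the idealized equation at time `t`. -/
def treeSolution (f₀ : Phase → ℝ) (g₀ : Vel → ℝ) (t : ℝ) (Φ : Tree) : ℝ :=
  treeDensity f₀ g₀ Φ.1 Φ.2.1 Φ.2.2 t

variable {f₀ : Phase → ℝ} {g₀ : Vel → ℝ} {T : ℝ}

lemma treeSolution_initial (f₀ : Phase → ℝ) (g₀ : Vel → ℝ) (Φ : Tree) :
    treeSolution f₀ g₀ 0 Φ = if Φ.1 = 0 then f₀ Φ.2.1 else 0 := by
  rcases Φ with ⟨_ | n, z, m⟩ <;> simp [treeSolution, treeDensity]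

lemma treeSolution_intervalIntegrable {Φ : Tree} (hΦ : Φ ∈ MT T) (hT : 0 ≤ T) :
    IntervalIntegrable (fun s => treeSolution f₀ g₀ s Φ) volume 0 T := by
  rcases Φ with ⟨_ | n, z, m⟩
  · simp only [treeSolution, treeDensity]
    exact Continuous.intervalIntegrable (by fun_prop) _ _
  · simp only [treeSolution, treeDensity]
    rw [ite_mem_Ioc_eq_indicator (hΦ.1 (Fin.last n)).1, intervalIntegrable_iff_integrableOn_Ioc_of_le hT]
    refine Integrable.indicator ?_ measurableSet_Ici
    exact (Continuous.intervalIntegrable (by fun_prop) 0 T).1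

/-- Without collisions there is pure exponential decay from `f₀`. Otherwise the density is zero
before `τ`, jumps at `τ` by the coefficient of the Dirac mass, and then decays at the rate of the
velocity after the collision, which is the velocity of `root` at `τ`. -/
lemma treeSolution_equation {Φ : Tree} (hΦ : Φ ∈ MT T) {t : ℝ} (ht : 0 ≤ t) :
    treeSolution f₀ g₀ t Φ = treeSolution f₀ g₀ 0 Φ
      + (∫ s in Icc (0 : ℝ) t, treeGain g₀ (treeSolution f₀ g₀ s) Φ
          ∂(Measure.dirac (finalTime Φ)))
      - ∫ s in (0 : ℝ)..t, treeLoss g₀ (treeSolution f₀ g₀ s) Φ := by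
  classical
  rw [setIntegral_dirac, treeSolution_initial]
  rcases Φ with ⟨_ | n, z, m⟩
  · have h := integral_exp_decay (f₀ z) (lossRate g₀ z.2) 0 t
    simp only [sub_zero] at h
    simp [treeSolution, treeDensity, treeGain, treeLoss, root, rootAux, freeFlow_snd, h]
  · have hτ := (hΦ.1 (Fin.last n)).1
    dsimp only at hτ
    have hv : (root ⟨n + 1, z, m⟩ (m (Fin.last n)).1).2
        = scatter (rootAux n z (Fin.init m) (m (Fin.last n)).1).2 (m (Fin.last n)).2.1
          (m (Fin.last n)).2.2 := by
      simp [root, rootAux]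
    simp only [treeLoss, finalTime, hv, treeSolution, treeDensity, treeGain, prune]
    rw [integral_exp_decay_after hτ ht]
    simp only [root, mem_Icc, mem_Ioc, hτ, hτ.le, true_and]
    split_ifs <;> simp_all

/-! ### Integration over all trees and the law of the root -/

lemma measurableEmbedding_sigmaMk (n : ℕ) :
    MeasurableEmbedding (Sigma.mk (β := fun n => Phase × (Fin n → Marker)) n) := by
  have hset : ∀ s : Set Tree, MeasurableSet s ↔
      ∀ n, MeasurableSet (Sigma.mk n ⁻¹' s) := fun s => by
    simp only [MeasurableSpace.measurableSet_iInf]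
    rfl
  refine ⟨sigma_mk_injective, fun s hs => (hset s).1 hs n, fun s hs => (hset _).2 fun k => ?_⟩
  by_cases h : n = k
  · subst h
    rwa [preimage_image_eq _ sigma_mk_injective]
  · rw [preimage_image_sigmaMk_of_ne (Ne.symm h)]
    exact MeasurableSet.empty

lemma measurable_of_comp_sigmaMk {β : Type*} [MeasurableSpace β] {F : Tree → β}
    (hF : ∀ n, Measurable fun p : Phase × (Fin n → Marker) => F ⟨n, p⟩) : Measurable F := by
  intro s hs
  simp only [MeasurableSpace.measurableSet_iInf]
  exact fun n => hF n hs

lemma treeMeasure_eq : treeMeasure = Measure.sum fun n => (levelMeasure n).map (Sigma.mk n) := rfl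

lemma ae_treeMeasure_iff {p : Tree → Prop} :
    (∀ᵐ Φ ∂treeMeasure, p Φ) ↔ ∀ n, ∀ᵐ q ∂(levelMeasure n), p ⟨n, q⟩ := by
  rw [treeMeasure_eq, Measure.ae_sum_iff]
  exact forall_congr' fun n => (measurableEmbedding_sigmaMk n).ae_map_iff

lemma lintegral_treeMeasure (F : Tree → ℝ≥0∞) :
    ∫⁻ Φ, F Φ ∂treeMeasure = ∑' n, ∫⁻ q, F ⟨n, q⟩ ∂(levelMeasure n) := by
  rw [treeMeasure_eq, lintegral_sum_measure]
  exact tsum_congr fun n => (measurableEmbedding_sigmaMk n).lintegral_map F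

variable {g : Vel → ℝ≥0∞} {f : Phase → ℝ≥0∞}

/-- The solution of the idealized equation with values in `[0, ⊤]`. -/
def treeSolutionE (g₀ : Vel → ℝ) (g : Vel → ℝ≥0∞) (f : Phase → ℝ≥0∞) (t : ℝ) (Φ : Tree) : ℝ≥0∞ :=
  treeDensityE (lossRate g₀) g f Φ.1 Φ.2.1 Φ.2.2 t

lemma measurable_treeSolutionE (hb : IsBackground g₀ g) (hf : Measurable f) (t : ℝ) :
    Measurable (treeSolutionE g₀ g f t) :=
  measurable_of_comp_sigmaMk fun n =>
    (measurable_treeDensityE hb.measurable_loss hb.measurable hf n).comp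
      (measurable_id.prodMk measurable_const)

lemma measurable_root (t : ℝ) : Measurable fun Φ => root Φ t :=
  measurable_of_comp_sigmaMk fun n =>
    (measurable_rootAux n).comp (measurable_id.prodMk measurable_const)

lemma lintegral_treeSolutionE (hb : IsBackground g₀ g) (hf : Measurable f) {t : ℝ} (ht : 0 ≤ t)
    {ψ : Phase → ℝ≥0∞} (hψ : Measurable ψ) :
    ∫⁻ Φ, ψ (root Φ t) * treeSolutionE g₀ g f t Φ ∂treeMeasure
      = ∫⁻ z, ψ z * solutionE g₀ g f t z := by
  rw [lintegral_treeMeasure, lintegral_mul_solutionE hb hf hψ]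
  exact tsum_congr fun n =>
    lintegral_treeDensityE hb.measurable_loss hb.measurable hf n ht hψ

/-- The idealized equation is required for every tree and so uses the given representatives `f₀`,
`g₀`. Integrals only need the measurable version, since exceptional sets of the data pull back to
null sets of trees. -/
lemma treeSolution_ae_eq (hb : IsBackground g₀ g) (hf : ∀ᵐ z, f₀ z = (f z).toReal) (t : ℝ) :
    treeSolution f₀ g₀ t =ᵐ[treeMeasure] fun Φ => (treeSolutionE g₀ g f t Φ).toReal := by
  refine ae_treeMeasure_iff.2 fun n => ?_
  have h1 : ∀ᵐ q ∂(levelMeasure n), f₀ q.1 = (f q.1).toReal :=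
    Measure.quasiMeasurePreserving_fst.ae hf
  have h2 : ∀ᵐ a ∂markerMeasure, g₀ a.2.2 = (g a.2.2).toReal :=
    (Measure.quasiMeasurePreserving_snd.comp Measure.quasiMeasurePreserving_snd).ae hb.ae_eq
  have h3 : ∀ᵐ q ∂(levelMeasure n), ∀ j, g₀ (q.2 j).2.2 = (g (q.2 j).2.2).toReal :=
    ae_all_iff.2 fun j => Measure.quasiMeasurePreserving_snd.ae
      ((Measure.quasiMeasurePreserving_eval (μ := fun _ : Fin n => markerMeasure) j).ae h2)
  filter_upwards [h1, h3] with q h1 h3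
  exact treeDensity_eq_toReal h1 h3 t

/-- A nonzero density forces ordered times in `(0, t]`, and coincident times are negligible.
Integrals over `MT T` may therefore be extended to all trees. -/
lemma treeSolution_ae_eq_zero {t : ℝ} (ht : t ≤ T) :
    ∀ᵐ Φ ∂treeMeasure, Φ ∉ MT T → treeSolution f₀ g₀ t Φ = 0 := by
  refine ae_treeMeasure_iff.2 fun n => ?_
  filter_upwards [ae_injective_times n] with q hq hΦ
  by_contra h
  obtain ⟨h1, h2⟩ := times_of_treeDensity_ne_zero h
  exact hΦ ⟨fun j => ⟨(h1 j).1, (h1 j).2.trans ht⟩, h2.strictMono_of_injective hq⟩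

lemma integrable_treeSolution (hb : IsBackground g₀ g) (hf : IsInitial f)
    (hf₀ : ∀ᵐ z, f₀ z = (f z).toReal) {t : ℝ} (ht : 0 ≤ t) :
    Integrable (treeSolution f₀ g₀ t) treeMeasure := by
  refine Integrable.congr (integrable_toReal_of_lintegral_ne_top
    (measurable_treeSolutionE hb hf.measurable t).aemeasurable ?_)
    (treeSolution_ae_eq hb hf₀ t).symm
  have h := lintegral_treeSolutionE hb hf.measurable ht (ψ := fun _ => 1) measurable_const
  simp only [one_mul] at h
  rw [h]
  exact (lintegral_solutionE_lt_top hb hf ht).ne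

lemma isIdealizedSolution_treeSolution (hb : IsBackground g₀ g) (hf : IsInitial f)
    (hf₀ : ∀ᵐ z, f₀ z = (f z).toReal) (hT : 0 ≤ T) :
    IsIdealizedSolution f₀ g₀ T (treeSolution f₀ g₀) where
  integrable _ ht := (integrable_treeSolution hb hf hf₀ ht.1).integrableOn
  initial Φ _ := treeSolution_initial f₀ g₀ Φ
  time_integrable _ hΦ := treeSolution_intervalIntegrable hΦ hT
  equation _ hΦ _ ht := treeSolution_equation hΦ ht.1

/-- Once the restriction to `MT T` is removed, this is the law of the root, summed over all numbers
of collisions and tested with the indicator of `Ω`. -/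
lemma setIntegral_treeSolution (hb : IsBackground g₀ g) (hf : IsInitial f)
    (hf₀ : ∀ᵐ z, f₀ z = (f z).toReal) {t : ℝ} (ht : t ∈ Icc 0 T) {Ω : Set Phase}
    (hΩ : MeasurableSet Ω) :
    ∫ z in Ω, solution hb hf t z = ∫ Φ in treesIn T t Ω, treeSolution f₀ g₀ t Φ ∂treeMeasure := by
  have hE := measurable_treeSolutionE hb hf.measurable t
  have hS := measurable_solutionE_apply hb hf.measurable t
  have hR : MeasurableSet {Φ : Tree | root Φ t ∈ Ω} := measurable_root t hΩ
  have h1 : ∫ Φ in treesIn T t Ω, treeSolution f₀ g₀ t Φ ∂treeMeasure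
      = ∫ Φ in {Φ | root Φ t ∈ Ω}, treeSolution f₀ g₀ t Φ ∂treeMeasure := by
    refine (setIntegral_eq_of_subset_of_ae_sdiff_eq_zero hR.nullMeasurableSet
      (fun Φ hΦ => hΦ.2) ?_).symm
    filter_upwards [treeSolution_ae_eq_zero (f₀ := f₀) (g₀ := g₀) ht.2] with Φ h hΦ
    exact h fun hMT => hΦ.2 ⟨hMT, hΦ.1⟩
  have hfin := lintegral_treeSolutionE hb hf.measurable ht.1 (ψ := fun _ => 1) measurable_const
  simp only [one_mul] at hfin
  have hlt := lintegral_solutionE_lt_top hb hf ht.1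
  rw [h1, setIntegral_congr_ae hR ((treeSolution_ae_eq hb hf₀ t).mono fun _ h _ => h),
    integral_toReal hE.aemeasurable (ae_restrict_of_ae (ae_lt_top hE (hfin.trans_lt hlt).ne)),
    setIntegral_congr_ae hΩ ((coeFn_solution hb hf ht.1).mono fun _ h _ => h),
    integral_toReal hS.aemeasurable (ae_restrict_of_ae (ae_lt_top hS hlt.ne))]
  congr 1
  have h2 := lintegral_treeSolutionE hb hf.measurable ht.1 (ψ := Ω.indicator 1)
    (measurable_one.indicator hΩ)
  rw [← lintegral_indicator hΩ, ← lintegral_indicator hR]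
  calc ∫⁻ z, Ω.indicator (solutionE g₀ g f t) z
      = ∫⁻ z, Ω.indicator 1 z * solutionE g₀ g f t z := by
        refine lintegral_congr fun z => ?_
        by_cases hz : z ∈ Ω <;> simp [hz]
    _ = _ := h2.symm
    _ = _ := by
        refine lintegral_congr fun Φ => ?_
        by_cases hz : root Φ t ∈ Ω <;> simp [hz]

end Idealized

lemma exists_isInitial {f₀ : Phase → ℝ} (hf : Integrable f₀) (hf0 : ∀ᵐ z, 0 ≤ f₀ z)
    (hm : Integrable fun z : Phase => f₀ z * (1 + ‖z.2‖ ^ 2)) :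
    ∃ f, IsInitial f ∧ ∀ᵐ z, f₀ z = (f z).toReal := by
  obtain ⟨f', hf', hff'⟩ := hf.aemeasurable
  refine ⟨fun z => ENNReal.ofReal (f' z), ⟨by fun_prop, ?_, ?_⟩, ?_⟩
  · have h := (hf.congr hff').2
    rw [HasFiniteIntegral] at h
    refine (lt_of_le_of_lt (lintegral_mono fun z => ?_) h).ne
    exact Real.ofReal_le_enorm _
  · have h := (hm.const_mul 2).2
    rw [HasFiniteIntegral] at h
    refine (lt_of_le_of_lt (lintegral_mono_ae ?_) h).ne
    filter_upwards [hff', hf0] with z h1 h2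
    rw [velWeight, ← h1, ← ENNReal.ofReal_mul (by positivity)]
    refine le_trans (ENNReal.ofReal_le_ofReal ?_) (Real.ofReal_le_enorm _)
    -- The factor `2` in `hm.const_mul 2` comes from `1 + x ≤ 2 (1 + x²)`, which dominates the first
    -- moment by the second.
    nlinarith [mul_nonneg h2 (sq_nonneg (‖z.2‖ - 1)), mul_nonneg h2 (sq_nonneg ‖z.2‖)]
  · filter_upwards [hff', hf0] with z h1 h2
    rw [ENNReal.toReal_ofReal (h1 ▸ h2), h1]

end

end RayleighGas

end

theorem theorem3p1 (T : ℝ) (hT : 0 < T)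
    (f₀ : RayleighGas.Phase → ℝ) (g₀ : RayleighGas.Vel → ℝ)
    (h : RayleighGas.Admissible f₀ g₀) :
    ∃ f : ℝ → RayleighGas.L1,
      RayleighGas.IsMildSolution (RayleighGas.IsAPlusB g₀) T (h.f_integrable.toL1 f₀) f ∧
      (∀ f' : ℝ → RayleighGas.L1,
        RayleighGas.IsMildSolution (RayleighGas.IsAPlusB g₀) T (h.f_integrable.toL1 f₀) f' →
          ∀ t ∈ Set.Icc (0 : ℝ) T, f' t = f t) ∧
      ∃ P : ℝ → RayleighGas.Tree → ℝ,
        RayleighGas.IsIdealizedSolution f₀ g₀ T P ∧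
        ∀ t ∈ Set.Icc (0 : ℝ) T, ∀ Ω : Set RayleighGas.Phase, MeasurableSet Ω →
          ∫ z in Ω, f t z = ∫ Φ in RayleighGas.treesIn T t Ω, P t Φ ∂(RayleighGas.treeMeasure) := by
  obtain ⟨g, hb⟩ := RayleighGas.exists_isBackground h.g_integrable h.g_nonneg h.g_moment
  obtain ⟨f, hf, hf₀⟩ := RayleighGas.exists_isInitial h.f_integrable h.f_nonneg h.f_moment
  have hmild := RayleighGas.isMildSolution_solution hb hf
    (h.f_integrable.coeFn_toL1.trans hf₀) hT.le
  exact ⟨RayleighGas.solution hb hf, hmild, fun f' hf' t ht => hmild.unique hb hf' ht,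
    RayleighGas.treeSolution f₀ g₀,
    RayleighGas.isIdealizedSolution_treeSolution hb hf hf₀ hT.le,
    fun t ht Ω hΩ => RayleighGas.setIntegral_treeSolution hb hf hf₀ ht hΩ⟩
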